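/- **System.** Let $N_t,N_r$ be positive integers, $n=\min(N_t,N_r)$, $L\ge 1$, $M\ge 2$. Each layer $l=1,\dots,L$ has a sparse codebook of $M$ codewords in $\mathbb C^n$, vanishing outside a set $\mathcal N_l\subseteq\{1,\dots,n\}$. The $M^L=2^\eta$ equiprobable messages ($\eta=L\log_2M$) choose one codeword $\mathbf s_l$ per layer, and the data symbol vector is $\mathbf s=\sum_l\mathbf s_l$; distinct messages have distinct vectors $\mathbf s$. The channel $\mathbf H\in\mathbb C^{N_r\times N_t}$ has i.i.d. $\mathcal{CN}(0,1)$ entries and singular value decomposition $\mathbf H=\mathbf U\boldsymbol\Sigma\mathbf V^H$ with squared singular values $\lambda_1\ge\dots\ge\lambda_n\ge0$. With $\bar{\mathbf U},\bar{\mathbf V}$ the first $n$ columns of $\mathbf U,\mathbf V$, one sends $\mathbf x=\bar{\mathbf V}\mathbf s$, receives $\mathbf y=\mathbf H\mathbf x+\mathbf n$ with independent noise $\mathbf n\sim\mathcal{CN}(0,N_0\mathbf I)$, and forms $\mathbf z=\bar{\mathbf U}^H\mathbf y$. A maximum likelihood detector returns a minimizer of $\sum_m|z_m-\sqrt{\lambda_m}\,s_m|^2$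 over all data symbol vectors. $\mathrm{AWEP}$ is the average probability that it does not return the transmitted one, and $\mathrm{SNR}=\mathbb E\|\mathbf s\|^2/N_0$, with the codebooks fixed. **Union bound.** Expand $\prod_m\lambda_m^{|N_t-N_r|}\prod_{m>m'}(\lambda_m-\lambda_{m'})^2=\sum_{p=1}^P\alpha_p\prod_m\lambda_m^{\beta_{p,m}}$ into distinct monomials with non-zero coefficients. The ordered eigenvalue density is $p(\boldsymbol\lambda)=C_{N_t,N_r}^{-1}\sum_p\alpha_p\prod_me^{-\lambda_m}\lambda_m^{\beta_{p,m}}$ on $\mathcal D=\{\lambda_1\ge\dots\ge\lambda_n\ge0\}$, with $C_{N_t,N_r}$ the normalizing factor. For a difference vector $\boldsymbol\psi=\mathbf s-\hat{\mathbf s}$ put $a_m=|\psi_m|^2/(4N_0)$, $b_m=|\psi_m|^2/(3N_0)$, $$I_1(\boldsymbol\psi)=\tfrac1{12}\int_{\mathcal D}\prod_me^{-a_m\lambda_m}p(\boldsymbol\lambda)\,d\boldsymbol\lambda,\quad I_2(\boldsymbol\psi)=\tfrac14\int_{\mathcal D}\prod_me^{-b_m\lambda_m}p(\boldsymbol\lambda)\,d\boldsymbol\lambda,$$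 $$\mathrm{AWEP}_{\mathrm{ub}}=2^{-\eta}\sum_{\mathbf s\neq\hat{\mathbf s}}\bigl(I_1(\boldsymbol\psi)+I_2(\boldsymbol\psi)\bigr).$$ **Asymptotic terms.** Let $N$ be the maximal number of leading zeros of $\mathbf s-\hat{\mathbf s}$ over pairs $\mathbf s\ne\hat{\mathbf s}$, let $\mathcal E_N$ be the family of ordered pairs $(\mathbf s,\hat{\mathbf s})$, $\mathbf s\neq\hat{\mathbf s}$, attaining it, and let $\mathcal P_N$ be the set of $p$ minimizing $B_p=\sum_{j=N+1}^n\beta_{p,j}$. Write $(x)_k=x(x+1)\cdots(x+k-1)$, $T_{p,k}=\sum_{j=k}^n(\beta_{p,j}+1)$, $c_k=1+\frac1{k-1}$ and $r_k=1+\frac{1+a_k}{k-1+a_{N+1}+\dots+a_{k-1}}$ (for $k\ge N+2$). If $N\ge1$, $$\tilde I_1(\boldsymbol\psi)=\frac1{12\,C_{N_t,N_r}}\sum_{p\in\mathcal P_N}\frac{\alpha_p\,(1)_{\beta_{p,1}}(1)_{\beta_{p,N+1}}}{\prod_{k=2}^{N}c_k^{T_{p,k+1}}}\cdot\frac1{\bigl(1+\frac{1+a_{N+1}}N\bigr)^{T_{p,N+1}}}\cdot\frac1{\prod_{k=N+2}^{n-1}r_k^{T_{p,k+1}}}\,F_p\,G_p,$$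 $$F_p=\sum_{i_1=0}^{\beta_{p,1}}\frac{(i_1+1)_{\beta_{p,2}}}{c_2^{\beta_{p,2}+i_1+1}}\sum_{i_2=0}^{\beta_{p,2}+i_1}\frac{(i_2+1)_{\beta_{p,3}}}{c_3^{\beta_{p,3}+i_2+1}}\cdots\sum_{i_{N-1}=0}^{\beta_{p,N-1}+i_{N-2}}\frac{(i_{N-1}+1)_{\beta_{p,N}}}{c_N^{\beta_{p,N}+i_{N-1}+1}},$$ $$G_p=\sum_{i_{N+1}=0}^{\beta_{p,N+1}}\frac{(i_{N+1}+1)_{\beta_{p,N+2}}}{r_{N+2}^{\beta_{p,N+2}+i_{N+1}+1}}\cdots\sum_{i_{n-1}=0}^{\beta_{p,n-1}+i_{n-2}}\frac{(i_{n-1}+1)_{\beta_{p,n}}}{r_n^{\beta_{p,n}+i_{n-1}+1}}$$ (empty products and empty nested sums are $1$). If $N=0$, the factors before $\prod_{k=N+2}^{n-1}$ are replaced by $\alpha_p(1)_{\beta_{p,1}}/(1+a_1)^{T_{p,1}}$, and $F_p=1$. $\tilde I_2$ arises from $\tilde I_1$ by replacing $\frac1{12}$ by $\frac14$ and every $a_m$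 by $b_m$. Put $$\widetilde{\mathrm{AWEP}}=2^{-\eta}\sum_{(\mathbf s,\hat{\mathbf s})\in\mathcal E_N}\bigl(\tilde I_1(\boldsymbol\psi)+\tilde I_2(\boldsymbol\psi)\bigr).$$ **Theorem.** As $\mathrm{SNR}\to\infty$: (i) $\mathrm{AWEP}_{\mathrm{ub}}\sim\widetilde{\mathrm{AWEP}}$ (the ratio tends to $1$); (ii) $\mathrm{AWEP}\le\mathrm{AWEP}_{\mathrm{ub}}$ for all sufficiently large $\mathrm{SNR}$; (iii) $\mathrm{AWEP}=\Theta(\widetilde{\mathrm{AWEP}})$. -/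

import Mathlib

open MeasureTheory ProbabilityTheory Filter Asymptotics
open scoped Matrix NNReal ENNReal

noncomputable section

namespace SLMIMO

/-! ### The code -/

/-- A sparse layered code with `L` layers, codebooks of size `M`, and `n` eigen-channels.
`support l` is the set of eigen-channels that layer `l` may use (column `l` of the sparse
layering matrix), and distinct messages have distinct data symbol vectors, so that there are
`M ^ L` data symbol vectors. -/
structure Code (n L M : ℕ) where
  codeword : Fin L → Fin M → Fin n → ℂ
  support : Fin L → Finset (Fin n)
  sparse : ∀ l j m, m ∉ support l → codeword l j m = 0
  injective : Function.Injective fun (u : Fin L → Fin M) (m : Fin n) => ∑ l, codeword l (u l) m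

variable {n L M : ℕ}

/-- The data symbol vector of a message: the sum of the codewords of all layers. -/
def Code.symbol (S : Code n L M) (u : Fin L → Fin M) : Fin n → ℂ :=
  fun m => ∑ l, S.codeword l (u l) m

/-- The difference vector `ψ` of a pair of messages. -/
def Code.diff (S : Code n L M) (q : (Fin L → Fin M) × (Fin L → Fin M)) : Fin n → ℂ :=
  S.symbol q.1 - S.symbol q.2

/-- The squared Euclidean norm of a complex vector. -/
def sqNorm (v : Fin n → ℂ) : ℝ := ∑ m, ‖v m‖ ^ 2

/-- The spectral efficiency `η = L log₂ M`. -/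
def eta (L M : ℕ) : ℝ := L * Real.logb 2 M

/-- The total transmit power, `E ‖s‖²` for equiprobable messages. -/
def Code.power (S : Code n L M) : ℝ := (1 / (M : ℝ) ^ L) * ∑ u, sqNorm (S.symbol u)

/-- The noise variance at signal-to-noise ratio `γ`. -/
def Code.noiseVar (S : Code n L M) (γ : ℝ) : ℝ := S.power / γ

/-- The number of leading zeros of a vector. -/
def leadingZeros (ψ : Fin n → ℂ) : ℕ := Set.ncard {m : Fin n | ∀ k, k ≤ m → ψ k = 0}

/-- The maximal number of leading zeros among the difference vectors of distinct messages. -/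
def Code.maxZeros (S : Code n L M) : ℕ :=
  (Finset.univ : Finset (Fin L → Fin M)).offDiag.sup fun q => leadingZeros (S.diff q)

/-- The pairs of distinct messages whose difference vector has the maximal number of leading
zeros. -/
def Code.maxPairs (S : Code n L M) : Finset ((Fin L → Fin M) × (Fin L → Fin M)) :=
  (Finset.univ : Finset (Fin L → Fin M)).offDiag.filter fun q =>
    leadingZeros (S.diff q) = S.maxZeros

/-! ### The channel and the maximum likelihood receiver -/

/-- The circularly symmetric complex Gaussian distribution with mean zero and variance `v`. -/
def cgauss (v : ℝ≥0) : Measure ℂ :=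
  ((gaussianReal 0 (v / 2)).prod (gaussianReal 0 (v / 2))).map fun p => (⟨p.1, p.2⟩ : ℂ)

/-- The law of a channel matrix with i.i.d. `CN(0,1)` entries. -/
def channelLaw (Nt Nr : ℕ) : Measure (Fin Nr → Fin Nt → ℂ) :=
  Measure.pi fun _ => Measure.pi fun _ => cgauss 1

/-- The law `CN(0, N₀ I)` of the receiver noise. -/
def noiseLaw (Nr : ℕ) (N₀ : ℝ) : Measure (Fin Nr → ℂ) :=
  Measure.pi fun _ => cgauss N₀.toNNReal

/-- The rectangular diagonal matrix with entries `√λ_m`. -/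
def sigmaMat {Nt Nr : ℕ} (lam : Fin (min Nt Nr) → ℝ) : Matrix (Fin Nr) (Fin Nt) ℂ :=
  Matrix.of fun i j =>
    if h : (i : ℕ) = (j : ℕ) then ((√(lam ⟨i, lt_min (h ▸ j.2) i.2⟩) : ℝ) : ℂ) else 0

/-- A singular value decomposition `H = U Σ Vᴴ`, with the squared singular values `lam` in
decreasing order. -/
structure SVD {Nt Nr : ℕ} (H : Matrix (Fin Nr) (Fin Nt) ℂ) where
  U : Matrix (Fin Nr) (Fin Nr) ℂ
  V : Matrix (Fin Nt) (Fin Nt) ℂ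
  lam : Fin (min Nt Nr) → ℝ
  U_mem : U ∈ Matrix.unitaryGroup (Fin Nr) ℂ
  V_mem : V ∈ Matrix.unitaryGroup (Fin Nt) ℂ
  antitone : Antitone lam
  nonneg : ∀ m, 0 ≤ lam m
  eq : H = U * sigmaMat lam * Vᴴ

section Receiver

variable {Nt Nr : ℕ} {H : Matrix (Fin Nr) (Fin Nt) ℂ}

/-- The first `min Nt Nr` columns of `U`. -/
def SVD.Ubar (D : SVD H) : Matrix (Fin Nr) (Fin (min Nt Nr)) ℂ :=
  D.U.submatrix id (Fin.castLE (min_le_right Nt Nr))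

/-- The first `min Nt Nr` columns of `V`. -/
def SVD.Vbar (D : SVD H) : Matrix (Fin Nt) (Fin (min Nt Nr)) ℂ :=
  D.V.submatrix id (Fin.castLE (min_le_left Nt Nr))

/-- The post-processed received vector `z = Ūᴴ (H x + ν)` for the transmit vector `x = V̄ s`. -/
def SVD.received (D : SVD H) (s : Fin (min Nt Nr) → ℂ) (ν : Fin Nr → ℂ) :
    Fin (min Nt Nr) → ℂ :=
  D.Ubarᴴ *ᵥ (H *ᵥ (D.Vbar *ᵥ s) + ν)

end Receiver

/-- The metric `‖z - Λ^{1/2} s‖²`. -/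
def metric (lam : Fin n → ℝ) (z s : Fin n → ℂ) : ℝ :=
  sqNorm fun m => z m - ((√(lam m) : ℝ) : ℂ) * s m

/-- `dec` is a maximum likelihood detector: it always returns a message of minimal metric. -/
def Code.IsML (S : Code n L M) (dec : (Fin n → ℝ) → (Fin n → ℂ) → (Fin L → Fin M)) : Prop :=
  ∀ lam z u, metric lam z (S.symbol (dec lam z)) ≤ metric lam z (S.symbol u)

/-- The average word error probability at noise variance `N₀`: the probability that the detected
message is not the transmitted one, averaged over the noise, the channel and the messages. -/
def awep {Nt Nr : ℕ} (S : Code (min Nt Nr) L M)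
    (svd : ∀ H : Matrix (Fin Nr) (Fin Nt) ℂ, SVD H)
    (dec : (Fin (min Nt Nr) → ℝ) → (Fin (min Nt Nr) → ℂ) → (Fin L → Fin M)) (N₀ : ℝ) : ℝ :=
  (1 / (M : ℝ) ^ L) * ∑ u : Fin L → Fin M,
    (∫⁻ H, noiseLaw Nr N₀ {ν | dec (svd (Matrix.of H)).lam
      ((svd (Matrix.of H)).received (S.symbol u) ν) ≠ u} ∂channelLaw Nt Nr).toReal

/-! ### The ordered eigenvalue density and the union bound -/

/-- `|Nt - Nr|` -/
def gap (Nt Nr : ℕ) : ℕ := Int.natAbs ((Nt : ℤ) - (Nr : ℤ))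

/-- The polynomial factor `∏ λ_m^|Nt-Nr| ∏_{m > m'} (λ_m - λ_m')²` of the joint density. -/
def eigPoly (Nt Nr : ℕ) : MvPolynomial (Fin (min Nt Nr)) ℝ :=
  (∏ m, MvPolynomial.X m ^ gap Nt Nr) *
    ∏ m, ∏ m' ∈ Finset.univ.filter (fun m' => m' < m), (MvPolynomial.X m - MvPolynomial.X m') ^ 2

/-- The domain `λ₁ ≥ λ₂ ≥ ⋯ ≥ λ_n ≥ 0`. -/
def ordDomain (n : ℕ) : Set (Fin n → ℝ) := {lam | Antitone lam ∧ ∀ m, 0 ≤ lam m}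

/-- The joint density of the ordered eigenvalues, up to normalization. -/
def unnormDensity (Nt Nr : ℕ) (lam : Fin (min Nt Nr) → ℝ) : ℝ :=
  (∏ m, Real.exp (-lam m)) * MvPolynomial.eval lam (eigPoly Nt Nr)

/-- The normalizing factor `C_{Nt,Nr}`. -/
def normC (Nt Nr : ℕ) : ℝ := ∫ lam in ordDomain (min Nt Nr), unnormDensity Nt Nr lam

/-- The expectation of `∏ e^{-a_m λ_m}` under the joint density of the ordered eigenvalues. -/
def mgfNeg (Nt Nr : ℕ) (a : Fin (min Nt Nr) → ℝ) : ℝ :=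
  ∫ lam in ordDomain (min Nt Nr),
    (∏ m, Real.exp (-(a m * lam m))) * (1 / normC Nt Nr * unnormDensity Nt Nr lam)

/-- `a_m = |ψ_m|² / (4 N₀)` -/
def coefA (ψ : Fin n → ℂ) (N₀ : ℝ) : Fin n → ℝ := fun m => ‖ψ m‖ ^ 2 / (4 * N₀)

/-- `b_m = |ψ_m|² / (3 N₀)` -/
def coefB (ψ : Fin n → ℂ) (N₀ : ℝ) : Fin n → ℝ := fun m => ‖ψ m‖ ^ 2 / (3 * N₀)

/-- `I₁(ψ)` -/
def I1 (Nt Nr : ℕ) (ψ : Fin (min Nt Nr) → ℂ) (N₀ : ℝ) : ℝ := 1 / 12 * mgfNeg Nt Nr (coefA ψ N₀)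

/-- `I₂(ψ)` -/
def I2 (Nt Nr : ℕ) (ψ : Fin (min Nt Nr) → ℂ) (N₀ : ℝ) : ℝ := 1 / 4 * mgfNeg Nt Nr (coefB ψ N₀)

/-- The union bound on the average word error probability. -/
def unionBound {Nt Nr : ℕ} (S : Code (min Nt Nr) L M) (N₀ : ℝ) : ℝ :=
  1 / (2 : ℝ) ^ eta L M *
    ∑ q ∈ (Finset.univ : Finset (Fin L → Fin M)).offDiag,
      (I1 Nt Nr (S.diff q) N₀ + I2 Nt Nr (S.diff q) N₀)

/-! ### The asymptotic terms -/

/-- The entry of a vector with indices counted from one. -/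
def at1 {R : Type*} [Zero R] (f : Fin n → R) (k : ℕ) : R :=
  if h : 1 ≤ k ∧ k ≤ n then f ⟨k - 1, by omega⟩ else 0

/-- The `d`-fold nested sum
`∑_{i_k = 0}^{U} (i_k + 1)_{β_{k+1}} / r_{k+1} ^ (β_{k+1} + i_k + 1)
  ∑_{i_{k+1} = 0}^{β_{k+1} + i_k} (i_{k+1} + 1)_{β_{k+2}} / r_{k+2} ^ (β_{k+2} + i_{k+1} + 1) ⋯`. -/
def nested (r : ℕ → ℝ) (β : ℕ → ℕ) : (d k U : ℕ) → ℝ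
  | 0, _, _ => 1
  | d + 1, k, U => ∑ i ∈ Finset.range (U + 1),
      ((i + 1).ascFactorial (β (k + 1)) : ℝ) / r (k + 1) ^ (β (k + 1) + i + 1) *
        nested r β d (k + 1) (β (k + 1) + i)

/-- `B_p = ∑_{j > N} β_{p,j}` -/
def tailDeg (N : ℕ) (p : Fin n →₀ ℕ) : ℕ := ∑ j ∈ Finset.Icc (N + 1) n, at1 p j

/-- The monomials of the expanded density for which `B_p` is minimal. -/
def minMonomials (Nt Nr N : ℕ) : Finset (Fin (min Nt Nr) →₀ ℕ) :=
  (eigPoly Nt Nr).support.filter fun p => ∀ q ∈ (eigPoly Nt Nr).support, tailDeg N p ≤ tailDeg N q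

/-- The factor `1 + 1 / (k - 1)`. -/
def constRatio (k : ℕ) : ℝ := 1 + 1 / ((k : ℝ) - 1)

/-- The factor `1 + (1 + a_k) / (k - 1 + a_{N+1} + ⋯ + a_{k-1})`. -/
def ratio (N : ℕ) (a : ℕ → ℝ) (k : ℕ) : ℝ :=
  1 + (1 + a k) / ((k : ℝ) - 1 + ∑ j ∈ Finset.Icc (N + 1) (k - 1), a j)

/-- The contribution, without the coefficient `α_p`, of the monomial with exponents
`β 1, …, β n`. For `N = 0` the quotient in `(1 + (1 + a_{N+1}) / N)` makes no sense, and the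
SNR-dependent factor is `(1 + a₁) ^ (β₁ + ⋯ + β_n + n)`. -/
def monomialTerm (n N : ℕ) (a : ℕ → ℝ) (β : ℕ → ℕ) : ℝ :=
  (if N = 0 then
      ((1 : ℕ).ascFactorial (β 1) : ℝ) /
        (1 + a 1) ^ ((∑ j ∈ Finset.Icc 1 n, β j) + n)
    else
      ((1 : ℕ).ascFactorial (β 1) : ℝ) * ((1 : ℕ).ascFactorial (β (N + 1)) : ℝ) /
          (∏ k ∈ Finset.Icc 2 N,
            constRatio k ^ ((∑ j ∈ Finset.Icc (k + 1) n, β j) + (n - k))) *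
        (1 / (1 + (1 + a (N + 1)) / (N : ℝ)) ^
          ((∑ j ∈ Finset.Icc (N + 1) n, β j) + (n - N)))) *
    (1 / ∏ k ∈ Finset.Icc (N + 2) (n - 1),
      ratio N a k ^ ((∑ j ∈ Finset.Icc (k + 1) n, β j) + (n - k))) *
    nested constRatio β (N - 1) 1 (β 1) *
    nested (ratio N a) β (n - 1 - N) (N + 1) (β (N + 1))

/-- The sum over the minimal monomials, with the factor `1 / C_{Nt,Nr}`. -/
def asymSum (Nt Nr N : ℕ) (a : Fin (min Nt Nr) → ℝ) : ℝ :=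
  1 / normC Nt Nr * ∑ p ∈ minMonomials Nt Nr N,
    MvPolynomial.coeff p (eigPoly Nt Nr) * monomialTerm (min Nt Nr) N (at1 a) (at1 p)

/-- `Ĩ₁(ψ)` -/
def I1tilde (Nt Nr N : ℕ) (ψ : Fin (min Nt Nr) → ℂ) (N₀ : ℝ) : ℝ :=
  1 / 12 * asymSum Nt Nr N (coefA ψ N₀)

/-- `Ĩ₂(ψ)` -/
def I2tilde (Nt Nr N : ℕ) (ψ : Fin (min Nt Nr) → ℂ) (N₀ : ℝ) : ℝ :=
  1 / 4 * asymSum Nt Nr N (coefB ψ N₀)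

/-- The high-SNR approximation of the average word error probability. -/
def asymAwep {Nt Nr : ℕ} (S : Code (min Nt Nr) L M) (N₀ : ℝ) : ℝ :=
  1 / (2 : ℝ) ^ eta L M *
    ∑ q ∈ S.maxPairs,
      (I1tilde Nt Nr S.maxZeros (S.diff q) N₀ + I2tilde Nt Nr S.maxZeros (S.diff q) N₀)

end SLMIMO

end

/-! Given the channel, one message is mistaken for another when a Gaussian projection of the noise
exceeds half a squared distance, with probability `gaussTail y`, `y = ∑ a_m λ_m`. The Gaussian tail
is a mixture of the exponentials `exp (-(1 + u) y)`, so everything reduces to the Laplace transform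
`mgfNeg` of the ordered eigenvalue density. If `mgfNeg (t a)` is asymptotic to `c / t ^ K`, then the
averaged pairwise error is asymptotic to `c * tailMoment K / t ^ K` (`tendsto_pairError`) and `I₁ +
I₂` to `c * boundWeight K / t ^ K` (`tendsto_scaled`), with the same `c`. The numerical inequality
`tailMoment_lt` and a union bound give (ii). Since a single dominant pair bounds the error from
below, (iii) follows from (i) and (ii).

For (i), the polynomial in the density is expanded and each monomial is integrated exactly over the
ordered cone (`lintegral_ordDomain`). The result is a nested sum in the ratios of consecutive
partial sums of the exponential rates (`coneVal_eq`). For a difference vector with `N ≥ 1` leading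
zeros only the ratio with index `N + 1` diverges, and the nested sum splits there into the two
factors `F_p` and `G_p` (`tendsto_nested_split`). The contribution of a monomial converges after
multiplication by `t ^ (B_p + n - N)`, so the monomials with minimal `B_p` remain. Their
coefficients have both signs and might cancel. This is excluded by a lower bound for the integral
over a box where the first `N` eigenvalues have order one and the others order `1 / t`
(`exists_le_mgfNeg`), together with a bound for the degree in the trailing variables
(`baseDeg_le_tailDeg`). The diversity order strictly decreases with `N`, so the pairs with most
leading zeros dominate.

It also has to be shown that the squared singular values follow the stated density
(`lintegral_svd_lam`). Rows are added one at a time. Each new row is a rank-one update of the Gram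
matrix, its squared coordinates in an eigenbasis are exponential variables, and they are the weights
of a secular equation whose roots are the new eigenvalues. The change from weights to roots has a
ratio of Vandermonde determinants as Jacobian, and integrating out the old eigenvalues over the gaps
of the new ones reproduces the density. The spectrum is encoded by the values of `det (z + Hᴴ H)` at
the positive integers, which are continuous in `H`, so an arbitrary choice of singular value
decompositions is allowed. -/

namespace SLMIMO

/-! ### Interlacing sequences and rank-one updates -/

section Interlacing

open Polynomial Lagrange

variable {n : ℕ}

/-- The strictly decreasing positive sequences. -/
def strictCone (n : ℕ) : Set (Fin n → ℝ) := {x | StrictAnti x ∧ ∀ i, 0 < x i}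

/-- The sequences `μ` with `μ 0 > ν 0 > μ 1 > ν 1 > ⋯`. -/
def interlacing (ν : Fin n → ℝ) : Set (Fin n → ℝ) :=
  {μ | (∀ i, ν i < μ i) ∧ ∀ i j, i < j → μ j < ν i}

/-- The absolute value of the Vandermonde determinant. -/
noncomputable def absVand (x : Fin n → ℝ) : ℝ := |(Matrix.vandermonde x).det|

/-- The weights `x` with `∏ (z - μ_j) = ∏ (z - ν_i) - ∑ x_i ∏_{k ≠ i} (z - ν_k)`. -/
noncomputable def weights (ν μ : Fin n → ℝ) : Fin n → ℝ := fun i =>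
  (∏ j ∈ Finset.univ.erase i, (ν j - ν i))⁻¹ * ∏ j, (μ j - ν i)

/-- The polynomial `∏ (z - ν_i) - ∑ x_i ∏_{k ≠ i} (z - ν_k)`. -/
noncomputable def secular (ν x : Fin n → ℝ) : ℝ[X] :=
  nodal Finset.univ ν - ∑ i, C (x i) * nodal (Finset.univ.erase i) ν

lemma interlacing_strictAnti {ν μ : Fin n → ℝ} (h : μ ∈ interlacing ν) : StrictAnti μ :=
  fun i j hij => (h.2 i j hij).trans (h.1 i)

lemma degree_sum_nodal_lt (ν x : Fin n → ℝ) :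
    (∑ i, C (x i) * nodal (Finset.univ.erase i) ν).degree < n := by
  rw [← mem_degreeLT]
  refine Submodule.sum_mem _ fun i _ => mem_degreeLT.2 ?_
  rw [← smul_eq_C_mul]
  refine (degree_smul_le _ _).trans_lt ?_
  rw [degree_nodal, Finset.card_erase_of_mem (Finset.mem_univ i), Finset.card_univ,
    Fintype.card_fin]
  have := i.pos
  exact_mod_cast Nat.sub_lt this one_pos

lemma degree_secular_sub_nodal_lt (ν x μ : Fin n → ℝ) :
    (nodal Finset.univ μ - secular ν x).degree < n := by
  rw [secular, ← sub_add]
  refine (degree_add_le _ _).trans_lt (max_lt ?_ (degree_sum_nodal_lt ν x))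
  have h : (nodal Finset.univ μ).degree = (nodal Finset.univ ν).degree := by
    rw [degree_nodal, degree_nodal]
  rcases Nat.eq_zero_or_pos n with rfl | hn
  · simp [nodal]
  refine (degree_sub_lt_left h (nodal_monic.ne_zero) ?_).trans_eq (by simp [degree_nodal])
  rw [nodal_monic.leadingCoeff, nodal_monic.leadingCoeff]

lemma eval_secular_node {ν : Fin n → ℝ} (x : Fin n → ℝ) (i : Fin n) :
    (secular ν x).eval (ν i) = -(x i * ∏ k ∈ Finset.univ.erase i, (ν i - ν k)) := by
  rw [secular, eval_sub, eval_nodal_at_node (Finset.mem_univ i), eval_finsetSum,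
    Finset.sum_eq_single i]
  · simp [eval_nodal]
  · intro j _ hj
    rw [eval_mul, eval_nodal_at_node (Finset.mem_erase.2 ⟨hj.symm, Finset.mem_univ i⟩), mul_zero]
  · simp

lemma prod_erase_sub_ne_zero {ν : Fin n → ℝ} (hν : StrictAnti ν) (i : Fin n) :
    ∏ k ∈ Finset.univ.erase i, (ν k - ν i) ≠ 0 :=
  Finset.prod_ne_zero_iff.2 fun _ hk =>
    sub_ne_zero.2 fun h => (Finset.mem_erase.1 hk).1 (hν.injective h)

lemma prod_sub_swap {ι : Type*} (s : Finset ι) (a : ℝ) (f : ι → ℝ) :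
    ∏ k ∈ s, (a - f k) = (-1) ^ s.card * ∏ k ∈ s, (f k - a) := by
  rw [← Finset.prod_const, ← Finset.prod_mul_distrib]
  exact Finset.prod_congr rfl fun _ _ => by ring

lemma eval_nodal_node {ν μ : Fin n → ℝ} (hν : StrictAnti ν) (i : Fin n) :
    (nodal Finset.univ μ).eval (ν i) =
      -(weights ν μ i * ∏ k ∈ Finset.univ.erase i, (ν i - ν k)) := by
  have h1 := prod_erase_sub_ne_zero hν i
  have h2 := prod_sub_swap (Finset.univ.erase i) (ν i) ν
  have h3 := prod_sub_swap Finset.univ (ν i) μ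
  rw [Finset.card_erase_of_mem (Finset.mem_univ i), Finset.card_univ, Fintype.card_fin] at h2
  rw [Finset.card_univ, Fintype.card_fin] at h3
  rw [eval_nodal, weights, h2, h3]
  obtain ⟨m, rfl⟩ : ∃ m, n = m + 1 := ⟨n - 1, by have := i.pos; omega⟩
  rw [Nat.add_sub_cancel]
  field_simp
  ring

/-- Both sides are monic of degree `n`, so their difference has degree below `n`; the weights are
exactly the values that make it vanish at the `n` distinct nodes `ν i`. -/
lemma nodal_eq_secular {ν : Fin n → ℝ} (hν : StrictAnti ν) (μ : Fin n → ℝ) :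
    nodal Finset.univ μ = secular ν (weights ν μ) := by
  refine eq_of_degree_sub_lt_of_eval_index_eq (s := Finset.univ) (v := ν) hν.injective.injOn ?_ ?_
  · simpa using degree_secular_sub_nodal_lt ν (weights ν μ) μ
  · intro i _
    rw [eval_nodal_node hν, eval_secular_node]

lemma eq_of_nodal_eq {x y : Fin n → ℝ} (hx : StrictAnti x) (hy : StrictAnti y)
    (h : nodal Finset.univ x = nodal Finset.univ y) : x = y := by
  refine (hx.range_inj hy).1 (Set.ext fun z => ?_)
  have key : ∀ w : Fin n → ℝ, z ∈ Set.range w ↔ (nodal Finset.univ w).eval z = 0 := by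
    intro w
    rw [eval_nodal, Finset.prod_eq_zero_iff]
    simp [sub_eq_zero, eq_comm]
  rw [key, key, h]

lemma weights_injOn {ν : Fin n → ℝ} (hν : StrictAnti ν) :
    Set.InjOn (weights ν) (interlacing ν) := by
  intro μ hμ μ' hμ' h
  refine eq_of_nodal_eq (interlacing_strictAnti hμ) (interlacing_strictAnti hμ') ?_
  rw [nodal_eq_secular hν μ, nodal_eq_secular hν μ', h]

/-- For `j ≠ i`, interlacing forces `μ j - ν i` and `ν j - ν i` to have the same sign, so all
quotients are positive. -/
lemma weights_pos {ν : Fin n → ℝ} (hν : StrictAnti ν) {μ : Fin n → ℝ} (hμ : μ ∈ interlacing ν)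
    (i : Fin n) : 0 < weights ν μ i := by
  have h : weights ν μ i =
      (μ i - ν i) * ∏ j ∈ Finset.univ.erase i, ((μ j - ν i) / (ν j - ν i)) := by
    rw [weights, ← Finset.mul_prod_erase _ _ (Finset.mem_univ i), Finset.prod_div_distrib]
    ring
  rw [h]
  refine mul_pos (sub_pos.2 (hμ.1 i)) (Finset.prod_pos fun j hj => ?_)
  rcases lt_or_gt_of_ne (Finset.mem_erase.1 hj).1 with hji | hij
  · have := hν hji
    exact div_pos (sub_pos.2 (this.trans (hμ.1 j))) (sub_pos.2 this)
  · exact div_pos_of_neg_of_neg (sub_neg.2 (hμ.2 i j hij)) (sub_neg.2 (hν hij))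

lemma exists_root_Ioo_of_mul_neg (f : ℝ[X]) {a b : ℝ} (hab : a < b)
    (h : f.eval a * f.eval b < 0) : ∃ z ∈ Set.Ioo a b, f.eval z = 0 := by
  rcases mul_neg_iff.1 h with ⟨h1, h2⟩ | ⟨h1, h2⟩
  · exact intermediate_value_Ioo' hab.le f.continuousOn ⟨h2, h1⟩
  · exact intermediate_value_Ioo hab.le f.continuousOn ⟨h1, h2⟩

lemma secular_monic (ν x : Fin n → ℝ) : (secular ν x).Monic := by
  refine nodal_monic.sub_of_left ?_
  rw [degree_nodal, Finset.card_univ, Fintype.card_fin]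
  exact degree_sum_nodal_lt ν x

lemma secular_natDegree (ν x : Fin n → ℝ) : (secular ν x).natDegree = n := by
  refine natDegree_eq_of_degree_eq_some ?_
  have h : (nodal Finset.univ ν).degree = n := by simp [degree_nodal]
  rw [secular, degree_sub_eq_left_of_degree_lt, h]
  rw [h]
  exact degree_sum_nodal_lt ν x

/-- With positive weights the secular polynomial changes sign between consecutive nodes and is
negative at the largest node although it is monic. The resulting `n + 1` interlacing roots exhaust
the degree. -/
lemma exists_roots_secular {ν x : Fin (n + 1) → ℝ} (hν : StrictAnti ν) (hx : ∀ i, 0 < x i) :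
    ∃ μ ∈ interlacing ν, nodal Finset.univ μ = secular ν x := by
  have h0 : ∃ z, ν 0 < z ∧ (secular ν x).eval z = 0 := by
    have hneg : (secular ν x).eval (ν 0) < 0 := by
      rw [eval_secular_node, neg_lt_zero]
      refine mul_pos (hx 0) (Finset.prod_pos fun k hk => sub_pos.2 (hν ?_))
      exact Fin.pos_iff_ne_zero.2 (Finset.mem_erase.1 hk).1
    have hdeg : 0 < (secular ν x).degree := by
      rw [← natDegree_pos_iff_degree_pos, secular_natDegree]; omega
    obtain ⟨b, hb1, hb2⟩ := ((tendsto_atTop_of_leadingCoeff_nonneg _ hdeg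
      (by rw [(secular_monic ν x).leadingCoeff]; exact zero_le_one)).eventually_gt_atTop 0 |>.and
        (eventually_gt_atTop (ν 0))).exists
    obtain ⟨z, hz, hz'⟩ := exists_root_Ioo_of_mul_neg (secular ν x) hb2
      (mul_neg_of_neg_of_pos hneg hb1)
    exact ⟨z, hz.1, hz'⟩
  have h1 : ∀ i : Fin n, ∃ z ∈ Set.Ioo (ν i.succ) (ν i.castSucc), (secular ν x).eval z = 0 := by
    intro i
    refine exists_root_Ioo_of_mul_neg _ (hν i.castSucc_lt_succ) ?_
    rw [eval_secular_node, eval_secular_node]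
    have hne : i.castSucc ≠ i.succ := i.castSucc_lt_succ.ne
    rw [← Finset.mul_prod_erase _ _ (Finset.mem_erase.2 ⟨hne, Finset.mem_univ i.castSucc⟩),
      ← Finset.mul_prod_erase _ _ (Finset.mem_erase.2 ⟨hne.symm, Finset.mem_univ i.succ⟩),
      Finset.erase_right_comm]
    -- No node lies between two consecutive ones, so each remaining factor has the same sign at both
    -- points.
    have hpos : 0 < (∏ k ∈ (Finset.univ.erase i.castSucc).erase i.succ, (ν i.succ - ν k)) *
        ∏ k ∈ (Finset.univ.erase i.castSucc).erase i.succ, (ν i.castSucc - ν k) := by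
      rw [← Finset.prod_mul_distrib]
      refine Finset.prod_pos fun k hk => ?_
      simp only [Finset.mem_erase, Finset.mem_univ, and_true] at hk
      rcases lt_or_gt_of_ne hk.2 with h | h
      · exact mul_pos_of_neg_of_neg (sub_neg.2 (hν (h.trans i.castSucc_lt_succ)))
          (sub_neg.2 (hν h))
      · have : i.succ < k := by
          refine lt_of_le_of_ne ?_ hk.1.symm
          exact Fin.castSucc_lt_iff_succ_le.1 h
        exact mul_pos (sub_pos.2 (hν this)) (sub_pos.2 (hν h))
    have hd := hν i.castSucc_lt_succ
    have hxx := mul_pos (hx i.succ) (hx i.castSucc)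
    have := mul_pos (mul_pos hxx hpos) (mul_pos (sub_pos.2 hd) (sub_pos.2 hd))
    nlinarith
  obtain ⟨z0, hz0, hz0'⟩ := h0
  choose z hz hz' using h1
  have hμ : (Fin.cons z0 z : Fin (n + 1) → ℝ) ∈ interlacing ν := by
    refine ⟨fun i => ?_, fun i j hij => ?_⟩
    · induction i using Fin.cases with
      | zero => simpa using hz0
      | succ i => simpa using (hz i).1
    · induction j using Fin.cases with
      | zero => exact absurd hij (Fin.not_lt_zero i)
      | succ j =>
        simp only [Fin.cons_succ]
        exact (hz j).2.trans_le (hν.antitone (Fin.le_castSucc_iff.2 hij))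
  refine ⟨_, hμ, eq_of_degree_sub_lt_of_eval_index_eq (s := Finset.univ)
    (v := (Fin.cons z0 z : Fin (n + 1) → ℝ)) (interlacing_strictAnti hμ).injective.injOn ?_ ?_⟩
  · simpa using degree_secular_sub_nodal_lt ν x _
  · intro i _
    rw [eval_nodal_at_node (Finset.mem_univ i)]
    induction i using Fin.cases with
    | zero => simpa using hz0'.symm
    | succ i => simpa using (hz' i).symm

lemma weights_image {ν : Fin n → ℝ} (hν : StrictAnti ν) :
    weights ν '' interlacing ν = {x | ∀ i, 0 < x i} := by
  refine Set.Subset.antisymm ?_ ?_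
  · rintro _ ⟨μ, hμ, rfl⟩ i
    exact weights_pos hν hμ i
  · intro x hx
    cases n with
    | zero => exact ⟨x, ⟨fun i => i.elim0, fun i => i.elim0⟩, Subsingleton.elim _ _⟩
    | succ n =>
      obtain ⟨μ, hμ, h⟩ := exists_roots_secular hν hx
      refine ⟨μ, hμ, funext fun i => ?_⟩
      have h1 := congrArg (eval (ν i)) h
      rw [eval_nodal_node hν, eval_secular_node, neg_inj] at h1
      refine mul_right_cancel₀ (Finset.prod_ne_zero_iff.2 fun k hk => ?_) h1
      exact sub_ne_zero.2 fun h => (Finset.mem_erase.1 hk).1 (hν.injective h.symm)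

/-- Comparison of the subleading coefficients; for matrices this is the trace identity. It expresses
the exponential weight `exp (-∑ x_i)` through the old and new eigenvalues. -/
lemma sum_weights {ν : Fin n → ℝ} (hν : StrictAnti ν) (μ : Fin n → ℝ) :
    ∑ i, weights ν μ i = ∑ i, μ i - ∑ i, ν i := by
  rcases n with _ | n
  · simp
  have h := congrArg (fun p => coeff p n) (nodal_eq_secular hν μ)
  have hc : ∀ v : Fin (n + 1) → ℝ, (nodal Finset.univ v).coeff n = -∑ i, v i := by
    intro v
    have := prod_X_sub_C_coeff_card_pred (Finset.univ : Finset (Fin (n + 1))) v (by simp)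
    simpa [nodal] using this
  have he : ∀ i, (nodal (Finset.univ.erase i) ν).coeff n = 1 := by
    intro i
    have : (nodal (Finset.univ.erase i) ν).natDegree = n := by
      rw [natDegree_nodal, Finset.card_erase_of_mem (Finset.mem_univ i)]; simp
    have h1 := (nodal_monic (s := Finset.univ.erase i) (v := ν)).coeff_natDegree
    rwa [this] at h1
  simp only [secular, coeff_sub, hc, finsetSum_coeff, coeff_C_mul, he, mul_one] at h
  linarith

/-- The Jacobian matrix of `weights ν`. -/
noncomputable def weightsJac (ν μ : Fin n → ℝ) : Matrix (Fin n) (Fin n) ℝ :=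
  Matrix.of fun i j => (∏ k ∈ Finset.univ.erase i, (ν k - ν i))⁻¹ *
    ∏ k ∈ Finset.univ.erase j, (μ k - ν i)

lemma hasFDerivAt_weights (ν μ : Fin n → ℝ) :
    HasFDerivAt (weights ν) (Matrix.toLin' (weightsJac ν μ)).toContinuousLinearMap μ := by
  rw [hasFDerivAt_pi']
  intro i
  have h : ∀ j ∈ (Finset.univ : Finset (Fin n)), HasFDerivAt (fun μ : Fin n → ℝ => μ j - ν i)
      (ContinuousLinearMap.proj (R := ℝ) (φ := fun _ : Fin n => ℝ) j) μ :=
    fun j _ => (hasFDerivAt_apply j μ).sub_const _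
  have h2 := (HasFDerivAt.finsetProd h).const_mul (∏ j ∈ Finset.univ.erase i, (ν j - ν i))⁻¹
  refine h2.congr_fderiv ?_
  ext v
  simp [weightsJac, Matrix.mulVec, dotProduct, Finset.mul_sum, mul_assoc]

lemma absVand_eq (x : Fin n → ℝ) : absVand x = ∏ i, ∏ j ∈ Finset.Ioi i, |x j - x i| := by
  rw [absVand, Matrix.det_vandermonde, Finset.abs_prod]
  exact Finset.prod_congr rfl fun i _ => Finset.abs_prod _ _

lemma absVand_nonneg (x : Fin n → ℝ) : 0 ≤ absVand x := abs_nonneg _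

lemma absVand_pos {x : Fin n → ℝ} (hx : StrictAnti x) : 0 < absVand x :=
  abs_pos.2 (Matrix.det_vandermonde_ne_zero_iff.2 hx.injective)

lemma prod_prod_erase_abs (x : Fin n → ℝ) :
    ∏ i, ∏ j ∈ Finset.univ.erase i, |x j - x i| = absVand x ^ 2 := by
  have h : ∀ i, ∏ j ∈ Finset.univ.erase i, |x j - x i| =
      (∏ j ∈ Finset.Ioi i, |x j - x i|) * ∏ j ∈ Finset.Iio i, |x j - x i| := by
    intro i
    rw [← Finset.prod_union]
    · refine Finset.prod_congr (Finset.ext fun j => ?_) fun _ _ => rfl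
      simp only [Finset.mem_erase, Finset.mem_univ, and_true, Finset.mem_union, Finset.mem_Ioi,
        Finset.mem_Iio]
      exact ne_iff_lt_or_gt.trans or_comm
    · rw [Finset.disjoint_left]
      intro j h1 h2
      exact lt_asymm (Finset.mem_Ioi.1 h1) (Finset.mem_Iio.1 h2)
  rw [Finset.prod_congr rfl fun i _ => h i, Finset.prod_mul_distrib, sq, absVand_eq]
  congr 1
  rw [Finset.prod_comm' (t' := Finset.univ) (s' := fun j => Finset.Ioi j) (by simp)]
  exact Finset.prod_congr rfl fun i _ => Finset.prod_congr rfl fun j _ => abs_sub_comm _ _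

/-- For any points `y`, the matrix with entries `∏_{k ≠ j} (μ k - y i)` is the Vandermonde matrix of
`y` times a coefficient matrix that does not depend on `y`. At `y = μ` it is diagonal; comparing the
determinants at `ν` and at `μ` eliminates the coefficient matrix. -/
lemma det_prod_erase (ν μ : Fin n → ℝ) :
    (Matrix.of fun i j => ∏ k ∈ Finset.univ.erase j, (μ k - ν i)).det *
        (Matrix.vandermonde μ).det =
      (Matrix.vandermonde ν).det * ∏ j, ∏ k ∈ Finset.univ.erase j, (μ k - μ j) := by
  set L : Fin n → ℝ[X] := fun j => ∏ k ∈ Finset.univ.erase j, (C (μ k) - X) with hL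
  have hdeg : ∀ j, (L j).natDegree < n := by
    intro j
    refine (natDegree_prod_le _ _).trans_lt ?_
    refine (Finset.sum_le_card_nsmul _ _ 1 fun k _ => ?_).trans_lt ?_
    · exact (natDegree_sub_le _ _).trans (by simp)
    · rw [Finset.card_erase_of_mem (Finset.mem_univ j)]
      have := j.pos
      simp
      omega
  set A : Matrix (Fin n) (Fin n) ℝ := Matrix.of fun l j => (L j).coeff l with hA
  have hmul : ∀ y : Fin n → ℝ, (Matrix.of fun i j => ∏ k ∈ Finset.univ.erase j, (μ k - y i)) =
      Matrix.vandermonde y * A := by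
    intro y
    ext i j
    have : (L j).eval (y i) = ∏ k ∈ Finset.univ.erase j, (μ k - y i) := by
      simp [hL, eval_prod]
    rw [Matrix.of_apply, ← this, eval_eq_sum_range' (hdeg j), Matrix.mul_apply,
      ← Fin.sum_univ_eq_sum_range (fun l => (L j).coeff l * y i ^ l)]
    exact Finset.sum_congr rfl fun l _ => by simp [hA, mul_comm]
  have hdiag : (Matrix.of fun i j => ∏ k ∈ Finset.univ.erase j, (μ k - μ i)) =
      Matrix.diagonal fun j => ∏ k ∈ Finset.univ.erase j, (μ k - μ j) := by
    ext i j
    rw [Matrix.of_apply, Matrix.diagonal_apply]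
    split_ifs with h
    · rw [h]
    · exact Finset.prod_eq_zero (Finset.mem_erase.2 ⟨h, Finset.mem_univ i⟩) (sub_self _)
  have h1 := congrArg Matrix.det (hmul ν)
  have h2 := congrArg Matrix.det ((hmul μ).symm.trans hdiag)
  rw [Matrix.det_mul] at h1 h2
  rw [Matrix.det_diagonal] at h2
  rw [h1, ← h2]
  ring

lemma abs_det_weightsJac {ν μ : Fin n → ℝ} (hν : StrictAnti ν) (hμ : StrictAnti μ) :
    |(weightsJac ν μ).det| = absVand μ / absVand ν := by
  have h1 := congrArg abs (det_prod_erase ν μ)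
  rw [abs_mul, abs_mul, Finset.abs_prod, Finset.prod_congr rfl fun j _ => Finset.abs_prod _ _,
    prod_prod_erase_abs, ← absVand, ← absVand] at h1
  have h2 : (weightsJac ν μ).det = (∏ i, (∏ k ∈ Finset.univ.erase i, (ν k - ν i))⁻¹) *
      (Matrix.of fun i j => ∏ k ∈ Finset.univ.erase j, (μ k - ν i)).det := by
    rw [← Matrix.det_mul_column]
    rfl
  have h3 : |∏ i, (∏ k ∈ Finset.univ.erase i, (ν k - ν i))⁻¹| = (absVand ν ^ 2)⁻¹ := by
    rw [Finset.prod_inv_distrib, abs_inv, Finset.abs_prod,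
      Finset.prod_congr rfl fun j _ => Finset.abs_prod _ _, prod_prod_erase_abs]
  have hp := absVand_pos hν
  have hp' := absVand_pos hμ
  rw [h2, abs_mul, h3]
  have h4 : |(Matrix.of fun i j => ∏ k ∈ Finset.univ.erase j, (μ k - ν i)).det| =
      absVand ν * absVand μ := by
    refine mul_right_cancel₀ hp'.ne' (h1.trans ?_)
    ring
  rw [h4]
  field_simp

lemma isOpen_interlacing (ν : Fin n → ℝ) : IsOpen (interlacing ν) := by
  have : interlacing ν = (⋂ i, {μ | ν i < μ i}) ∩
      ⋂ i, ⋂ j, ⋂ (_ : i < j), {μ : Fin n → ℝ | μ j < ν i} := by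
    ext μ
    simp [interlacing]
  rw [this]
  refine (isOpen_iInter_of_finite fun i => isOpen_lt (by fun_prop) (by fun_prop)).inter ?_
  exact isOpen_iInter_of_finite fun i => isOpen_iInter_of_finite fun j =>
    isOpen_iInter_of_finite fun _ => isOpen_lt (by fun_prop) (by fun_prop)

/-- The change of variables from the weights of a rank-one update to the new eigenvalues. -/
lemma lintegral_pos_eq_lintegral_interlacing {ν : Fin n → ℝ} (hν : StrictAnti ν)
    (g : (Fin n → ℝ) → ℝ≥0∞) :
    ∫⁻ x in {x | ∀ i, 0 < x i}, g x =
      ∫⁻ μ in interlacing ν, ENNReal.ofReal (absVand μ / absVand ν) * g (weights ν μ) := by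
  rw [← weights_image hν, lintegral_image_eq_lintegral_abs_det_fderiv_mul volume
    (isOpen_interlacing ν).measurableSet
    (fun μ _ => (hasFDerivAt_weights ν μ).hasFDerivWithinAt) (weights_injOn hν)]
  refine setLIntegral_congr_fun (isOpen_interlacing ν).measurableSet fun μ hμ => ?_
  have : (Matrix.toLin' (weightsJac ν μ)).toContinuousLinearMap.det = (weightsJac ν μ).det := by
    rw [← LinearMap.det_toLin']; rfl
  simp only [this, abs_det_weightsJac hν (interlacing_strictAnti hμ)]

end Interlacing

end SLMIMO
namespace SLMIMO

/-! ### Integrating the Vandermonde determinant over interlacing sequences. -/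

section InterlacingIntegral

/-- The product of the intervals between consecutive entries of `μ`. -/
def gapBox {m : ℕ} (μ : Fin (m + 1) → ℝ) : Set (Fin m → ℝ) :=
  Set.univ.pi fun i => Set.Ioo (μ i.succ) (μ i.castSucc)

variable {m : ℕ}

/-- Subtracting from each row of the Vandermonde matrix its predecessor leaves the first column `(1,
0, …, 0)`; expansion along it gives the matrix of differences up to sign. -/
lemma abs_det_vandermonde_diff (μ : Fin (m + 1) → ℝ) :
    |(Matrix.of fun i j : Fin m => μ i.castSucc ^ ((j : ℕ) + 1) - μ i.succ ^ ((j : ℕ) + 1)).det| =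
      absVand μ := by
  set B : Matrix (Fin (m + 1)) (Fin (m + 1)) ℝ := Matrix.of
    (Fin.cons (fun j => μ 0 ^ (j : ℕ))
      fun i j => μ i.succ ^ (j : ℕ) - μ i.castSucc ^ (j : ℕ)) with hB
  have h1 : (Matrix.vandermonde μ).det = B.det := by
    refine Matrix.det_eq_of_forall_row_eq_smul_add_pred (fun _ => 1) (fun j => ?_) fun i j => ?_
    · simp [hB, Matrix.vandermonde]
    · simp [hB, Matrix.vandermonde]
  rw [absVand, h1, Matrix.det_succ_column_zero, Fin.sum_univ_succ]
  have h2 : ∀ i : Fin m, B i.succ 0 = 0 := fun i => by simp [hB]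
  have h3 : B 0 0 = 1 := by simp [hB]
  have h4 : B.submatrix (Fin.succAbove 0) Fin.succ = -(Matrix.of fun i j : Fin m =>
      μ i.castSucc ^ ((j : ℕ) + 1) - μ i.succ ^ ((j : ℕ) + 1)) := by
    ext i j
    simp [hB]
  simp only [h2, h3, h4, mul_zero, zero_mul, Finset.sum_const_zero, add_zero, mul_one,
    Fin.val_zero, pow_zero, one_mul, Matrix.det_neg, abs_mul, abs_pow, abs_neg, abs_one, one_pow]

lemma det_vandermonde_of_strictAnti {x : Fin m → ℝ} (hx : StrictAnti x) :
    absVand x = (∏ i : Fin m, ∏ _j ∈ Finset.Ioi i, (-1 : ℝ)) * (Matrix.vandermonde x).det := by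
  rw [absVand_eq, Matrix.det_vandermonde, ← Finset.prod_mul_distrib]
  refine Finset.prod_congr rfl fun i _ => ?_
  rw [← Finset.prod_mul_distrib]
  refine Finset.prod_congr rfl fun j hj => ?_
  rw [abs_of_neg (sub_neg.2 (hx (Finset.mem_Ioi.1 hj)))]
  ring

lemma gapBox_strictAnti {μ : Fin (m + 1) → ℝ} (hμ : StrictAnti μ) {x : Fin m → ℝ}
    (hx : x ∈ gapBox μ) : StrictAnti x := by
  intro i j hij
  have h1 := (hx i (Set.mem_univ i)).1
  have h2 := (hx j (Set.mem_univ j)).2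
  exact (h2.trans_le (hμ.antitone (Fin.castSucc_lt_iff_succ_le.1 (by simpa using hij)))).trans h1

lemma volume_restrict_gapBox (μ : Fin (m + 1) → ℝ) :
    (volume : Measure (Fin m → ℝ)).restrict (gapBox μ) =
      Measure.pi fun i => volume.restrict (Set.Ioo (μ i.succ) (μ i.castSucc)) := by
  rw [gapBox, volume_pi, Measure.restrict_pi_pi]

lemma measurableSet_gapBox (μ : Fin (m + 1) → ℝ) : MeasurableSet (gapBox μ) :=
  MeasurableSet.univ_pi fun _ => measurableSet_Ioo

/-- Row `i` of the Vandermonde matrix depends on `x i` alone, so the integral over a box can be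
taken row by row inside the determinant. The factors `1 / (j + 1)` come from the antiderivatives of
`x ^ j`. -/
lemma integral_gapBox_det {μ : Fin (m + 1) → ℝ} (hμ : StrictAnti μ) :
    ∫ x in gapBox μ, (Matrix.vandermonde x).det = (∏ j : Fin m, ((j : ℝ) + 1)⁻¹) *
      (Matrix.of fun i j : Fin m =>
        μ i.castSucc ^ ((j : ℕ) + 1) - μ i.succ ^ ((j : ℕ) + 1)).det := by
  rw [← Matrix.det_mul_row, volume_restrict_gapBox]
  -- The Leibniz formula for the transpose: the factor with index `i` is taken from row `i` and so
  -- involves one variable.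
  have hdet : ∀ M : Matrix (Fin m) (Fin m) ℝ, M.det =
      ∑ σ : Equiv.Perm (Fin m), ((σ.sign : ℤ) : ℝ) * ∏ i, M i (σ i) := by
    intro M
    rw [← Matrix.det_transpose, Matrix.det_apply']
    rfl
  simp only [hdet, Matrix.vandermonde_apply]
  have hint : ∀ (i : Fin m) (k : ℕ), Integrable (fun x : ℝ => x ^ k)
      (volume.restrict (Set.Ioo (μ i.succ) (μ i.castSucc))) := by
    intro i k
    exact ((continuous_pow k).integrableOn_Icc).mono_set Set.Ioo_subset_Icc_self
  rw [integral_finsetSum]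
  · refine Finset.sum_congr rfl fun σ _ => ?_
    rw [integral_const_mul, integral_fintype_prod_eq_prod (f := fun i x => x ^ (σ i : ℕ))]
    congr 1
    refine Finset.prod_congr rfl fun i _ => ?_
    rw [← integral_Ioc_eq_integral_Ioo, ← intervalIntegral.integral_of_le
      (hμ i.castSucc_lt_succ).le, integral_pow]
    simp only [Matrix.of_apply]
    rw [div_eq_inv_mul]
  · intro σ _
    exact (Integrable.fintype_prod (f := fun i (x : ℝ) => x ^ (σ i : ℕ)) fun i => hint i _).const_mul _

lemma continuous_absVand : Continuous (absVand : (Fin m → ℝ) → ℝ) := by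
  refine Continuous.abs (Continuous.matrix_det ?_)
  refine continuous_matrix fun i j => ?_
  simp only [Matrix.vandermonde_apply]
  fun_prop

/-- Points of the box are strictly decreasing, so the Vandermonde determinant has constant sign
there and the absolute value moves outside the integral. -/
lemma lintegral_gapBox_absVand {μ : Fin (m + 1) → ℝ} (hμ : StrictAnti μ) :
    ∫⁻ x in gapBox μ, ENNReal.ofReal (absVand x) =
      ENNReal.ofReal ((∏ j : Fin m, ((j : ℝ) + 1)⁻¹) * absVand μ) := by
  rw [← ofReal_integral_eq_lintegral_ofReal]
  · congr 1
    have h : ∫ x in gapBox μ, absVand x = (∏ i : Fin m, ∏ _j ∈ Finset.Ioi i, (-1 : ℝ)) *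
        ∫ x in gapBox μ, (Matrix.vandermonde x).det := by
      rw [← integral_const_mul]
      exact setIntegral_congr_fun (measurableSet_gapBox μ) fun x hx =>
        det_vandermonde_of_strictAnti (gapBox_strictAnti hμ hx)
    have h0 : 0 ≤ ∫ x in gapBox μ, absVand x := integral_nonneg fun x => absVand_nonneg x
    rw [← abs_of_nonneg h0, h, integral_gapBox_det hμ, abs_mul, abs_mul, abs_det_vandermonde_diff]
    have : |∏ i : Fin m, ∏ _j ∈ Finset.Ioi i, (-1 : ℝ)| = 1 := by
      simp [Finset.abs_prod]
    rw [this, one_mul, abs_of_nonneg]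
    exact Finset.prod_nonneg fun j _ => by positivity
  · have hb : gapBox μ ⊆ Set.univ.pi fun i : Fin m => Set.Icc (μ i.succ) (μ i.castSucc) :=
      Set.pi_mono fun _ _ => Set.Ioo_subset_Icc_self
    exact (continuous_absVand.continuousOn.integrableOn_compact
      (isCompact_univ_pi fun _ => isCompact_Icc)).mono_set hb
  · exact ae_of_all _ fun x => absVand_nonneg x

end InterlacingIntegral

end SLMIMO
namespace SLMIMO

/-! ### Complex Gaussian vectors: unitary invariance, real projections, squared moduli. -/

section Gaussian

variable {r : ℕ}

instance isProbabilityMeasure_cgauss (v : ℝ≥0) : IsProbabilityMeasure (cgauss v) :=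
  Measure.isProbabilityMeasure_map (by
    have : Measurable fun p : ℝ × ℝ => Complex.equivRealProdCLM.symm p := by fun_prop
    exact this.aemeasurable)

lemma cgauss_eq_map (v : ℝ≥0) : cgauss v =
    ((gaussianReal 0 (v / 2)).prod (gaussianReal 0 (v / 2))).map
      (Complex.equivRealProdCLM.symm : ℝ × ℝ →L[ℝ] ℂ) := rfl

lemma charFunDual_gaussianReal_zero (v : ℝ≥0) (L : StrongDual ℝ ℝ) :
    charFunDual (gaussianReal 0 v) L = Complex.exp (-(v * L 1 ^ 2 / 2 : ℝ)) := by
  have hL : (L : ℝ → ℝ) = fun x => L 1 * x := by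
    ext x
    conv_lhs => rw [← mul_one x, ← smul_eq_mul, map_smul, smul_eq_mul, mul_comm]
  rw [charFunDual_eq_charFun_map_one, hL, gaussianReal_map_const_mul, charFun_gaussianReal]
  congr 1
  push_cast
  simp
  ring

lemma charFunDual_cgauss (v : ℝ≥0) (L : StrongDual ℝ ℂ) :
    charFunDual (cgauss v) L =
      Complex.exp (-(v / 4 * (L 1 ^ 2 + L Complex.I ^ 2) : ℝ)) := by
  rw [cgauss_eq_map, charFunDual_map, charFunDual_prod, charFunDual_gaussianReal_zero,
    charFunDual_gaussianReal_zero, ← Complex.exp_add]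
  have h1 : (Complex.equivRealProdCLM.symm : ℝ × ℝ →L[ℝ] ℂ) (1, 0) = 1 := by
    simp [Complex.equivRealProdCLM_symm_apply]
  have h2 : (Complex.equivRealProdCLM.symm : ℝ × ℝ →L[ℝ] ℂ) (0, 1) = Complex.I := by
    simp [Complex.equivRealProdCLM_symm_apply]
  simp only [ContinuousLinearMap.comp_apply, ContinuousLinearMap.inl_apply,
    ContinuousLinearMap.inr_apply, h1, h2]
  congr 1
  push_cast
  ring

lemma charFunDual_pi_cgauss (v : ℝ≥0) (L : StrongDual ℝ (Fin r → ℂ)) :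
    charFunDual (Measure.pi fun _ : Fin r => cgauss v) L = Complex.exp (-(v / 4 *
      ∑ i, (L (Pi.single i 1) ^ 2 + L (Pi.single i Complex.I) ^ 2) : ℝ)) := by
  rw [charFunDual_pi]
  simp only [charFunDual_cgauss]
  rw [← Complex.exp_sum, Finset.mul_sum]
  congr 1
  push_cast
  rw [← Finset.sum_neg_distrib]
  rfl

/-- The real linear functional `x ↦ Re ∑ w_i x_i`. -/
noncomputable def reDual (w : Fin r → ℂ) : StrongDual ℝ (Fin r → ℂ) :=
  ∑ i, (Complex.reCLM.comp ((ContinuousLinearMap.mul ℝ ℂ (w i)))).comp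
    (ContinuousLinearMap.proj (R := ℝ) (φ := fun _ : Fin r => ℂ) i)

lemma reDual_apply (w x : Fin r → ℂ) : reDual w x = (w ⬝ᵥ x).re := by
  simp [reDual, dotProduct]

lemma reDual_single (w : Fin r → ℂ) (i : Fin r) (z : ℂ) :
    reDual w (Pi.single i z) = (w i * z).re := by
  rw [reDual_apply, dotProduct_single]

lemma exists_reDual (L : StrongDual ℝ (Fin r → ℂ)) : ∃ w, L = reDual w := by
  refine ⟨fun i => ⟨L (Pi.single i 1), -L (Pi.single i Complex.I)⟩, ?_⟩
  refine ContinuousLinearMap.coe_inj.1 (LinearMap.pi_ext fun i z => ?_)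
  have hz : (Pi.single i z : Fin r → ℂ) =
      z.re • (Pi.single i 1 : Fin r → ℂ) + z.im • (Pi.single i Complex.I : Fin r → ℂ) := by
    rw [← Pi.single_smul, ← Pi.single_smul, ← Pi.single_add]
    congr 1
    apply Complex.ext <;> simp
  simp only [ContinuousLinearMap.coe_coe]
  rw [reDual_single]
  conv_lhs => rw [hz]
  simp
  ring

/-- The characteristic function depends on `w` only through its norm. Unitary invariance and the law
of real projections are read off from this. -/
lemma charFunDual_pi_cgauss_reDual (v : ℝ≥0) (w : Fin r → ℂ) :
    charFunDual (Measure.pi fun _ : Fin r => cgauss v) (reDual w) =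
      Complex.exp (-(v / 4 * sqNorm w : ℝ)) := by
  rw [charFunDual_pi_cgauss, sqNorm]
  congr 4
  refine Finset.sum_congr rfl fun i _ => ?_
  rw [reDual_single, reDual_single, Complex.sq_norm, Complex.normSq_apply]
  simp
  ring

lemma ofReal_sqNorm (w : Fin r → ℂ) : ((sqNorm w : ℝ) : ℂ) = star w ⬝ᵥ w := by
  simp [sqNorm, dotProduct, Complex.conj_mul']

lemma sqNorm_mulVec {s : ℕ} {A : Matrix (Fin s) (Fin r) ℂ} (hA : Aᴴ * A = 1) (w : Fin r → ℂ) :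
    sqNorm (A *ᵥ w) = sqNorm w := by
  have h : ((sqNorm (A *ᵥ w) : ℝ) : ℂ) = ((sqNorm w : ℝ) : ℂ) := by
    rw [ofReal_sqNorm, ofReal_sqNorm, Matrix.star_mulVec, ← Matrix.dotProduct_mulVec,
      Matrix.mulVec_mulVec, hA, Matrix.one_mulVec]
  exact_mod_cast h

lemma sqNorm_star (w : Fin r → ℂ) : sqNorm (star w) = sqNorm w := by
  simp [sqNorm]

lemma pi_cgauss_map_mulVec (v : ℝ≥0) {A : Matrix (Fin r) (Fin r) ℂ}
    (hA : A ∈ Matrix.unitaryGroup (Fin r) ℂ) :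
    (Measure.pi fun _ : Fin r => cgauss v).map (fun x => A *ᵥ x) =
      Measure.pi fun _ : Fin r => cgauss v := by
  set T : (Fin r → ℂ) →L[ℝ] (Fin r → ℂ) :=
    (A.mulVecLin.restrictScalars ℝ).toContinuousLinearMap with hT
  have hcoe : (fun x => A *ᵥ x) = T := rfl
  rw [hcoe]
  have : IsProbabilityMeasure ((Measure.pi fun _ : Fin r => cgauss v).map T) :=
    Measure.isProbabilityMeasure_map T.continuous.aemeasurable
  refine Measure.ext_of_charFunDual (funext fun L => ?_)
  obtain ⟨w, rfl⟩ := exists_reDual L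
  have hcomp : (reDual w).comp T = reDual (w ᵥ* A) := by
    ext x
    rw [ContinuousLinearMap.comp_apply, reDual_apply, reDual_apply, ← Matrix.dotProduct_mulVec]
    rfl
  rw [charFunDual_map, hcomp, charFunDual_pi_cgauss_reDual, charFunDual_pi_cgauss_reDual]
  congr 4
  rw [← sqNorm_star, Matrix.star_vecMul, sqNorm_mulVec _ _, sqNorm_star]
  rw [Matrix.conjTranspose_conjTranspose]
  exact Matrix.mem_unitaryGroup_iff.1 hA

lemma pi_cgauss_map_re_dotProduct (v : ℝ≥0) (w : Fin r → ℂ) :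
    (Measure.pi fun _ : Fin r => cgauss v).map (fun x => (w ⬝ᵥ x).re) =
      gaussianReal 0 (v / 2 * (sqNorm w).toNNReal) := by
  have hcoe : (fun x => (w ⬝ᵥ x).re) = reDual w := funext fun x => (reDual_apply w x).symm
  rw [hcoe]
  have : IsProbabilityMeasure ((Measure.pi fun _ : Fin r => cgauss v).map (reDual w)) :=
    Measure.isProbabilityMeasure_map (reDual w).continuous.aemeasurable
  have hw : 0 ≤ sqNorm w := Finset.sum_nonneg fun _ _ => by positivity
  refine Measure.ext_of_charFun (funext fun t => ?_)
  have hsm : t • reDual w = reDual ((t : ℂ) • w) := by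
    ext x
    rw [reDual_apply, smul_dotProduct]
    simp [reDual_apply]
  rw [charFun_map_eq_charFunDual_smul, hsm, charFunDual_pi_cgauss_reDual, charFun_gaussianReal]
  have : sqNorm ((t : ℂ) • w) = t ^ 2 * sqNorm w := by
    simp [sqNorm, Finset.mul_sum, mul_pow]
  rw [this]
  congr 1
  push_cast
  rw [Real.coe_toNNReal _ hw]
  simp
  ring

/-- The standard exponential law. -/
noncomputable def expLaw : Measure ℝ :=
  (volume.restrict (Set.Ioi 0)).withDensity fun t => ENNReal.ofReal (Real.exp (-t))

/-- Polar coordinates: the density is `exp (-r²) / π`, the angle contributes `2 π`, and the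
substitution `t = r²` absorbs `2 r dr`. -/
lemma lintegral_cgauss_norm_sq {F : ℝ → ℝ≥0∞} (hF : Measurable F) :
    ∫⁻ z, F (‖z‖ ^ 2) ∂cgauss 1 =
      ∫⁻ t in Set.Ioi 0, ENNReal.ofReal (Real.exp (-t)) * F t := by
  have hv : (1 / 2 : ℝ≥0) ≠ 0 := by norm_num
  have hm : Measurable fun z : ℂ => F (‖z‖ ^ 2) := by fun_prop
  rw [cgauss_eq_map, lintegral_map hm (by fun_prop), gaussianReal_of_var_ne_zero _ hv,
    prod_withDensity (by fun_prop) (by fun_prop), lintegral_withDensity_eq_lintegral_mul _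
      (by fun_prop) (by fun_prop), ← Measure.volume_eq_prod, ← lintegral_comp_polarCoord_symm]
  have hpt : ∀ p ∈ polarCoord.target, ENNReal.ofReal p.1 • ((fun z : ℝ × ℝ =>
      gaussianPDF 0 (1 / 2) z.1 * gaussianPDF 0 (1 / 2) z.2) * fun a =>
        F (‖(Complex.equivRealProdCLM.symm : ℝ × ℝ →L[ℝ] ℂ) a‖ ^ 2)) (polarCoord.symm p) =
      ENNReal.ofReal (2 * p.1) * (ENNReal.ofReal (Real.exp (-p.1 ^ 2)) * F (p.1 ^ 2)) *
        ENNReal.ofReal (1 / (2 * Real.pi)) := by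
    intro p hp
    have hp1 : 0 < p.1 := hp.1
    have hn : ‖(Complex.equivRealProdCLM.symm : ℝ × ℝ →L[ℝ] ℂ) (polarCoord.symm p)‖ ^ 2 =
        p.1 ^ 2 := by
      have : (Complex.equivRealProdCLM.symm : ℝ × ℝ →L[ℝ] ℂ) (polarCoord.symm p) =
        Complex.polarCoord.symm p := rfl
      rw [this, Complex.norm_polarCoord_symm, sq_abs]
    have hd : gaussianPDF 0 (1 / 2) (polarCoord.symm p).1 *
        gaussianPDF 0 (1 / 2) (polarCoord.symm p).2 =
        ENNReal.ofReal (Real.exp (-p.1 ^ 2)) * ENNReal.ofReal (1 / Real.pi) := by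
      rw [gaussianPDF, gaussianPDF, ← ENNReal.ofReal_mul (gaussianPDFReal_nonneg _ _ _),
        ← ENNReal.ofReal_mul (Real.exp_nonneg _)]
      congr 1
      simp only [gaussianPDFReal, polarCoord_symm_apply, sub_zero]
      rw [mul_mul_mul_comm, ← Real.exp_add, ← mul_inv, Real.mul_self_sqrt (by positivity), mul_comm]
      have : -(p.1 * Real.cos p.2) ^ 2 / (2 * ((1 / 2 : ℝ≥0) : ℝ)) +
          -(p.1 * Real.sin p.2) ^ 2 / (2 * ((1 / 2 : ℝ≥0) : ℝ)) = -p.1 ^ 2 := by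
        have := Real.sin_sq_add_cos_sq p.2
        push_cast
        linear_combination -p.1 ^ 2 * this
      rw [this]
      push_cast
      congr 1
      field_simp
    simp only [Pi.mul_apply, smul_eq_mul]
    rw [hn, hd, show (2 * p.1) = p.1 * 2 by ring, ENNReal.ofReal_mul hp1.le,
      show (1 / Real.pi) = 2 * (1 / (2 * Real.pi)) by field_simp, ENNReal.ofReal_mul (by norm_num)]
    ring
  rw [setLIntegral_congr_fun polarCoord.open_target.measurableSet hpt]
  have him : (fun r : ℝ => r ^ 2) '' Set.Ioi 0 = Set.Ioi 0 := by
    ext t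
    refine ⟨?_, fun ht => ⟨√t, Real.sqrt_pos.2 ht, Real.sq_sqrt (le_of_lt ht)⟩⟩
    rintro ⟨s, hs, rfl⟩
    exact pow_pos (Set.mem_Ioi.1 hs) 2
  have hmono : MonotoneOn (fun r : ℝ => r ^ 2) (Set.Ioi 0) := fun a ha b _ hab =>
    pow_le_pow_left₀ (le_of_lt ha) hab 2
  have hcv := lintegral_image_eq_lintegral_deriv_mul_of_monotoneOn (f := fun r : ℝ => r ^ 2)
    (f' := fun r => 2 * r) measurableSet_Ioi
    (fun x _ => by simpa using (hasDerivAt_pow 2 x).hasDerivWithinAt) hmono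
    fun t => ENNReal.ofReal (Real.exp (-t)) * F t
  rw [him] at hcv
  rw [hcv]
  have htarget : polarCoord.target = Set.Ioi (0 : ℝ) ×ˢ Set.Ioo (-Real.pi) Real.pi := rfl
  rw [htarget, Measure.volume_eq_prod, ← Measure.prod_restrict,
    lintegral_prod_mul (f := fun s : ℝ => ENNReal.ofReal (2 * s) *
      (ENNReal.ofReal (Real.exp (-s ^ 2)) * F (s ^ 2)))
      (g := fun _ : ℝ => ENNReal.ofReal (1 / (2 * Real.pi))) (by fun_prop) (by fun_prop)]
  rw [lintegral_const, Measure.restrict_apply_univ, Real.volume_Ioo,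
    ← ENNReal.ofReal_mul (by positivity)]
  have : 1 / (2 * Real.pi) * (Real.pi - -Real.pi) = 1 := by
    have := Real.pi_ne_zero
    field_simp
    ring
  rw [this, ENNReal.ofReal_one, mul_one]

lemma cgauss_map_norm_sq : (cgauss 1).map (fun z => ‖z‖ ^ 2) = expLaw := by
  refine Measure.ext_of_lintegral _ fun F hF => ?_
  rw [lintegral_map hF (by fun_prop), lintegral_cgauss_norm_sq hF, expLaw,
    lintegral_withDensity_eq_lintegral_mul _ (by fun_prop) hF]
  rfl

instance isProbabilityMeasure_expLaw : IsProbabilityMeasure expLaw :=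
  cgauss_map_norm_sq ▸ Measure.isProbabilityMeasure_map (by fun_prop)

end Gaussian

end SLMIMO
namespace SLMIMO

/-! ### Exponential variables and their sums. -/

section SumLaws

lemma lintegral_pi_insertNth {E : Type*} [MeasurableSpace E] {n : ℕ} (μ : Measure E)
    [SigmaFinite μ] (i : Fin (n + 1)) {f : (Fin (n + 1) → E) → ℝ≥0∞} (hf : Measurable f) :
    ∫⁻ x, f x ∂(Measure.pi fun _ => μ) =
      ∫⁻ a, ∫⁻ y, f (i.insertNth a y) ∂(Measure.pi fun _ => μ) ∂μ := by
  have h := (measurePreserving_piFinSuccAbove (fun _ : Fin (n + 1) => μ) i).symm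
  rw [← h.lintegral_comp hf, lintegral_prod]
  · rfl
  · exact (hf.comp (MeasurableEquiv.measurable _)).aemeasurable

lemma lintegral_volume_insertNth {n : ℕ} (i : Fin (n + 1)) {f : (Fin (n + 1) → ℝ) → ℝ≥0∞}
    (hf : Measurable f) : ∫⁻ x, f x = ∫⁻ a, ∫⁻ y, f (i.insertNth a y) :=
  lintegral_pi_insertNth volume i hf

lemma measurable_insertNth {E : Type*} [MeasurableSpace E] {n : ℕ} (i : Fin (n + 1)) :
    Measurable fun p : E × (Fin n → E) => (i.insertNth p.1 p.2 : Fin (n + 1) → E) :=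
  (MeasurableEquiv.piFinSuccAbove (fun _ : Fin (n + 1) => E) i).symm.measurable

lemma lintegral_expLaw {F : ℝ → ℝ≥0∞} (hF : Measurable F) :
    ∫⁻ t, F t ∂expLaw = ∫⁻ t in Set.Ioi 0, ENNReal.ofReal (Real.exp (-t)) * F t := by
  rw [expLaw, lintegral_withDensity_eq_lintegral_mul _ (by fun_prop) hF]
  rfl

lemma measurableSet_pos (n : ℕ) : MeasurableSet {x : Fin n → ℝ | ∀ i, 0 < x i} := by
  rw [Set.ofPred_forall]
  exact MeasurableSet.iInter fun i => measurableSet_lt measurable_const (measurable_pi_apply i)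

lemma lintegral_pi_expLaw {n : ℕ} {F : (Fin n → ℝ) → ℝ≥0∞} (hF : Measurable F) :
    ∫⁻ x, F x ∂(Measure.pi fun _ => expLaw) =
      ∫⁻ x in {x | ∀ i, 0 < x i}, ENNReal.ofReal (Real.exp (-∑ i, x i)) * F x := by
  induction n with
  | zero =>
    have h : {x : Fin 0 → ℝ | ∀ i, 0 < x i} = Set.univ := by ext; simp
    rw [h, Measure.restrict_univ, volume_pi, Measure.pi_of_empty, Measure.pi_of_empty]
    simp
  | succ n ih =>
    have hm := measurable_insertNth (E := ℝ) (0 : Fin (n + 1))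
    rw [lintegral_pi_insertNth _ 0 hF, ← lintegral_indicator (measurableSet_pos _),
      lintegral_volume_insertNth 0 (Measurable.indicator (by fun_prop) (measurableSet_pos _)),
      lintegral_expLaw (Measurable.lintegral_prod_right' (f := fun p : ℝ × (Fin n → ℝ) =>
        F ((0 : Fin (n + 1)).insertNth p.1 p.2)) (hF.comp hm)),
      ← lintegral_indicator measurableSet_Ioi]
    refine lintegral_congr fun a => ?_
    have hFa : Measurable fun y : Fin n → ℝ => F ((0 : Fin (n + 1)).insertNth a y) :=
      hF.comp (hm.comp (by fun_prop : Measurable fun y : Fin n → ℝ => (a, y)))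
    by_cases ha : 0 < a
    · rw [Set.indicator_of_mem (Set.mem_Ioi.2 ha)]
      dsimp only
      rw [ih hFa, ← lintegral_const_mul _ (by fun_prop),
        ← lintegral_indicator (measurableSet_pos _)]
      refine lintegral_congr fun y => ?_
      by_cases hy : ∀ i, 0 < y i
      · rw [Set.indicator_of_mem (by exact hy), Set.indicator_of_mem, ← mul_assoc,
          ← ENNReal.ofReal_mul (Real.exp_nonneg _), ← Real.exp_add]
        · simp [Fin.sum_univ_succ, add_comm]
        · intro i
          induction i using Fin.cases with
          | zero => simpa using ha
          | succ i => simpa using hy i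
      · rw [Set.indicator_of_notMem (by exact hy), Set.indicator_of_notMem]
        intro h
        exact hy fun i => by simpa using h i.succ
    · rw [Set.indicator_of_notMem (by simpa using ha)]
      symm
      rw [lintegral_eq_zero_iff' (by
        refine Measurable.aemeasurable ?_
        exact (Measurable.indicator (by fun_prop) (measurableSet_pos _)).comp
          (hm.comp (by fun_prop : Measurable fun y : Fin n → ℝ => (a, y))))]
      refine ae_of_all _ fun y => Set.indicator_of_notMem (fun h => ha ?_) _
      simpa using h 0

lemma lintegral_Ioi_add (t : ℝ) (h : ℝ → ℝ≥0∞) :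
    ∫⁻ a in Set.Ioi 0, h (a + t) = ∫⁻ s in Set.Ioi t, h s := by
  rw [← lintegral_indicator measurableSet_Ioi, ← lintegral_indicator measurableSet_Ioi,
    ← lintegral_add_right_eq_self (fun s => (Set.Ioi t).indicator h s) t]
  refine lintegral_congr fun a => ?_
  simp [Set.indicator]

lemma lintegral_swap_triangle {f g : ℝ → ℝ≥0∞} (hf : Measurable f) (hg : Measurable g) :
    ∫⁻ t in Set.Ioi 0, f t * ∫⁻ s in Set.Ioi t, g s =
      ∫⁻ s in Set.Ioi 0, (∫⁻ t in Set.Ioo 0 s, f t) * g s := by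
  have hm : Measurable fun p : ℝ × ℝ => {p : ℝ × ℝ | 0 < p.1 ∧ p.1 < p.2}.indicator
      (fun p => f p.1 * g p.2) p := by
    refine Measurable.indicator (by fun_prop) ?_
    exact (measurableSet_lt measurable_const measurable_fst).inter
      (measurableSet_lt measurable_fst measurable_snd)
  have h := lintegral_lintegral_swap (μ := (volume : Measure ℝ)) (ν := (volume : Measure ℝ))
    (f := fun t s => {p : ℝ × ℝ | 0 < p.1 ∧ p.1 < p.2}.indicator (fun p => f p.1 * g p.2) (t, s))
    hm.aemeasurable
  rw [← lintegral_indicator measurableSet_Ioi, ← lintegral_indicator measurableSet_Ioi]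
  refine Eq.trans (lintegral_congr fun t => ?_) (h.trans (lintegral_congr fun s => ?_))
  · by_cases ht : 0 < t
    · rw [Set.indicator_of_mem (Set.mem_Ioi.2 ht), ← lintegral_const_mul _ hg,
        ← lintegral_indicator measurableSet_Ioi]
      exact lintegral_congr fun s => by simp [Set.indicator, ht]
    · rw [Set.indicator_of_notMem (by simpa using ht)]
      simp [Set.indicator, ht]
  · by_cases hs : 0 < s
    · rw [Set.indicator_of_mem (Set.mem_Ioi.2 hs), ← lintegral_mul_const _ hf,
        ← lintegral_indicator measurableSet_Ioo]
      exact lintegral_congr fun t => by simp [Set.indicator]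
    · rw [Set.indicator_of_notMem (by simpa using hs)]
      have : ∀ t : ℝ, ¬ (0 < t ∧ t < s) := fun t h => hs (h.1.trans h.2)
      simp [Set.indicator, this]

lemma lintegral_Ioo_pow_div_factorial (k : ℕ) {s : ℝ} (hs : 0 < s) :
    ∫⁻ t in Set.Ioo 0 s, ENNReal.ofReal (t ^ k / k.factorial) =
      ENNReal.ofReal (s ^ (k + 1) / (k + 1).factorial) := by
  rw [← ofReal_integral_eq_lintegral_ofReal]
  · rw [← integral_Ioc_eq_integral_Ioo, ← intervalIntegral.integral_of_le hs.le,
      intervalIntegral.integral_div, integral_pow, Nat.factorial_succ]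
    congr 1
    push_cast
    field_simp
    simp
  · exact (Continuous.integrableOn_Icc (by fun_prop)).mono_set Set.Ioo_subset_Icc_self
  · refine (ae_restrict_mem measurableSet_Ioo).mono fun t ht => ?_
    have := ht.1
    simp only [Pi.zero_apply]
    positivity

/-- Convolution: the exponentials multiply to `exp (-s)`, so one more variable replaces `t ^ k / k!`
by its integral over `(0, s)`. -/
lemma lintegral_pi_expLaw_sum (k : ℕ) {F : ℝ → ℝ≥0∞} (hF : Measurable F) :
    ∫⁻ y : Fin (k + 1) → ℝ, F (∑ i, y i) ∂(Measure.pi fun _ => expLaw) =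
      ∫⁻ t in Set.Ioi 0, ENNReal.ofReal (t ^ k / k.factorial) *
        (ENNReal.ofReal (Real.exp (-t)) * F t) := by
  induction k generalizing F with
  | zero =>
    have h1 := lintegral_pi_insertNth expLaw (0 : Fin 1)
      (f := fun y : Fin 1 → ℝ => F (∑ i, y i)) (by fun_prop)
    rw [h1, Measure.pi_of_empty]
    simp [lintegral_expLaw hF]
  | succ k ih =>
    rw [lintegral_pi_insertNth expLaw (0 : Fin (k + 2)) (by fun_prop)]
    simp only [Fin.insertNth_zero', Fin.sum_univ_succ (n := k + 1), Fin.cons_zero, Fin.cons_succ]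
    have h1 : ∀ a, ∫⁻ y : Fin (k + 1) → ℝ, F (a + ∑ i, y i) ∂(Measure.pi fun _ => expLaw) =
        ∫⁻ t in Set.Ioi 0, ENNReal.ofReal (t ^ k / k.factorial) *
        (ENNReal.ofReal (Real.exp (-t)) * F (a + t)) := fun a =>
      ih (F := fun t => F (a + t)) (by fun_prop)
    simp only [h1]
    have hm : Measurable fun p : ℝ × ℝ => ENNReal.ofReal (p.2 ^ k / k.factorial) *
        (ENNReal.ofReal (Real.exp (-p.2)) * F (p.1 + p.2)) := by fun_prop
    rw [lintegral_expLaw (hm.lintegral_prod_right (ν := volume.restrict (Set.Ioi 0)))]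
    have h2 : ∀ a, ENNReal.ofReal (Real.exp (-a)) * ∫⁻ t in Set.Ioi 0,
        ENNReal.ofReal (t ^ k / k.factorial) * (ENNReal.ofReal (Real.exp (-t)) * F (a + t)) =
        ∫⁻ t in Set.Ioi 0, ENNReal.ofReal (t ^ k / k.factorial) *
          (ENNReal.ofReal (Real.exp (-(a + t))) * F (a + t)) := by
      intro a
      rw [← lintegral_const_mul _ (by fun_prop)]
      refine lintegral_congr fun t => ?_
      rw [neg_add, Real.exp_add, ENNReal.ofReal_mul (Real.exp_nonneg _)]
      ring
    simp only [h2]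
    rw [lintegral_lintegral_swap (by fun_prop)]
    have h3 : ∀ t, ∫⁻ a in Set.Ioi 0, ENNReal.ofReal (t ^ k / k.factorial) *
          (ENNReal.ofReal (Real.exp (-(a + t))) * F (a + t)) =
        ENNReal.ofReal (t ^ k / k.factorial) *
          ∫⁻ s in Set.Ioi t, ENNReal.ofReal (Real.exp (-s)) * F s := by
      intro t
      rw [lintegral_const_mul _ (by fun_prop), lintegral_Ioi_add t
        fun s => ENNReal.ofReal (Real.exp (-s)) * F s]
    simp only [h3]
    rw [lintegral_swap_triangle (by fun_prop) (by fun_prop)]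
    refine setLIntegral_congr_fun measurableSet_Ioi fun s hs => ?_
    simp only [lintegral_Ioo_pow_div_factorial k (Set.mem_Ioi.1 hs)]

/-- The equivalence `e` is meant to separate the coordinates along eigenvectors with positive
eigenvalues from the `k + 1` coordinates along the kernel. The latter enter only through their sum
of squares, whose gamma law supplies the factor `x ^ k / k!` in the last variable. -/
lemma lintegral_pi_cgauss_snoc {m k r : ℕ} (e : Fin m ⊕ Fin (k + 1) ≃ Fin r)
    {G : (Fin (m + 1) → ℝ) → ℝ≥0∞} (hG : Measurable G) :
    ∫⁻ w, G ((Fin.last m).insertNth (∑ j, ‖w (e (Sum.inr j))‖ ^ 2)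
        fun i => ‖w (e (Sum.inl i))‖ ^ 2) ∂(Measure.pi fun _ : Fin r => cgauss 1) =
      ∫⁻ x in {x | ∀ i, 0 < x i}, ENNReal.ofReal (Real.exp (-∑ i, x i)) *
        (ENNReal.ofReal (x (Fin.last m) ^ k / k.factorial) * G x) := by
  have hins := measurable_insertNth (E := ℝ) (Fin.last m)
  set Φ : (Fin r → ℝ) → ℝ≥0∞ := fun y => G ((Fin.last m).insertNth (∑ j, y (e (Sum.inr j)))
    fun i => y (e (Sum.inl i))) with hΦ
  have hΦm : Measurable Φ := hG.comp (hins.comp (by fun_prop :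
    Measurable fun y : Fin r → ℝ => (∑ j, y (e (Sum.inr j)), fun i => y (e (Sum.inl i)))))
  have h1 : ∫⁻ w, Φ (fun i => ‖w i‖ ^ 2) ∂(Measure.pi fun _ : Fin r => cgauss 1) =
      ∫⁻ y, Φ y ∂(Measure.pi fun _ => expLaw) := by
    have hp := Measure.pi_map_pi (μ := fun _ : Fin r => cgauss 1)
      (f := fun _ (z : ℂ) => ‖z‖ ^ 2) (hμ := fun _ => by rw [cgauss_map_norm_sq]; infer_instance)
      (fun _ => by fun_prop)
    simp only [cgauss_map_norm_sq] at hp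
    rw [← hp, lintegral_map hΦm (by fun_prop)]
  have h2 : ∫⁻ y, Φ y ∂(Measure.pi fun _ => expLaw) =
      ∫⁻ a : Fin m → ℝ, ∫⁻ b : Fin (k + 1) → ℝ, G ((Fin.last m).insertNth (∑ j, b j) a)
        ∂(Measure.pi fun _ => expLaw) ∂(Measure.pi fun _ => expLaw) := by
    have hp1 := measurePreserving_piCongrLeft (fun _ : Fin r => expLaw) e
    have hp2 := measurePreserving_sumPiEquivProdPi_symm (X := fun _ : Fin m ⊕ Fin (k + 1) => ℝ)
      fun _ => expLaw
    rw [← hp1.lintegral_comp hΦm, ← hp2.lintegral_comp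
      (f := fun y => Φ (MeasurableEquiv.piCongrLeft (fun _ : Fin r => ℝ) e y))
      (hΦm.comp (MeasurableEquiv.measurable _)),
      lintegral_prod]
    · refine lintegral_congr fun a => lintegral_congr fun b => ?_
      simp only [hΦ]
      congr 2
      · refine Finset.sum_congr rfl fun j _ => ?_
        rw [MeasurableEquiv.coe_piCongrLeft, Equiv.piCongrLeft_apply_apply]
        rfl
      · funext i
        rw [MeasurableEquiv.coe_piCongrLeft, Equiv.piCongrLeft_apply_apply]
        rfl
    · exact ((hΦm.comp (MeasurableEquiv.measurable _)).comp
        (MeasurableEquiv.measurable _)).aemeasurable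
  refine h1.trans (h2.trans ?_)
  have h3 : ∀ a : Fin m → ℝ, ∫⁻ b : Fin (k + 1) → ℝ, G ((Fin.last m).insertNth (∑ j, b j) a)
      ∂(Measure.pi fun _ => expLaw) = ∫⁻ t in Set.Ioi 0, ENNReal.ofReal (t ^ k / k.factorial) *
        (ENNReal.ofReal (Real.exp (-t)) * G ((Fin.last m).insertNth t a)) := fun a =>
    lintegral_pi_expLaw_sum k (F := fun t => G ((Fin.last m).insertNth t a))
      (hG.comp (hins.comp (by fun_prop : Measurable fun t : ℝ => (t, a))))
  simp only [h3]
  have hGm : Measurable fun p : (Fin m → ℝ) × ℝ => G ((Fin.last m).insertNth p.2 p.1) :=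
    hG.comp (hins.comp measurable_swap)
  have hm : Measurable fun p : (Fin m → ℝ) × ℝ => ENNReal.ofReal (p.2 ^ k / k.factorial) *
      (ENNReal.ofReal (Real.exp (-p.2)) * G ((Fin.last m).insertNth p.2 p.1)) := by fun_prop
  rw [lintegral_pi_expLaw (hm.lintegral_prod_right (ν := volume.restrict (Set.Ioi 0))),
    ← lintegral_indicator (measurableSet_pos _), ← lintegral_indicator (measurableSet_pos _),
    lintegral_volume_insertNth (Fin.last m)
      (Measurable.indicator (by fun_prop) (measurableSet_pos _))]
  rw [lintegral_lintegral_swap]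
  swap
  · exact ((Measurable.indicator (by fun_prop) (measurableSet_pos _)).comp hins).aemeasurable
  refine lintegral_congr fun a => ?_
  by_cases ha : ∀ i, 0 < a i
  · have hGa : Measurable fun t : ℝ => G ((Fin.last m).insertNth t a) :=
      hGm.comp (by fun_prop : Measurable fun t : ℝ => (a, t))
    rw [Set.indicator_of_mem (by exact ha), ← lintegral_const_mul _ (by fun_prop),
      ← lintegral_indicator measurableSet_Ioi]
    refine lintegral_congr fun t => ?_
    by_cases ht : 0 < t
    · rw [Set.indicator_of_mem (Set.mem_Ioi.2 ht), Set.indicator_of_mem]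
      · rw [Fin.sum_univ_castSucc]
        simp only [Fin.insertNth_last', Fin.snoc_castSucc, Fin.snoc_last]
        rw [neg_add, Real.exp_add, ENNReal.ofReal_mul (Real.exp_nonneg _)]
        ring
      · intro i
        induction i using Fin.lastCases with
        | last => simpa using ht
        | cast i => simpa using ha i
    · rw [Set.indicator_of_notMem (by simpa using ht), Set.indicator_of_notMem]
      intro h
      exact ht (by simpa using h (Fin.last m))
  · rw [Set.indicator_of_notMem (by exact ha)]
    symm
    have : ∀ t : ℝ, (Fin.last m).insertNth t a ∉ {x : Fin (m + 1) → ℝ | ∀ i, 0 < x i} := by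
      intro t h
      exact ha fun i => by simpa using h i.castSucc
    simp only [Set.indicator_of_notMem (this _), lintegral_zero]

end SumLaws

end SLMIMO
namespace SLMIMO

/-! ### Rank-one updates of Gram matrices and a continuous spectral statistic. -/

section RankOne

open Polynomial in
lemma roots_prod_X_sub_C_neg {γ : Type*} [Fintype γ] (u : γ → ℝ) :
    (∏ a, (X - C (-u a))).roots = Multiset.map (fun a => -u a) Finset.univ.val := by
  rw [← roots_multiset_prod_X_sub_C (Multiset.map (fun a => -u a) Finset.univ.val),
    Multiset.map_map]
  rfl

open Polynomial in
-- The monic polynomials with roots `-f a` and `-g b` agree at infinitely many points, hence are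
-- equal. Equal root multiplicities are equal fibre cardinalities, and these give the bijection.
lemma exists_equiv_of_prod_eq {α β : Type*} [Fintype α] [Fintype β] {f : α → ℝ} {g : β → ℝ}
    (h : ∀ j : ℕ, ∏ a, ((j : ℝ) + 1 + f a) = ∏ b, ((j : ℝ) + 1 + g b)) :
    ∃ e : α ≃ β, ∀ a, g (e a) = f a := by
  classical
  have hp : ∏ a, (X - C (-f a)) = ∏ b, (X - C (-g b)) := by
    refine eq_of_infinite_eval_eq _ _ ?_
    refine (Set.infinite_range_of_injective (f := fun j : ℕ => (j : ℝ) + 1) fun i j hij => by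
      simpa using hij).mono ?_
    rintro _ ⟨j, rfl⟩
    simpa [eval_prod] using h j
  have hr := congrArg roots hp
  rw [roots_prod_X_sub_C_neg, roots_prod_X_sub_C_neg] at hr
  have hc : ∀ c : ℝ, Fintype.card {a // f a = c} = Fintype.card {b // g b = c} := by
    intro c
    have h1 := congrArg (Multiset.count (-c)) hr
    rw [Multiset.count_map, Multiset.count_map] at h1
    rw [Fintype.card_subtype, Fintype.card_subtype, Finset.card_def, Finset.card_def,
      Finset.filter_val, Finset.filter_val]
    simpa [eq_comm] using h1
  exact ⟨Equiv.ofFiberEquiv fun c => Fintype.equivOfCardEq (hc c),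
    fun a => Equiv.ofFiberEquiv_map _ a⟩

variable {m r : ℕ}

/-- The Gram matrix `Hᴴ H`. -/
noncomputable def gram (H : Fin m → Fin r → ℂ) : Matrix (Fin r) (Fin r) ℂ :=
  (Matrix.of H)ᴴ * Matrix.of H

/-- The values `det (z + Hᴴ H)` at the positive integers. -/
noncomputable def gramDet (H : Fin m → Fin r → ℂ) : ℕ → ℝ := fun j =>
  ((((j : ℝ) + 1 : ℝ) : ℂ) • (1 : Matrix (Fin r) (Fin r) ℂ) + gram H).det.re

lemma gram_insertNth (h : Fin r → ℂ) (H : Fin m → Fin r → ℂ) :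
    gram ((0 : Fin (m + 1)).insertNth h H) = gram H + Matrix.vecMulVec (star h) h := by
  ext a b
  simp [gram, Matrix.mul_apply, Fin.sum_univ_succ, Matrix.vecMulVec_apply, add_comm]

lemma exists_spectral (H : Fin m → Fin r → ℂ) :
    ∃ A ∈ Matrix.unitaryGroup (Fin r) ℂ, ∃ d : Fin r → ℝ,
      gram H = A * Matrix.diagonal (fun i => (d i : ℂ)) * Aᴴ := by
  have hG : (gram H).IsHermitian := Matrix.isHermitian_conjTranspose_mul_self _
  refine ⟨hG.eigenvectorUnitary, hG.eigenvectorUnitary.2, hG.eigenvalues, ?_⟩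
  conv_lhs => rw [hG.spectral_theorem, Unitary.conjStarAlgAut_apply]
  rfl

lemma det_conj {A : Matrix (Fin r) (Fin r) ℂ} (hA : A ∈ Matrix.unitaryGroup (Fin r) ℂ)
    (B : Matrix (Fin r) (Fin r) ℂ) : (A * B * Aᴴ).det = B.det := by
  rw [Matrix.det_mul_comm, ← mul_assoc, ← Matrix.star_eq_conjTranspose,
    Matrix.mem_unitaryGroup_iff'.1 hA, one_mul]

lemma smul_one_add_conj {A : Matrix (Fin r) (Fin r) ℂ} (hA : A ∈ Matrix.unitaryGroup (Fin r) ℂ)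
    (z : ℂ) (B : Matrix (Fin r) (Fin r) ℂ) :
    z • (1 : Matrix (Fin r) (Fin r) ℂ) + A * B * Aᴴ =
      A * (z • (1 : Matrix (Fin r) (Fin r) ℂ) + B) * Aᴴ := by
  rw [mul_add, add_mul, Matrix.mul_smul, mul_one, Matrix.smul_mul,
    ← Matrix.star_eq_conjTranspose, Matrix.mem_unitaryGroup_iff.1 hA]

lemma smul_one_add_diagonal (z : ℝ) (d : Fin r → ℝ) :
    (z : ℂ) • (1 : Matrix (Fin r) (Fin r) ℂ) + Matrix.diagonal (fun i => (d i : ℂ)) =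
      Matrix.diagonal fun i => ((z + d i : ℝ) : ℂ) := by
  rw [← Matrix.diagonal_one, ← Matrix.diagonal_smul, Matrix.diagonal_add]
  simp

lemma gramDet_eq {H : Fin m → Fin r → ℂ} {A : Matrix (Fin r) (Fin r) ℂ}
    (hA : A ∈ Matrix.unitaryGroup (Fin r) ℂ) {d : Fin r → ℝ}
    (hd : gram H = A * Matrix.diagonal (fun i => (d i : ℂ)) * Aᴴ) (j : ℕ) :
    gramDet H j = ∏ i, ((j : ℝ) + 1 + d i) := by
  rw [gramDet, hd, smul_one_add_conj hA, det_conj hA, smul_one_add_diagonal, Matrix.det_diagonal]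
  rw [← Complex.ofReal_prod, Complex.ofReal_re]

lemma det_diagonal_add_vecMulVec {D : Fin r → ℝ} (hD : ∀ i, D i ≠ 0) (w : Fin r → ℂ) :
    (Matrix.diagonal (fun i => (D i : ℂ)) + Matrix.vecMulVec (star w) w).det =
      (((∏ i, D i) * (1 + ∑ i, ‖w i‖ ^ 2 / D i) : ℝ) : ℂ) := by
  have h1 : Matrix.diagonal (fun i => (D i : ℂ)) + Matrix.vecMulVec (star w) w =
      Matrix.diagonal (fun i => (D i : ℂ)) *
        (1 + Matrix.replicateCol Unit (fun i => (D i : ℂ)⁻¹ * star (w i)) *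
          Matrix.replicateRow Unit w) := by
    rw [mul_add, mul_one, ← Matrix.vecMulVec_eq Unit, Matrix.mul_vecMulVec]
    congr 2
    funext i
    rw [Matrix.mulVec_diagonal, mul_inv_cancel_left₀ (by exact_mod_cast hD i)]
    rfl
  rw [h1, Matrix.det_mul, Matrix.det_diagonal, Matrix.det_one_add_replicateCol_mul_replicateRow]
  push_cast
  congr 2
  refine Finset.sum_congr rfl fun i _ => ?_
  rw [← Complex.mul_conj']
  simp only [RCLike.star_def]
  ring

/-- In an eigenbasis of `gram H` the new row has coordinates `Aᵀ *ᵥ h`, and the update becomes a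
diagonal matrix plus a rank-one matrix, to which the matrix determinant lemma applies. -/
lemma gramDet_insertNth {H : Fin m → Fin r → ℂ} {A : Matrix (Fin r) (Fin r) ℂ}
    (hA : A ∈ Matrix.unitaryGroup (Fin r) ℂ) {d : Fin r → ℝ} (hd0 : ∀ i, 0 ≤ d i)
    (hd : gram H = A * Matrix.diagonal (fun i => (d i : ℂ)) * Aᴴ) (h : Fin r → ℂ) (j : ℕ) :
    gramDet ((0 : Fin (m + 1)).insertNth h H) j = (∏ i, ((j : ℝ) + 1 + d i)) *
      (1 + ∑ i, ‖(Aᵀ *ᵥ h) i‖ ^ 2 / ((j : ℝ) + 1 + d i)) := by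
  have h1 : Matrix.vecMulVec (star h) h =
      A * Matrix.vecMulVec (star (Aᵀ *ᵥ h)) (Aᵀ *ᵥ h) * Aᴴ := by
    rw [Matrix.mul_vecMulVec, Matrix.vecMulVec_mul, Matrix.mulVec_transpose, Matrix.star_vecMul,
      Matrix.mulVec_mulVec, Matrix.vecMul_vecMul, ← Matrix.star_eq_conjTranspose,
      Matrix.mem_unitaryGroup_iff.1 hA, Matrix.one_mulVec, Matrix.vecMul_one]
  have hne : ∀ i, (j : ℝ) + 1 + d i ≠ 0 := fun i => by
    have := hd0 i
    positivity
  rw [gramDet, gram_insertNth, hd, h1, ← add_mul, ← mul_add, smul_one_add_conj hA, det_conj hA,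
    ← add_assoc, smul_one_add_diagonal, det_diagonal_add_vecMulVec hne, Complex.ofReal_re]

lemma continuous_gramDet : Continuous (gramDet : (Fin m → Fin r → ℂ) → ℕ → ℝ) := by
  refine continuous_pi fun j => Complex.continuous_re.comp (Continuous.matrix_det ?_)
  refine continuous_const.add ?_
  refine continuous_matrix fun a b => ?_
  simp only [gram, Matrix.mul_apply, Matrix.conjTranspose_apply, Matrix.of_apply]
  fun_prop

/-- The values `z ^ k ∏ (z + x_i)` at the positive integers. -/
noncomputable def prodStat (k : ℕ) (x : Fin m → ℝ) : ℕ → ℝ := fun j =>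
  ((j : ℝ) + 1) ^ k * ∏ i, ((j : ℝ) + 1 + x i)

lemma continuous_prodStat (k : ℕ) : Continuous (prodStat k : (Fin m → ℝ) → ℕ → ℝ) := by
  refine continuous_pi fun j => ?_
  simp only [prodStat]
  fun_prop

lemma prodStat_eq (k : ℕ) (x : Fin m → ℝ) (j : ℕ) : prodStat k x j =
    ∏ s : Fin m ⊕ Fin k, ((j : ℝ) + 1 + Sum.elim x (fun _ => 0) s) := by
  simp [prodStat, Fintype.prod_sum_type, mul_comm]

/-- An antitone family with the same values of `prodStat` as a strictly decreasing one. -/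
lemma eq_of_prodStat_eq {k : ℕ} {x y : Fin m → ℝ} (hx : StrictAnti x) (hy : Antitone y)
    (h : prodStat k x = prodStat k y) : x = y := by
  obtain ⟨e, he⟩ := exists_equiv_of_prod_eq (f := x) (g := y) fun j => by
    have := congrFun h j
    exact mul_left_cancel₀ (by positivity) this
  have hy' : StrictAnti y := hy.strictAnti_of_injective fun a b hab => by
    have h1 := he (e.symm a)
    have h2 := he (e.symm b)
    rw [Equiv.apply_symm_apply] at h1 h2
    exact e.symm.injective (hx.injective (h1.symm.trans (hab.trans h2)))
  refine (hx.range_inj hy').1 ?_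
  rw [show x = y ∘ e from funext fun a => (he a).symm, e.surjective.range_comp]

lemma isOpen_strictCone : IsOpen (strictCone m) := by
  have : strictCone m = (⋂ i, ⋂ j, ⋂ (_ : i < j), {x : Fin m → ℝ | x j < x i}) ∩
      ⋂ i, {x | 0 < x i} := by
    ext x
    simp [strictCone, StrictAnti]
  rw [this]
  refine IsOpen.inter ?_ (isOpen_iInter_of_finite fun i => isOpen_lt (by fun_prop) (by fun_prop))
  exact isOpen_iInter_of_finite fun i => isOpen_iInter_of_finite fun j =>
    isOpen_iInter_of_finite fun _ => isOpen_lt (by fun_prop) (by fun_prop)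

/-- An injective continuous map on a Borel subset of a Polish space is a measurable embedding. Hence
every measurable function on the cone factors measurably through the statistic, and no measurable
selection of eigenvalues is needed. -/
lemma measurableEmbedding_prodStat (k : ℕ) :
    MeasurableEmbedding ((strictCone m).domRestrict (prodStat k)) :=
  (continuous_prodStat k).continuousOn.measurableEmbedding isOpen_strictCone.measurableSet
    fun _ hx _ hy h => eq_of_prodStat_eq hx.1 hy.1.antitone h

lemma snoc_strictAnti {x : Fin m → ℝ} (hx : x ∈ strictCone m) :
    StrictAnti ((Fin.last m).insertNth 0 x : Fin (m + 1) → ℝ) := by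
  intro i j hij
  induction i using Fin.lastCases with
  | last => exact absurd hij (Fin.not_lt.2 (Fin.le_last j))
  | cast i =>
    induction j using Fin.lastCases with
    | last => simpa using hx.2 i
    | cast j => simpa using hx.1 (by simpa using hij)

lemma prod_add_eq_of_weights {n : ℕ} {ν : Fin n → ℝ} (hν : StrictAnti ν) (μ : Fin n → ℝ) {z : ℝ}
    (hz : ∀ i, z + ν i ≠ 0) :
    (∏ i, (z + ν i)) * (1 + ∑ i, weights ν μ i / (z + ν i)) = ∏ i, (z + μ i) := by
  have h := congrArg (Polynomial.eval (-z)) (nodal_eq_secular hν μ)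
  have hsign : ∀ (s : Finset (Fin n)) (f : Fin n → ℝ), ∏ i ∈ s, (-z - f i) =
      (-1) ^ s.card * ∏ i ∈ s, (z + f i) := by
    intro s f
    rw [← Finset.prod_const, ← Finset.prod_mul_distrib]
    exact Finset.prod_congr rfl fun _ _ => by ring
  simp only [secular, Polynomial.eval_sub, Lagrange.eval_nodal, Polynomial.eval_finsetSum,
    Polynomial.eval_mul, Polynomial.eval_C, hsign] at h
  have hn : ((-1 : ℝ) ^ (Finset.univ : Finset (Fin n)).card) ≠ 0 := by positivity
  refine mul_left_cancel₀ hn (Eq.trans ?_ h.symm)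
  rw [mul_add, mul_one, mul_add, sub_eq_add_neg, ← Finset.sum_neg_distrib, Finset.mul_sum,
    Finset.mul_sum]
  congr 1
  refine Finset.sum_congr rfl fun i _ => ?_
  rw [← Finset.mul_prod_erase _ _ (Finset.mem_univ i)]
  have hcard : (Finset.univ : Finset (Fin n)).card = (Finset.univ.erase i).card + 1 := by
    rw [Finset.card_erase_add_one (Finset.mem_univ i)]
  rw [hcard, pow_succ]
  field_simp [hz i]

end RankOne

end SLMIMO
namespace SLMIMO

/-! ### The eigenvalue density, by adding one row at a time. -/

section Wishart

variable {m k r : ℕ}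

/-- The unnormalized density of the ordered squared singular values. -/
noncomputable def svDensity (k : ℕ) (x : Fin m → ℝ) : ℝ :=
  absVand x ^ 2 * (∏ i, x i) ^ k * Real.exp (-∑ i, x i)

lemma continuous_svDensity (k : ℕ) : Continuous (svDensity k : (Fin m → ℝ) → ℝ) := by
  have := continuous_absVand (m := m)
  unfold svDensity
  fun_prop

lemma measurable_absVand : Measurable (absVand : (Fin m → ℝ) → ℝ) := continuous_absVand.measurable

lemma absVand_snoc {x : Fin m → ℝ} (hx : ∀ i, 0 < x i) :
    absVand ((Fin.last m).insertNth 0 x : Fin (m + 1) → ℝ) = absVand x * ∏ i, x i := by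
  have h : ∀ {n : ℕ} (y : Fin n → ℝ), absVand y =
      ∏ i, ∏ j, if i < j then |y j - y i| else 1 := by
    intro n y
    rw [absVand_eq]
    refine Finset.prod_congr rfl fun i _ => ?_
    rw [← Finset.prod_filter]
    congr 1
    ext j
    simp
  rw [h, h, Fin.prod_univ_castSucc]
  have hlast : ∀ j, ¬ Fin.last m < j := fun j => Fin.not_lt.2 (Fin.le_last j)
  simp only [hlast, if_false, Finset.prod_const_one, mul_one, Fin.prod_univ_castSucc,
    Fin.castSucc_lt_castSucc_iff, Fin.castSucc_lt_last, if_true, Fin.insertNth_last',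
    Fin.snoc_castSucc, Fin.snoc_last, Finset.prod_mul_distrib]
  congr 1
  exact Finset.prod_congr rfl fun i _ => by rw [zero_sub, abs_neg, abs_of_pos (hx i)]

/-- The transition kernel of the squared singular values when a row is added. -/
noncomputable def addRowKernel (k : ℕ) (x : Fin m → ℝ) (μ : Fin (m + 1) → ℝ) : ℝ :=
  absVand μ / (absVand x * ∏ i, x i) * (Real.exp (-(∑ i, μ i - ∑ i, x i)) *
    (((∏ i, μ i) / ∏ i, x i) ^ k / k.factorial))

lemma weights_snoc_last {x : Fin m → ℝ} (μ : Fin (m + 1) → ℝ) :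
    weights ((Fin.last m).insertNth 0 x : Fin (m + 1) → ℝ) μ (Fin.last m) =
      (∏ i, μ i) / ∏ i, x i := by
  have h : (Finset.univ.erase (Fin.last m) : Finset (Fin (m + 1))) =
      Finset.univ.map Fin.castSuccEmb := by
    ext j
    induction j using Fin.lastCases with
    | last => simp
    | cast j => simp [Fin.castSucc_ne_last]
  rw [weights, h, Finset.prod_map]
  simp only [Fin.coe_castSuccEmb, Fin.insertNth_last', Fin.snoc_castSucc, Fin.snoc_last, sub_zero]
  rw [div_eq_inv_mul]

/-- The spectrum of `gram H` consists of `x` and of `k + 1` zeros. By unitary invariance the new row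
is again standard Gaussian in an eigenbasis. Its squared moduli, summed over the kernel, are the
weights of a secular polynomial with nodes `x` and `0`; passing from weights to roots yields
`addRowKernel`. -/
lemma lintegral_gramDet_insertNth {x : Fin m → ℝ} (hx : x ∈ strictCone m)
    {H : Fin m → Fin r → ℂ} (hH : gramDet H = prodStat (k + 1) x)
    {G : (ℕ → ℝ) → ℝ≥0∞} (hG : Measurable G) :
    ∫⁻ h, G (gramDet ((0 : Fin (m + 1)).insertNth h H)) ∂(Measure.pi fun _ : Fin r => cgauss 1) =
      ∫⁻ μ in interlacing ((Fin.last m).insertNth 0 x : Fin (m + 1) → ℝ),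
        ENNReal.ofReal (addRowKernel k x μ) * G (prodStat k μ) := by
  obtain ⟨A, hA, d, hd⟩ := exists_spectral H
  set ν : Fin (m + 1) → ℝ := (Fin.last m).insertNth 0 x with hν
  have hνa : StrictAnti ν := snoc_strictAnti hx
  have hν0 : ∀ i, 0 ≤ ν i := by
    intro i
    induction i using Fin.lastCases with
    | last => simp [hν]
    | cast i => simpa [hν] using (hx.2 i).le
  obtain ⟨e, he⟩ := exists_equiv_of_prod_eq (α := Fin m ⊕ Fin (k + 1))
    (f := Sum.elim x fun _ => 0) (g := d) fun j => by
      rw [← prodStat_eq, ← hH, gramDet_eq hA hd]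
  have hd0 : ∀ i, 0 ≤ d i := by
    intro i
    obtain ⟨s, rfl⟩ := e.surjective i
    rw [he]
    rcases s with i | j
    · exact (hx.2 i).le
    · exact le_rfl
  -- The statistic of the enlarged matrix as a function of the weights. One of the `k + 1` zero
  -- eigenvalues is kept as the last node, the other `k` form the power in front.
  set S : (Fin (m + 1) → ℝ) → ℕ → ℝ := fun y j => ((j : ℝ) + 1) ^ k *
    ((∏ i, ((j : ℝ) + 1 + ν i)) * (1 + ∑ i, y i / ((j : ℝ) + 1 + ν i))) with hS
  have hSm : Measurable S := by
    refine measurable_pi_iff.2 fun j => ?_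
    simp only [hS]
    fun_prop
  have hstat : ∀ h : Fin r → ℂ, gramDet ((0 : Fin (m + 1)).insertNth h H) =
      S ((Fin.last m).insertNth (∑ j, ‖(Aᵀ *ᵥ h) (e (Sum.inr j))‖ ^ 2)
        fun i => ‖(Aᵀ *ᵥ h) (e (Sum.inl i))‖ ^ 2) := by
    intro h
    funext j
    rw [gramDet_insertNth hA hd0 hd, ← e.prod_comp, ← e.sum_comp]
    simp only [he, Fintype.prod_sum_type, Fintype.sum_sum_type, Sum.elim_inl, Sum.elim_inr, hS, hν,
      Fin.prod_univ_castSucc, Fin.sum_univ_castSucc, Fin.insertNth_last', Fin.snoc_castSucc,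
      Fin.snoc_last, add_zero, Finset.prod_const, Finset.card_univ, Fintype.card_fin,
      ← Finset.sum_div]
    ring
  have hAt : Aᵀ ∈ Matrix.unitaryGroup (Fin r) ℂ := by
    have h1 : star Aᵀ = (star A)ᵀ := rfl
    rw [Matrix.mem_unitaryGroup_iff, h1, ← Matrix.transpose_mul,
      Matrix.mem_unitaryGroup_iff'.1 hA, Matrix.transpose_one]
  have hins := measurable_insertNth (E := ℝ) (Fin.last m)
  have hF : Measurable fun w : Fin r → ℂ => G (S ((Fin.last m).insertNth
      (∑ j, ‖w (e (Sum.inr j))‖ ^ 2) fun i => ‖w (e (Sum.inl i))‖ ^ 2)) := by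
    refine hG.comp (hSm.comp (hins.comp (?_ : Measurable fun w : Fin r → ℂ =>
      (∑ j, ‖w (e (Sum.inr j))‖ ^ 2, fun i => ‖w (e (Sum.inl i))‖ ^ 2))))
    fun_prop
  simp only [hstat]
  have hmv : Measurable fun h : Fin r → ℂ => Aᵀ *ᵥ h := by
    have : Continuous fun h : Fin r → ℂ => Aᵀ *ᵥ h := by fun_prop
    exact this.measurable
  rw [← lintegral_map hF hmv, pi_cgauss_map_mulVec 1 hAt,
    lintegral_pi_cgauss_snoc e (G := fun y => G (S y)) (hG.comp hSm),
    lintegral_pos_eq_lintegral_interlacing hνa]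
  refine setLIntegral_congr_fun (isOpen_interlacing ν).measurableSet fun μ hμ => ?_
  have hμ0 : ∀ i, 0 < μ i := fun i => (hν0 i).trans_lt (hμ.1 i)
  have hSw : S (weights ν μ) = prodStat k μ := by
    funext j
    simp only [hS, prodStat]
    rw [prod_add_eq_of_weights hνa μ fun i => by have := hν0 i; positivity]
  have hsum : ∑ i, ν i = ∑ i, x i := by
    simp [hν, Fin.sum_univ_castSucc]
  simp only [hSw, sum_weights hνa, hsum]
  rw [hν, weights_snoc_last, absVand_snoc hx.2, addRowKernel, ENNReal.ofReal_mul,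
    ENNReal.ofReal_mul (Real.exp_nonneg _)]
  · ring
  · exact div_nonneg (absVand_nonneg _)
      (mul_nonneg (absVand_nonneg _) (Finset.prod_nonneg fun i _ => (hx.2 i).le))

/-- The same set of pairs fibred over the old and over the new eigenvalues, as needed to exchange
the integrations. -/
lemma mem_cone_interlacing_iff {x : Fin m → ℝ} {μ : Fin (m + 1) → ℝ} :
    (x ∈ strictCone m ∧ μ ∈ interlacing ((Fin.last m).insertNth 0 x : Fin (m + 1) → ℝ)) ↔
      (μ ∈ strictCone (m + 1) ∧ x ∈ gapBox μ) := by
  constructor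
  · rintro ⟨hx, hμ⟩
    refine ⟨⟨interlacing_strictAnti hμ, fun i => ?_⟩, fun i _ => ⟨?_, ?_⟩⟩
    · refine lt_of_le_of_lt ?_ (hμ.1 i)
      induction i using Fin.lastCases with
      | last => simp
      | cast i => simpa using (hx.2 i).le
    · simpa using hμ.2 i.castSucc i.succ i.castSucc_lt_succ
    · simpa using hμ.1 i.castSucc
  · rintro ⟨hμ, hx⟩
    have hx' : x ∈ strictCone m :=
      ⟨gapBox_strictAnti hμ.1 hx, fun i => (hμ.2 _).trans (hx i (Set.mem_univ i)).1⟩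
    refine ⟨hx', fun i => ?_, fun i j hij => ?_⟩
    · induction i using Fin.lastCases with
      | last => simpa using hμ.2 (Fin.last m)
      | cast i => simpa using (hx i (Set.mem_univ i)).2
    · induction i using Fin.lastCases with
      | last => exact absurd hij (Fin.not_lt.2 (Fin.le_last j))
      | cast i =>
        refine (hμ.1.antitone (Fin.castSucc_lt_iff_succ_le.1 hij)).trans_lt ?_
        simpa using (hx i (Set.mem_univ i)).1

/-- The powers of `∏ x i`, one Vandermonde factor and the exponential of `∑ x i` cancel. What
remains depends on `x` through `absVand x` alone, so that `lintegral_gapBox_absVand` applies. -/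
lemma svDensity_mul_addRowKernel {x : Fin m → ℝ} (hx : x ∈ strictCone m) (μ : Fin (m + 1) → ℝ) :
    svDensity (k + 1) x * addRowKernel k x μ =
      absVand x * (absVand μ * (∏ i, μ i) ^ k * Real.exp (-∑ i, μ i) / k.factorial) := by
  have h1 := absVand_pos hx.1
  have h2 : 0 < ∏ i, x i := Finset.prod_pos fun i _ => hx.2 i
  have h3 : Real.exp (-(∑ i, μ i - ∑ i, x i)) = Real.exp (-∑ i, μ i) * Real.exp (∑ i, x i) := by
    rw [← Real.exp_add]; ring_nf
  have h4 : Real.exp (-∑ i, x i) = (Real.exp (∑ i, x i))⁻¹ := Real.exp_neg _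
  have h5 := Real.exp_pos (∑ i, x i)
  rw [svDensity, addRowKernel, h3, h4, div_pow]
  field_simp
  ring

lemma svDensity_nonneg {x : Fin m → ℝ} (hx : ∀ i, 0 ≤ x i) : 0 ≤ svDensity k x :=
  mul_nonneg (mul_nonneg (sq_nonneg _) (pow_nonneg (Finset.prod_nonneg fun i _ => hx i) _))
    (Real.exp_nonneg _)

lemma measurable_addRowKernel :
    Measurable fun p : (Fin m → ℝ) × (Fin (m + 1) → ℝ) => addRowKernel k p.1 p.2 := by
  have h1 : Measurable fun p : (Fin m → ℝ) × (Fin (m + 1) → ℝ) => absVand p.1 :=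
    measurable_absVand.comp measurable_fst
  have h2 : Measurable fun p : (Fin m → ℝ) × (Fin (m + 1) → ℝ) => absVand p.2 :=
    measurable_absVand.comp measurable_snd
  unfold addRowKernel
  refine Measurable.mul (h2.div (h1.mul (by fun_prop))) (by fun_prop)

lemma lintegral_svDensity_addRowKernel {g : (Fin (m + 1) → ℝ) → ℝ≥0∞} (hg : Measurable g) :
    ∫⁻ x in strictCone m, ENNReal.ofReal (svDensity (k + 1) x) *
        ∫⁻ μ in interlacing ((Fin.last m).insertNth 0 x : Fin (m + 1) → ℝ),
          ENNReal.ofReal (addRowKernel k x μ) * g μ =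
      ENNReal.ofReal ((∏ j : Fin m, ((j : ℝ) + 1)⁻¹) / k.factorial) *
        ∫⁻ μ in strictCone (m + 1), ENNReal.ofReal (svDensity k μ) * g μ := by
  obtain ⟨P, hP⟩ : ∃ P : Set ((Fin m → ℝ) × (Fin (m + 1) → ℝ)), ∀ x μ, (x, μ) ∈ P ↔
      (x ∈ strictCone m ∧ μ ∈ interlacing ((Fin.last m).insertNth 0 x : Fin (m + 1) → ℝ)) :=
    ⟨{p | p.1 ∈ strictCone m ∧
      p.2 ∈ interlacing ((Fin.last m).insertNth 0 p.1 : Fin (m + 1) → ℝ)}, fun _ _ => Iff.rfl⟩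
  have hP' : ∀ x μ, (x, μ) ∈ P ↔ (μ ∈ strictCone (m + 1) ∧ x ∈ gapBox μ) := fun x μ =>
    (hP x μ).trans mem_cone_interlacing_iff
  have hPm : MeasurableSet P := by
    have : P = {p | p.2 ∈ strictCone (m + 1)} ∩
        ⋂ i : Fin m, ({p | p.2 i.succ < p.1 i} ∩ {p | p.1 i < p.2 i.castSucc}) := by
      ext p
      refine (hP' p.1 p.2).trans ?_
      simp [gapBox]
    rw [this]
    refine (measurable_snd isOpen_strictCone.measurableSet).inter (MeasurableSet.iInter fun i => ?_)
    exact (measurableSet_lt (by fun_prop) (by fun_prop)).inter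
      (measurableSet_lt (by fun_prop) (by fun_prop))
  have hK := measurable_addRowKernel (m := m) (k := k)
  have hD : Measurable fun p : (Fin m → ℝ) × (Fin (m + 1) → ℝ) => svDensity (k + 1) p.1 :=
    (continuous_svDensity (k + 1)).measurable.comp measurable_fst
  obtain ⟨F, hF, hFm⟩ : ∃ F : (Fin m → ℝ) × (Fin (m + 1) → ℝ) → ℝ≥0∞,
      (∀ x μ, F (x, μ) = ENNReal.ofReal (svDensity (k + 1) x) *
        (ENNReal.ofReal (addRowKernel k x μ) * g μ)) ∧ Measurable F :=
    ⟨fun p => ENNReal.ofReal (svDensity (k + 1) p.1) *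
      (ENNReal.ofReal (addRowKernel k p.1 p.2) * g p.2), fun _ _ => rfl, by fun_prop⟩
  have hswap := lintegral_lintegral_swap (μ := (volume : Measure (Fin m → ℝ)))
    (ν := (volume : Measure (Fin (m + 1) → ℝ))) (f := fun x μ => P.indicator F (x, μ))
    (hFm.indicator hPm).aemeasurable
  have houter : ∀ x ∈ strictCone m, ENNReal.ofReal (svDensity (k + 1) x) *
        ∫⁻ μ in interlacing ((Fin.last m).insertNth 0 x : Fin (m + 1) → ℝ),
          ENNReal.ofReal (addRowKernel k x μ) * g μ = ∫⁻ μ, P.indicator F (x, μ) := by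
    intro x hx
    have hKx : Measurable (addRowKernel k x) := Measurable.of_uncurry_left (f := addRowKernel k) hK
    rw [← lintegral_const_mul (f := fun μ => ENNReal.ofReal (addRowKernel k x μ) * g μ) _
      (hKx.ennreal_ofReal.mul hg)]
    refine (lintegral_indicator (isOpen_interlacing _).measurableSet _).symm.trans
      (lintegral_congr fun μ => ?_)
    by_cases hμ : μ ∈ interlacing ((Fin.last m).insertNth 0 x : Fin (m + 1) → ℝ)
    · rw [Set.indicator_of_mem hμ, Set.indicator_of_mem ((hP x μ).2 ⟨hx, hμ⟩), hF]
    · rw [Set.indicator_of_notMem hμ, Set.indicator_of_notMem (fun h => hμ ((hP x μ).1 h).2)]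
  have hzero : ∀ x ∉ strictCone m, ∫⁻ μ, P.indicator F (x, μ) = 0 := by
    intro x hx
    have : ∀ μ, (x, μ) ∉ P := fun μ h => hx ((hP x μ).1 h).1
    simp only [Set.indicator_of_notMem (this _), lintegral_zero]
  have hleft : ∫⁻ x in strictCone m, ENNReal.ofReal (svDensity (k + 1) x) *
        ∫⁻ μ in interlacing ((Fin.last m).insertNth 0 x : Fin (m + 1) → ℝ),
          ENNReal.ofReal (addRowKernel k x μ) * g μ =
      ∫⁻ x, ∫⁻ μ, P.indicator F (x, μ) := by
    rw [setLIntegral_congr_fun isOpen_strictCone.measurableSet houter]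
    exact setLIntegral_eq_of_support_subset fun x hx => by
      by_contra hcon
      exact hx (hzero x hcon)
  refine hleft.trans (hswap.trans ?_)
  rw [← lintegral_const_mul' _ _ ENNReal.ofReal_ne_top,
    ← lintegral_indicator isOpen_strictCone.measurableSet]
  refine lintegral_congr fun μ => ?_
  by_cases hμ : μ ∈ strictCone (m + 1)
  · set c : ℝ := absVand μ * (∏ i, μ i) ^ k * Real.exp (-∑ i, μ i) / k.factorial with hc
    have hc0 : 0 ≤ c := div_nonneg (mul_nonneg (mul_nonneg (absVand_nonneg _)
      (pow_nonneg (Finset.prod_nonneg fun i _ => (hμ.2 i).le) _)) (Real.exp_nonneg _))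
      (Nat.cast_nonneg _)
    have h1 : ∀ x, P.indicator F (x, μ) =
        (gapBox μ).indicator (fun x => ENNReal.ofReal (absVand x)) x *
          (ENNReal.ofReal c * g μ) := by
      intro x
      by_cases hx : x ∈ gapBox μ
      · have hp : (x, μ) ∈ P := (hP' x μ).2 ⟨hμ, hx⟩
        have hxc := ((hP x μ).1 hp).1
        rw [Set.indicator_of_mem hx, Set.indicator_of_mem hp, hF, ← mul_assoc, ← mul_assoc,
          ← ENNReal.ofReal_mul (svDensity_nonneg fun i => (hxc.2 i).le),
          ← ENNReal.ofReal_mul (absVand_nonneg _), svDensity_mul_addRowKernel hxc]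
      · rw [Set.indicator_of_notMem hx, zero_mul, Set.indicator_of_notMem]
        exact fun h => hx ((hP' x μ).1 h).2
    simp only [h1]
    have hA : Measurable fun x : Fin m → ℝ => ENNReal.ofReal (absVand x) :=
      measurable_absVand.ennreal_ofReal
    rw [lintegral_mul_const _ (hA.indicator (measurableSet_gapBox μ)),
      lintegral_indicator (measurableSet_gapBox μ), lintegral_gapBox_absVand hμ.1,
      Set.indicator_of_mem hμ, ← mul_assoc, ← mul_assoc, ← ENNReal.ofReal_mul, ← ENNReal.ofReal_mul]
    · congr 2
      rw [hc, svDensity]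
      ring
    · exact div_nonneg (Finset.prod_nonneg fun j _ => by positivity) (Nat.cast_nonneg _)
    · exact mul_nonneg (Finset.prod_nonneg fun j _ => by positivity) (absVand_nonneg _)
  · rw [Set.indicator_of_notMem hμ]
    have : ∀ x, (x, μ) ∉ P := fun x h => hμ ((hP' x μ).1 h).1
    simp only [Set.indicator_of_notMem (this _), lintegral_zero]

/-- The hypothesis is tested on the indicator of the complement of the range, for which the
right-hand side vanishes. -/
lemma ae_mem_range_prodStat {Ω : Type*} [MeasurableSpace Ω] {P : Measure Ω} {T : Ω → ℕ → ℝ}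
    (hT : Measurable T) {c : ℝ≥0∞} (hc : ∀ G : (ℕ → ℝ) → ℝ≥0∞, Measurable G →
      ∫⁻ ω, G (T ω) ∂P =
        c * ∫⁻ x in strictCone m, ENNReal.ofReal (svDensity k x) * G (prodStat k x)) :
    ∀ᵐ ω ∂P, T ω ∈ Set.range ((strictCone m).domRestrict (prodStat k)) := by
  have hemb := measurableEmbedding_prodStat (m := m) k
  have hm0 := (measurable_one (α := ℝ≥0∞)).indicator hemb.measurableSet_range.compl
  have h0 := hc _ hm0
  have h1 : ∫⁻ x in strictCone m, ENNReal.ofReal (svDensity k x) *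
      Set.indicator (Set.range ((strictCone m).domRestrict (prodStat k)))ᶜ 1
        (prodStat k x) = 0 := by
    rw [setLIntegral_congr_fun (g := fun _ => 0) isOpen_strictCone.measurableSet,
      lintegral_zero]
    intro x hx
    have : prodStat k x ∉ (Set.range ((strictCone m).domRestrict (prodStat k)))ᶜ :=
      fun h => h ⟨⟨x, hx⟩, rfl⟩
    simp only [Set.indicator_of_notMem this, mul_zero]
  rw [h1, mul_zero] at h0
  replace h0 := (lintegral_eq_zero_iff (hm0.comp hT)).1 h0
  filter_upwards [h0] with ω hω
  by_contra hcon
  have h2 := Set.indicator_of_mem (show T ω ∈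
    (Set.range ((strictCone m).domRestrict (prodStat k)))ᶜ from hcon) (1 : (ℕ → ℝ) → ℝ≥0∞)
  exact one_ne_zero (h2.symm.trans hω)

/-- The law of the ordered squared singular values of a complex Gaussian matrix, up to the
normalizing factor. -/
theorem exists_lintegral_gramDet (m k r : ℕ) (hr : m + k = r) :
    ∃ c : ℝ≥0∞, ∀ G : (ℕ → ℝ) → ℝ≥0∞, Measurable G →
      ∫⁻ H, G (gramDet H) ∂(Measure.pi fun _ : Fin m => Measure.pi fun _ : Fin r => cgauss 1) =
        c * ∫⁻ x in strictCone m, ENNReal.ofReal (svDensity k x) * G (prodStat k x) := by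
  induction m generalizing k with
  | zero =>
    refine ⟨1, fun G hG => ?_⟩
    have h1 : strictCone 0 = Set.univ := by
      ext x
      simp [strictCone, StrictAnti]
    have h2 : ∀ H : Fin 0 → Fin r → ℂ, gramDet H = prodStat k (0 : Fin 0 → ℝ) := by
      intro H
      funext j
      have : gram H = 0 := by ext; simp [gram, Matrix.mul_apply]
      rw [gramDet, this, add_zero, Matrix.det_smul, Matrix.det_one, mul_one, ← Complex.ofReal_pow,
        Complex.ofReal_re]
      simp [prodStat, ← hr]
    rw [h1, Measure.restrict_univ, volume_pi, Measure.pi_of_empty, Measure.pi_of_empty]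
    simp [h2, svDensity, absVand]
    exact congrArg (fun x => G (prodStat k x)) (Subsingleton.elim _ _)
  | succ m ih =>
    -- With one row fewer, the Gram matrix of the same size has one more zero eigenvalue.
    obtain ⟨c, hc⟩ := ih (k + 1) (by omega)
    refine ⟨c * ENNReal.ofReal ((∏ j : Fin m, ((j : ℝ) + 1)⁻¹) / k.factorial), fun G hG => ?_⟩
    have hemb := measurableEmbedding_prodStat (m := m) (k + 1)
    have hins := measurable_insertNth (E := Fin r → ℂ) (0 : Fin (m + 1))
    have hgd : Measurable (gramDet : (Fin (m + 1) → Fin r → ℂ) → ℕ → ℝ) :=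
      continuous_gramDet.measurable
    have hgd' : Measurable (gramDet : (Fin m → Fin r → ℂ) → ℕ → ℝ) :=
      continuous_gramDet.measurable
    have hae : ∀ᵐ H ∂(Measure.pi fun _ : Fin m => Measure.pi fun _ : Fin r => cgauss 1),
        gramDet H ∈ Set.range ((strictCone m).domRestrict (prodStat (k + 1))) :=
      ae_mem_range_prodStat hgd' hc
    -- The conditional expectation given the other `m` rows, as a function of their eigenvalues.
    set Γ : (Fin m → ℝ) → ℝ≥0∞ := fun x =>
      ∫⁻ μ in interlacing ((Fin.last m).insertNth 0 x : Fin (m + 1) → ℝ),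
        ENNReal.ofReal (addRowKernel k x μ) * G (prodStat k μ) with hΓ
    have hΓm : Measurable fun x : strictCone m => Γ x := by
      have hP : MeasurableSet {p : (Fin m → ℝ) × (Fin (m + 1) → ℝ) |
          p.2 ∈ interlacing ((Fin.last m).insertNth 0 p.1 : Fin (m + 1) → ℝ)} := by
        have hν : Measurable fun p : (Fin m → ℝ) × (Fin (m + 1) → ℝ) =>
            ((Fin.last m).insertNth 0 p.1 : Fin (m + 1) → ℝ) :=
          (measurable_insertNth (E := ℝ) (Fin.last m)).comp (by fun_prop :
            Measurable fun p : (Fin m → ℝ) × (Fin (m + 1) → ℝ) => ((0 : ℝ), p.1))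
        have hν' := measurable_pi_iff.1 hν
        have : {p : (Fin m → ℝ) × (Fin (m + 1) → ℝ) |
            p.2 ∈ interlacing ((Fin.last m).insertNth 0 p.1 : Fin (m + 1) → ℝ)} =
            (⋂ i, {p | ((Fin.last m).insertNth 0 p.1 : Fin (m + 1) → ℝ) i < p.2 i}) ∩
            ⋂ i, ⋂ j, ⋂ (_ : i < j),
              {p | p.2 j < ((Fin.last m).insertNth 0 p.1 : Fin (m + 1) → ℝ) i} := by
          ext p
          simp [interlacing]
        rw [this]
        refine (MeasurableSet.iInter fun i => measurableSet_lt (hν' i) (by fun_prop)).inter ?_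
        exact MeasurableSet.iInter fun i => MeasurableSet.iInter fun j =>
          MeasurableSet.iInter fun _ => measurableSet_lt (by fun_prop) (hν' i)
      have hK := measurable_addRowKernel (m := m) (k := k)
      have hGp : Measurable fun p : (Fin m → ℝ) × (Fin (m + 1) → ℝ) => G (prodStat k p.2) :=
        hG.comp ((continuous_prodStat k).measurable.comp measurable_snd)
      have h1 : Measurable Γ := by
        have := Measurable.lintegral_prod_right' (ν := (volume : Measure (Fin (m + 1) → ℝ)))
          (Measurable.indicator (f := fun p : (Fin m → ℝ) × (Fin (m + 1) → ℝ) =>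
            ENNReal.ofReal (addRowKernel k p.1 p.2) * G (prodStat k p.2))
          (hK.ennreal_ofReal.mul hGp) hP)
        convert this using 2 with x
        rw [hΓ]
        dsimp only
        rw [← lintegral_indicator (isOpen_interlacing _).measurableSet]
        rfl
      exact h1.comp measurable_subtype_coe
    -- The induction hypothesis concerns functions of the statistic, so `Γ` is transported along the
    -- measurable embedding.
    obtain ⟨Γ', hΓ'm, hΓ'⟩ := hemb.exists_measurable_extend hΓm fun _ => inferInstance
    have hΓ'x : ∀ x ∈ strictCone m, Γ' (prodStat (k + 1) x) = Γ x := fun x hx =>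
      congrFun hΓ' ⟨x, hx⟩
    rw [lintegral_pi_insertNth _ 0 (f := fun H => G (gramDet H)) (hG.comp hgd),
      lintegral_lintegral_swap
      (f := fun h H => G (gramDet ((0 : Fin (m + 1)).insertNth h H)))
      ((hG.comp hgd).comp hins).aemeasurable]
    have hinner : ∀ᵐ H ∂(Measure.pi fun _ : Fin m => Measure.pi fun _ : Fin r => cgauss 1),
        ∫⁻ h, G (gramDet ((0 : Fin (m + 1)).insertNth h H))
          ∂(Measure.pi fun _ : Fin r => cgauss 1) = Γ' (gramDet H) := by
      filter_upwards [hae] with H hH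
      obtain ⟨⟨x, hx⟩, hxH⟩ := hH
      have hxH' : gramDet H = prodStat (k + 1) x := hxH.symm
      rw [hxH', hΓ'x x hx]
      exact lintegral_gramDet_insertNth hx hxH' hG
    have hfin := lintegral_svDensity_addRowKernel (m := m) (k := k)
      (g := fun μ => G (prodStat k μ)) (hG.comp (continuous_prodStat k).measurable)
    rw [lintegral_congr_ae hinner, hc Γ' hΓ'm, setLIntegral_congr_fun
      (g := fun x => ENNReal.ofReal (svDensity (k + 1) x) * Γ x) isOpen_strictCone.measurableSet
      fun x hx => by rw [hΓ'x x hx], mul_assoc, ← hfin]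

end Wishart

end SLMIMO
namespace SLMIMO

/-! ### The law of the ordered squared singular values -/

section SingularValueLaw

/-- Both laws are images of a product law over index pairs, and such a law is invariant under
exchanging the two indices. -/
lemma pi_pi_map_swap {E : Type*} [MeasurableSpace E] (μ : Measure E) [IsProbabilityMeasure μ]
    (a b : ℕ) :
    (Measure.pi fun _ : Fin a => Measure.pi fun _ : Fin b => μ).map (fun H j i => H i j) =
      Measure.pi fun _ : Fin b => Measure.pi fun _ : Fin a => μ := by
  have h (a b : ℕ) : (Measure.pi fun _ : Fin a => Measure.pi fun _ : Fin b => μ) =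
      (Measure.infinitePi fun _ : Fin a × Fin b => μ).map
        (MeasurableEquiv.curry (Fin a) (Fin b) E) := by
    rw [Measure.infinitePi_map_curry fun (_ : Fin a) (_ : Fin b) => μ, Measure.infinitePi_eq_pi]
    simp_rw [Measure.infinitePi_eq_pi]
  rw [h a b, h b a, Measure.map_map (by fun_prop) (by fun_prop),
    ← Measure.infinitePi_map_piCongrLeft (fun _ : Fin b × Fin a => μ)
      (Equiv.prodComm (Fin a) (Fin b)), Measure.map_map (by fun_prop) (by fun_prop)]
  congr 1

lemma measurable_swap {E : Type*} [MeasurableSpace E] (a b : ℕ) :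
    Measurable fun (H : Fin a → Fin b → E) (j : Fin b) (i : Fin a) => H i j := by
  fun_prop

lemma prod_add_extend {n r : ℕ} (h : n ≤ r) (x : Fin n → ℝ) (z : ℝ) :
    ∏ i : Fin r, (z + if hi : (i : ℕ) < n then x ⟨i, hi⟩ else 0) =
      z ^ (r - n) * ∏ i, (z + x i) := by
  obtain ⟨k, rfl⟩ := Nat.exists_eq_add_of_le h
  simp [Fin.prod_univ_add, mul_comm]

variable {Nt Nr : ℕ}

/-- The squared singular values padded with zeros. -/
noncomputable def padded (r : ℕ) {n : ℕ} (x : Fin n → ℝ) : Fin r → ℝ := fun i =>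
  if hi : (i : ℕ) < n then x ⟨i, hi⟩ else 0

lemma conjTranspose_sigmaMat_mul_sigmaMat {lam : Fin (min Nt Nr) → ℝ} (h : ∀ m, 0 ≤ lam m) :
    (sigmaMat lam : Matrix (Fin Nr) (Fin Nt) ℂ)ᴴ * sigmaMat lam =
      Matrix.diagonal fun i => (padded Nt lam i : ℂ) := by
  ext a b
  rw [Matrix.mul_apply]
  simp only [sigmaMat, Matrix.conjTranspose_apply, Matrix.of_apply, Matrix.diagonal_apply, padded]
  by_cases ha : (a : ℕ) < Nr
  · rw [Finset.sum_eq_single ⟨a, ha⟩]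
    · by_cases hab : a = b
      · subst hab
        have h2 : (a : ℕ) < min Nt Nr := lt_min a.2 ha
        simp [h2, ← Complex.ofReal_mul, Real.mul_self_sqrt (h _)]
      · have : (a : ℕ) ≠ b := fun h => hab (Fin.ext h)
        simp [hab, this]
    · intro c _ hc
      have : (c : ℕ) ≠ a := fun h => hc (Fin.ext h)
      simp [this]
    · simp
  · rw [Finset.sum_eq_zero]
    · have h2 : ¬ (a : ℕ) < min Nt Nr := fun h => ha (h.trans_le (min_le_right _ _))
      simp [h2]
    · intro c _
      have : (c : ℕ) ≠ a := fun h => ha (h ▸ c.2)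
      simp [this]

lemma sigmaMat_mul_conjTranspose_sigmaMat {lam : Fin (min Nt Nr) → ℝ} (h : ∀ m, 0 ≤ lam m) :
    (sigmaMat lam : Matrix (Fin Nr) (Fin Nt) ℂ) * (sigmaMat lam)ᴴ =
      Matrix.diagonal fun i => (padded Nr lam i : ℂ) := by
  ext a b
  rw [Matrix.mul_apply]
  simp only [sigmaMat, Matrix.conjTranspose_apply, Matrix.of_apply, Matrix.diagonal_apply, padded]
  by_cases ha : (a : ℕ) < Nt
  · rw [Finset.sum_eq_single ⟨a, ha⟩]
    · by_cases hab : a = b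
      · subst hab
        have h2 : (a : ℕ) < min Nt Nr := lt_min ha a.2
        simp [h2, ← Complex.ofReal_mul, Real.mul_self_sqrt (h _)]
      · have : (b : ℕ) ≠ a := fun h => hab (Fin.ext h.symm)
        simp [hab, this]
    · intro c _ hc
      have : (a : ℕ) ≠ c := fun h => hc (Fin.ext h.symm)
      simp [this]
    · simp
  · rw [Finset.sum_eq_zero]
    · have h2 : ¬ (a : ℕ) < min Nt Nr := fun h => ha (h.trans_le (min_le_left _ _))
      simp [h2]
    · intro c _
      have : (a : ℕ) ≠ c := fun h => ha (h ▸ c.2)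
      simp [this]

lemma gramDet_of_svd {H : Fin Nr → Fin Nt → ℂ} (D : SVD (Matrix.of H)) :
    gramDet H = prodStat (Nt - min Nt Nr) D.lam := by
  funext j
  have h1 : gram H = D.V * Matrix.diagonal (fun i => (padded Nt D.lam i : ℂ)) * D.Vᴴ := by
    refine (congrArg (fun A => Aᴴ * A) D.eq).trans ?_
    simp only [Matrix.conjTranspose_mul, Matrix.conjTranspose_conjTranspose,
      ← conjTranspose_sigmaMat_mul_sigmaMat D.nonneg]
    have hU : D.Uᴴ * D.U = 1 := Matrix.mem_unitaryGroup_iff'.1 D.U_mem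
    calc _ = D.V * (sigmaMat D.lam)ᴴ * (D.Uᴴ * D.U) * sigmaMat D.lam * D.Vᴴ := by
            simp only [Matrix.mul_assoc]
      _ = _ := by rw [hU, Matrix.mul_one]; simp only [Matrix.mul_assoc]
  rw [gramDet_eq D.V_mem h1]
  exact prod_add_extend (min_le_left _ _) D.lam _

lemma gramDet_swap_of_svd {H : Fin Nr → Fin Nt → ℂ} (D : SVD (Matrix.of H)) :
    gramDet (fun j i => H i j) = prodStat (Nr - min Nt Nr) D.lam := by
  funext j
  have hU' : (D.U.map star) ∈ Matrix.unitaryGroup (Fin Nr) ℂ := by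
    rw [Matrix.mem_unitaryGroup_iff, Matrix.star_eq_conjTranspose]
    have := congrArg (fun A => A.map (starRingEnd ℂ)) (Matrix.mem_unitaryGroup_iff.1 D.U_mem)
    simp only [Matrix.map_mul, Matrix.map_one _ (map_zero _) (map_one _)] at this
    exact this
  have h0 : Matrix.of H * (Matrix.of H)ᴴ =
      D.U * Matrix.diagonal (fun i => (padded Nr D.lam i : ℂ)) * D.Uᴴ := by
    refine (congrArg (fun A => A * Aᴴ) D.eq).trans ?_
    simp only [Matrix.conjTranspose_mul, Matrix.conjTranspose_conjTranspose,
      ← sigmaMat_mul_conjTranspose_sigmaMat D.nonneg]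
    have hV : D.Vᴴ * D.V = 1 := Matrix.mem_unitaryGroup_iff'.1 D.V_mem
    calc _ = D.U * sigmaMat D.lam * (D.Vᴴ * D.V) * (sigmaMat D.lam)ᴴ * D.Uᴴ := by
            simp only [Matrix.mul_assoc]
      _ = _ := by rw [hV, Matrix.mul_one]; simp only [Matrix.mul_assoc]
  have h1 : gram (fun j i => H i j) =
      D.U.map star * Matrix.diagonal (fun i => (padded Nr D.lam i : ℂ)) * (D.U.map star)ᴴ := by
    have h2 := congrArg (fun A => A.map (starRingEnd ℂ)) h0
    simp only [Matrix.map_mul] at h2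
    have h3 : (Matrix.diagonal (fun i => (padded Nr D.lam i : ℂ))).map (starRingEnd ℂ) =
        Matrix.diagonal (fun i => (padded Nr D.lam i : ℂ)) := by
      rw [Matrix.diagonal_map (map_zero _)]
      simp
    rw [h3] at h2
    refine Eq.trans ?_ h2
    ext a b
    simp [gram, Matrix.mul_apply]
  rw [gramDet_eq hU' h1]
  exact prod_add_extend (min_le_right _ _) D.lam _

/-- The function `lam` need not be measurable. Almost surely `T` lies in the image of the cone,
where it determines `lam`, so the integrand agrees almost everywhere with a measurable function of
`T`. -/
lemma lintegral_of_prodStat {m k : ℕ} {Ω : Type*} [MeasurableSpace Ω] {P : Measure Ω}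
    {T : Ω → ℕ → ℝ} (hT : Measurable T) {c : ℝ≥0∞}
    (hc : ∀ G : (ℕ → ℝ) → ℝ≥0∞, Measurable G → ∫⁻ ω, G (T ω) ∂P =
      c * ∫⁻ x in strictCone m, ENNReal.ofReal (svDensity k x) * G (prodStat k x))
    {lam : Ω → Fin m → ℝ} (hlam : ∀ ω, Antitone (lam ω)) (hTl : ∀ ω, T ω = prodStat k (lam ω))
    {g : (Fin m → ℝ) → ℝ≥0∞} (hg : Measurable g) :
    ∫⁻ ω, g (lam ω) ∂P =
      c * ∫⁻ x in strictCone m, ENNReal.ofReal (svDensity k x) * g x := by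
  obtain ⟨G, hG, hGg⟩ := (measurableEmbedding_prodStat (m := m) k).exists_measurable_extend
    (hg.comp measurable_subtype_coe) fun _ => inferInstance
  have hGx : ∀ x ∈ strictCone m, G (prodStat k x) = g x := fun x hx => congrFun hGg ⟨x, hx⟩
  have h1 : ∀ᵐ ω ∂P, g (lam ω) = G (T ω) := by
    filter_upwards [ae_mem_range_prodStat hT hc] with ω hω
    obtain ⟨⟨x, hx⟩, hxω⟩ := hω
    have h2 : prodStat k x = T ω := hxω
    rw [← h2, hGx x hx, eq_of_prodStat_eq hx.1 (hlam ω) (h2.trans (hTl ω))]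
  rw [lintegral_congr_ae h1, hc G hG, setLIntegral_congr_fun isOpen_strictCone.measurableSet]
  intro x hx
  simp only [hGx x hx]

lemma gap_eq (Nt Nr : ℕ) : gap Nt Nr = max Nt Nr - min Nt Nr := by
  unfold gap
  omega

/-- The row-by-row construction needs at most as many rows as columns; for `Nt ≤ Nr` it is applied
to the transposed matrix. -/
lemma exists_lintegral_lam (svd : ∀ H : Matrix (Fin Nr) (Fin Nt) ℂ, SVD H) :
    ∃ c : ℝ≥0∞, ∀ g : (Fin (min Nt Nr) → ℝ) → ℝ≥0∞, Measurable g →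
      ∫⁻ H, g (svd (Matrix.of H)).lam ∂channelLaw Nt Nr =
        c * ∫⁻ x in strictCone (min Nt Nr), ENNReal.ofReal (svDensity (gap Nt Nr) x) * g x := by
  have key (m r : ℕ) (hmr : m ≤ r) : ∀ n, n = m → ∀ k, k = r - m →
      ∃ c : ℝ≥0∞, ∀ G : (ℕ → ℝ) → ℝ≥0∞, Measurable G →
      ∫⁻ H, G (gramDet H) ∂(Measure.pi fun _ : Fin m => Measure.pi fun _ : Fin r => cgauss 1) =
        c * ∫⁻ x in strictCone n, ENNReal.ofReal (svDensity k x) * G (prodStat k x) := by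
    rintro n rfl k rfl
    exact exists_lintegral_gramDet n (r - n) r (by omega)
  rcases le_total Nr Nt with h | h
  · obtain ⟨c, hc⟩ := key Nr Nt h (min Nt Nr) (min_eq_right h) (gap Nt Nr) (by rw [gap_eq]; omega)
    refine ⟨c, fun g hg => lintegral_of_prodStat (T := gramDet) continuous_gramDet.measurable hc
      (fun H => (svd (Matrix.of H)).antitone) (fun H => ?_) hg⟩
    rw [gramDet_of_svd (svd (Matrix.of H)), gap_eq, max_eq_left h]
  · obtain ⟨c, hc⟩ := key Nt Nr h (min Nt Nr) (min_eq_left h) (gap Nt Nr) (by rw [gap_eq]; omega)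
    refine ⟨c, fun g hg => lintegral_of_prodStat (T := fun H => gramDet fun j i => H i j)
      (continuous_gramDet.measurable.comp (measurable_swap _ _)) (fun G hG => ?_)
      (fun H => (svd (Matrix.of H)).antitone) (fun H => ?_) hg⟩
    · rw [← hc G hG, ← pi_pi_map_swap (cgauss 1) Nr Nt,
        lintegral_map (f := fun H => G (gramDet H)) (hG.comp continuous_gramDet.measurable)
          (measurable_swap _ _)]
      rfl
    · rw [gramDet_swap_of_svd (svd (Matrix.of H)), gap_eq, max_eq_right h]

end SingularValueLaw

end SLMIMO
namespace SLMIMO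

/-! ### Normalization of the eigenvalue law and its Laplace transform. -/

section LamLaw

variable {n : ℕ} {Nt Nr : ℕ}

lemma eval_eigPoly (x : Fin (min Nt Nr) → ℝ) :
    MvPolynomial.eval x (eigPoly Nt Nr) = (∏ i, x i) ^ gap Nt Nr * absVand x ^ 2 := by
  rw [eigPoly, map_mul, absVand_eq]
  simp only [map_prod, map_pow, map_sub, MvPolynomial.eval_X, Finset.prod_pow]
  congr 1
  rw [← Finset.prod_pow]
  simp only [← Finset.prod_pow, sq_abs]
  exact Finset.prod_comm' (by simp)

lemma unnormDensity_eq (x : Fin (min Nt Nr) → ℝ) :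
    unnormDensity Nt Nr x = svDensity (gap Nt Nr) x := by
  rw [unnormDensity, eval_eigPoly, svDensity, ← Real.exp_sum, Finset.sum_neg_distrib]
  ring

lemma unnormDensity_nonneg {x : Fin (min Nt Nr) → ℝ} (hx : ∀ i, 0 ≤ x i) :
    0 ≤ unnormDensity Nt Nr x := by
  rw [unnormDensity_eq]
  exact svDensity_nonneg hx

lemma continuous_unnormDensity : Continuous (unnormDensity Nt Nr) := by
  rw [show unnormDensity Nt Nr = svDensity (gap Nt Nr) from funext unnormDensity_eq]
  exact continuous_svDensity _

lemma isClosed_ordDomain : IsClosed (ordDomain n) := by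
  have : ordDomain n = (⋂ i, ⋂ j, ⋂ (_ : i ≤ j), {x : Fin n → ℝ | x j ≤ x i}) ∩
      ⋂ i, {x | 0 ≤ x i} := by
    ext x
    simp [ordDomain, Antitone]
  rw [this]
  refine IsClosed.inter ?_ (isClosed_iInter fun i => isClosed_le (by fun_prop) (by fun_prop))
  exact isClosed_iInter fun i => isClosed_iInter fun j =>
    isClosed_iInter fun _ => isClosed_le (by fun_prop) (by fun_prop)

lemma strictCone_subset_ordDomain : strictCone n ⊆ ordDomain n :=
  fun _ hx => ⟨hx.1.antitone, fun i => (hx.2 i).le⟩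

lemma volume_eq_of_ne {n : ℕ} {L : (Fin n → ℝ) →ₗ[ℝ] ℝ} (hL : L ≠ 0) :
    volume {x : Fin n → ℝ | L x = 0} = 0 := by
  have h := Measure.addHaar_submodule (volume : Measure (Fin n → ℝ)) (LinearMap.ker L)
    (fun h => hL (LinearMap.ker_eq_top.1 h))
  exact h

/-- The difference lies in the finitely many hyperplanes `x i = 0` and `x i = x j`, which are null
sets. -/
lemma strictCone_ae_eq_ordDomain : strictCone n =ᵐ[volume] ordDomain n := by
  refine Filter.EventuallyLE.antisymm
    (Filter.Eventually.of_forall fun x hx => strictCone_subset_ordDomain hx) ?_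
  have h1 : ∀ᵐ x : Fin n → ℝ, ∀ i, x i ≠ 0 := by
    refine ae_all_iff.2 fun i => ?_
    refine volume_eq_of_ne (L := LinearMap.proj (R := ℝ) (φ := fun _ : Fin n => ℝ) i)
      (fun h => ?_) |>.le.trans' ?_ |>.antisymm bot_le
    · simpa using LinearMap.congr_fun h (Pi.single i 1)
    · exact measure_mono fun x hx => by simpa using hx
  have h2 : ∀ᵐ x : Fin n → ℝ, ∀ i j, i ≠ j → x i ≠ x j := by
    refine ae_all_iff.2 fun i => ae_all_iff.2 fun j => ?_
    by_cases hij : i = j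
    · simp [hij]
    refine volume_eq_of_ne
      (L := LinearMap.proj (R := ℝ) (φ := fun _ : Fin n => ℝ) i - LinearMap.proj j) (fun h => ?_)
      |>.le.trans' ?_ |>.antisymm bot_le
    · simpa [Pi.single_apply, Ne.symm hij] using LinearMap.congr_fun h (Pi.single i 1)
    · exact measure_mono fun x hx => by simpa [sub_eq_zero, hij] using hx
  filter_upwards [h1, h2] with x hx1 hx2 hx
  exact ⟨hx.1.strictAnti_of_injective fun a b hab => by
    by_contra hne
    exact hx2 a b hne hab, fun i => (hx.2 i).lt_of_ne (hx1 i).symm⟩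

/-- The total mass of the unnormalized density is positive and finite. -/
lemma lintegral_svDensity (m k : ℕ) :
    ∫⁻ x in strictCone m, ENNReal.ofReal (svDensity k x) ≠ 0 ∧
      ∫⁻ x in strictCone m, ENNReal.ofReal (svDensity k x) ≠ ∞ := by
  -- The Gaussian law has mass one, so `c` times the mass in question equals one, which excludes
  -- zero and infinity.
  obtain ⟨c, hc⟩ := exists_lintegral_gramDet m k (m + k) rfl
  have h := hc (fun _ => 1) measurable_const
  simp only [mul_one, lintegral_const, measure_univ] at h
  constructor <;> intro h0 <;> rw [h0] at h
  · simp at h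
  · by_cases hc0 : c = 0
    · simp [hc0] at h
    · rw [ENNReal.mul_top hc0] at h
      exact absurd h (by simp)

lemma ofReal_normC : ENNReal.ofReal (normC Nt Nr) =
    ∫⁻ x in strictCone (min Nt Nr), ENNReal.ofReal (svDensity (gap Nt Nr) x) := by
  have h1 : normC Nt Nr = ∫ x in strictCone (min Nt Nr), svDensity (gap Nt Nr) x := by
    rw [normC, setIntegral_congr_set strictCone_ae_eq_ordDomain]
    simp only [unnormDensity_eq]
  have h2 : 0 ≤ᵐ[volume.restrict (strictCone (min Nt Nr))] svDensity (gap Nt Nr) :=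
    (ae_restrict_iff' isOpen_strictCone.measurableSet).2
      (Filter.Eventually.of_forall fun x hx => svDensity_nonneg fun i => (hx.2 i).le)
  rw [h1, integral_eq_lintegral_of_nonneg_ae h2 (continuous_svDensity _).aestronglyMeasurable,
    ENNReal.ofReal_toReal (lintegral_svDensity _ _).2]

lemma normC_pos : 0 < normC Nt Nr := by
  rw [← ENNReal.ofReal_pos, ofReal_normC]
  exact pos_iff_ne_zero.2 (lintegral_svDensity _ _).1

/-- The law of the ordered squared singular values. -/
noncomputable def lamLaw (Nt Nr : ℕ) : Measure (Fin (min Nt Nr) → ℝ) :=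
  (volume.restrict (ordDomain (min Nt Nr))).withDensity
    fun x => ENNReal.ofReal (unnormDensity Nt Nr x / normC Nt Nr)

lemma lintegral_lamLaw {g : (Fin (min Nt Nr) → ℝ) → ℝ≥0∞} (hg : Measurable g) :
    ∫⁻ x, g x ∂lamLaw Nt Nr = ENNReal.ofReal (normC Nt Nr)⁻¹ *
      ∫⁻ x in strictCone (min Nt Nr), ENNReal.ofReal (svDensity (gap Nt Nr) x) * g x := by
  have hm : Measurable fun x => ENNReal.ofReal (svDensity (m := min Nt Nr) (gap Nt Nr) x) :=
    (continuous_svDensity _).measurable.ennreal_ofReal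
  rw [lamLaw, lintegral_withDensity_eq_lintegral_mul _
    (continuous_unnormDensity.measurable.div_const _).ennreal_ofReal hg,
    ← lintegral_const_mul (f := fun x => ENNReal.ofReal (svDensity (gap Nt Nr) x) * g x) _
      (hm.mul hg), setLIntegral_congr strictCone_ae_eq_ordDomain]
  refine lintegral_congr fun x => ?_
  rw [Pi.mul_apply, unnormDensity_eq, div_eq_inv_mul,
    ENNReal.ofReal_mul (inv_nonneg.2 normC_pos.le), mul_assoc]

/-- The law of the squared singular values in any singular value decomposition. -/
theorem lintegral_svd_lam (svd : ∀ H : Matrix (Fin Nr) (Fin Nt) ℂ, SVD H)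
    {g : (Fin (min Nt Nr) → ℝ) → ℝ≥0∞} (hg : Measurable g) :
    ∫⁻ H, g (svd (Matrix.of H)).lam ∂channelLaw Nt Nr = ∫⁻ x, g x ∂lamLaw Nt Nr := by
  obtain ⟨c, hc⟩ := exists_lintegral_lam svd
  -- The unspecified constant `c` is identified by the total mass.
  have h1 := hc (fun _ => 1) measurable_const
  have hP : channelLaw Nt Nr Set.univ = 1 := by
    rw [channelLaw]
    exact measure_univ
  simp only [mul_one, lintegral_const, hP, ← ofReal_normC] at h1
  have h2 : c = ENNReal.ofReal (normC Nt Nr)⁻¹ := by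
    rw [ENNReal.ofReal_inv_of_pos normC_pos]
    exact ENNReal.eq_inv_of_mul_eq_one_left h1.symm
  rw [hc g hg, lintegral_lamLaw hg, h2]

instance isProbabilityMeasure_lamLaw : IsProbabilityMeasure (lamLaw Nt Nr) := by
  refine ⟨?_⟩
  have h := lintegral_lamLaw (Nt := Nt) (Nr := Nr) (g := fun _ => 1) measurable_const
  simp only [mul_one, lintegral_const, ← ofReal_normC, one_mul] at h
  rw [h, ← ENNReal.ofReal_mul (inv_nonneg.2 normC_pos.le), inv_mul_cancel₀ normC_pos.ne',
    ENNReal.ofReal_one]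

lemma ae_lamLaw_mem : ∀ᵐ x ∂lamLaw Nt Nr, x ∈ ordDomain (min Nt Nr) :=
  (withDensity_absolutelyContinuous _ _).ae_le (ae_restrict_mem isClosed_ordDomain.measurableSet)

lemma ofReal_mgfNeg (a : Fin (min Nt Nr) → ℝ) (ha : ∀ i, 0 ≤ a i) :
    ENNReal.ofReal (mgfNeg Nt Nr a) =
      ∫⁻ x, ENNReal.ofReal (Real.exp (-∑ m, a m * x m)) ∂lamLaw Nt Nr := by
  have hcont : Continuous fun x : Fin (min Nt Nr) → ℝ => Real.exp (-∑ m, a m * x m) := by fun_prop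
  have hle : ∫⁻ x, ENNReal.ofReal (Real.exp (-∑ m, a m * x m)) ∂lamLaw Nt Nr ≤ 1 := by
    refine (lintegral_mono_ae (g := fun _ => 1) ?_).trans (by simp)
    filter_upwards [ae_lamLaw_mem] with x hx
    rw [ENNReal.ofReal_le_one, Real.exp_le_one_iff, neg_nonpos]
    exact Finset.sum_nonneg fun i _ => mul_nonneg (ha i) (hx.2 i)
  have h1 : ∫⁻ x, ENNReal.ofReal (Real.exp (-∑ m, a m * x m)) ∂lamLaw Nt Nr =
      ∫⁻ x in ordDomain (min Nt Nr), ENNReal.ofReal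
        ((∏ m, Real.exp (-(a m * x m))) * (1 / normC Nt Nr * unnormDensity Nt Nr x)) := by
    rw [lamLaw, lintegral_withDensity_eq_lintegral_mul _
      (continuous_unnormDensity.measurable.div_const _).ennreal_ofReal
      hcont.measurable.ennreal_ofReal]
    refine setLIntegral_congr_fun isClosed_ordDomain.measurableSet fun x hx => ?_
    rw [Pi.mul_apply, ← ENNReal.ofReal_mul (div_nonneg (unnormDensity_nonneg hx.2) normC_pos.le),
      ← Real.exp_sum, Finset.sum_neg_distrib]
    congr 1
    ring
  have hcont' : Continuous fun x => (∏ m, Real.exp (-(a m * x m))) *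
      (1 / normC Nt Nr * unnormDensity Nt Nr x) := by
    have := continuous_unnormDensity (Nt := Nt) (Nr := Nr)
    fun_prop
  rw [mgfNeg, integral_eq_lintegral_of_nonneg_ae _ hcont'.aestronglyMeasurable, ← h1,
    ENNReal.ofReal_toReal (hle.trans_lt ENNReal.one_lt_top).ne]
  refine (ae_restrict_iff' isClosed_ordDomain.measurableSet).2
    (Filter.Eventually.of_forall fun x hx => ?_)
  exact mul_nonneg (Finset.prod_nonneg fun i _ => (Real.exp_pos _).le)
    (mul_nonneg (one_div_nonneg.2 normC_pos.le) (unnormDensity_nonneg hx.2))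

end LamLaw

end SLMIMO
namespace SLMIMO

/-! ### Exponential integrals over the ordered cone -/

section ConeIntegral

/-- `∫_y^∞ x ^ u e^{- s x} dx = e^{- s y} * incGamma s u y`. -/
noncomputable def incGamma (s : ℝ) (u : ℕ) (y : ℝ) : ℝ :=
  ∑ i ∈ Finset.range (u + 1), (u.factorial : ℝ) / i.factorial / s ^ (u - i + 1) * y ^ i

lemma incGamma_succ (s : ℝ) (u : ℕ) (y : ℝ) :
    incGamma s (u + 1) y = ((u : ℝ) + 1) / s * incGamma s u y + y ^ (u + 1) / s := by
  rw [incGamma, Finset.sum_range_succ, incGamma, Finset.mul_sum]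
  congr 1
  · refine Finset.sum_congr rfl fun i hi => ?_
    have : u + 1 - i + 1 = (u - i + 1) + 1 := by
      have := Finset.mem_range.1 hi
      omega
    rw [this, pow_succ, Nat.factorial_succ]
    push_cast
    ring
  · have : ((u + 1).factorial : ℝ) ≠ 0 := by positivity
    rw [div_self this, Nat.sub_self, zero_add, pow_one]
    ring

lemma incGamma_nonneg {s y : ℝ} (hs : 0 < s) (hy : 0 ≤ y) (u : ℕ) : 0 ≤ incGamma s u y :=
  Finset.sum_nonneg fun i _ => by positivity

lemma hasDerivAt_incGamma {s : ℝ} (hs : 0 < s) (u : ℕ) (x : ℝ) :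
    HasDerivAt (fun x => -(Real.exp (-(s * x)) * incGamma s u x))
      (Real.exp (-(s * x)) * x ^ u) x := by
  have hexp : HasDerivAt (fun x => Real.exp (-(s * x))) (-s * Real.exp (-(s * x))) x := by
    have := (((hasDerivAt_id x).const_mul s).neg).exp
    simpa [mul_comm] using this
  induction u with
  | zero =>
    simp only [incGamma, zero_add, Finset.range_one, Finset.sum_singleton, Nat.factorial_zero,
      Nat.cast_one, div_one, Nat.sub_self, pow_one, pow_zero, mul_one]
    refine ((hexp.mul_const (1 / s)).neg).congr_deriv ?_
    field_simp
  | succ u ih =>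
    have h1 : (fun x => -(Real.exp (-(s * x)) * incGamma s (u + 1) x)) = fun x =>
        ((u : ℝ) + 1) / s * (-(Real.exp (-(s * x)) * incGamma s u x)) -
          Real.exp (-(s * x)) * (x ^ (u + 1) / s) := by
      funext x
      rw [incGamma_succ]
      ring
    rw [h1]
    refine ((ih.const_mul _).sub (hexp.mul ((hasDerivAt_pow (u + 1) x).div_const s))).congr_deriv ?_
    push_cast
    field_simp
    simp

lemma tendsto_incGamma {s : ℝ} (hs : 0 < s) (u : ℕ) :
    Tendsto (fun x => -(Real.exp (-(s * x)) * incGamma s u x)) atTop (nhds 0) := by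
  have h : ∀ i : ℕ, Tendsto (fun x : ℝ => Real.exp (-(s * x)) * x ^ i) atTop (nhds 0) := by
    intro i
    have := tendsto_rpow_mul_exp_neg_mul_atTop_nhds_zero i s hs
    refine this.congr fun x => ?_
    rw [Real.rpow_natCast, neg_mul, mul_comm]
  have h2 : (fun x => -(Real.exp (-(s * x)) * incGamma s u x)) = fun x =>
      ∑ i ∈ Finset.range (u + 1), -((u.factorial : ℝ) / i.factorial / s ^ (u - i + 1)) *
        (Real.exp (-(s * x)) * x ^ i) := by
    funext x
    rw [incGamma, Finset.mul_sum, ← Finset.sum_neg_distrib]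
    refine Finset.sum_congr rfl fun i _ => by ring
  rw [h2, ← Finset.sum_const_zero (s := Finset.range (u + 1))]
  refine tendsto_finsetSum _ fun i _ => ?_
  simpa using (h i).const_mul (-((u.factorial : ℝ) / i.factorial / s ^ (u - i + 1)))

lemma lintegral_Ioi_exp_mul_pow {s y : ℝ} (hs : 0 < s) (hy : 0 ≤ y) (u : ℕ) :
    ∫⁻ x in Set.Ioi y, ENNReal.ofReal (Real.exp (-(s * x)) * x ^ u) =
      ENNReal.ofReal (Real.exp (-(s * y)) * incGamma s u y) := by
  have hd : ∀ x ∈ Set.Ici y, HasDerivAt (fun x => -(Real.exp (-(s * x)) * incGamma s u x))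
      (Real.exp (-(s * x)) * x ^ u) x := fun x _ => hasDerivAt_incGamma hs u x
  have hnn : ∀ x ∈ Set.Ioi y, 0 ≤ Real.exp (-(s * x)) * x ^ u := fun x hx =>
    mul_nonneg (Real.exp_pos _).le (pow_nonneg (hy.trans (le_of_lt hx)) _)
  have hint := integrableOn_Ioi_deriv_of_nonneg' hd hnn (tendsto_incGamma hs u)
  rw [← ofReal_integral_eq_lintegral_ofReal hint
    ((ae_restrict_iff' measurableSet_Ioi).2 (Filter.Eventually.of_forall hnn)),
    integral_Ioi_of_hasDerivAt_of_nonneg' hd hnn (tendsto_incGamma hs u), zero_sub, neg_neg]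

/-- The value of `∫ x₀ ^ u e^{- s x₀} ∏ x_j ^ β_{k+j} e^{-A_{k+j} x_j}` over
`x₀ ≥ x₁ ≥ ⋯ ≥ x_d ≥ 0`, integrating over `x₀`, `x₁`, … in turn. -/
noncomputable def coneVal (A : ℕ → ℝ) (β : ℕ → ℕ) : (d k : ℕ) → (s : ℝ) → (u : ℕ) → ℝ
  | 0, _, s, u => u.factorial / s ^ (u + 1)
  | d + 1, k, s, u => ∑ i ∈ Finset.range (u + 1), (u.factorial : ℝ) / i.factorial / s ^ (u - i + 1) *
      coneVal A β d (k + 1) (s + A (k + 1)) (β (k + 1) + i)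

lemma coneVal_nonneg {A : ℕ → ℝ} (hA : ∀ j, 0 ≤ A j) (β : ℕ → ℕ) (d k : ℕ) {s : ℝ} (hs : 0 < s)
    (u : ℕ) : 0 ≤ coneVal A β d k s u := by
  induction d generalizing k s u with
  | zero => rw [coneVal]; positivity
  | succ d ih =>
    rw [coneVal]
    exact Finset.sum_nonneg fun i _ => mul_nonneg (by positivity)
      (ih _ (add_pos_of_pos_of_nonneg hs (hA _)) _)

lemma cons_mem_ordDomain {d : ℕ} {x : ℝ} {y : Fin (d + 1) → ℝ} :
    (Fin.cons x y : Fin (d + 2) → ℝ) ∈ ordDomain (d + 2) ↔ y 0 ≤ x ∧ y ∈ ordDomain (d + 1) := by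
  constructor
  · rintro ⟨h1, h2⟩
    exact ⟨h1 (Fin.zero_le 1), fun i j hij => h1 (Fin.succ_le_succ_iff.2 hij), fun i => h2 i.succ⟩
  · rintro ⟨h0, h1, h2⟩
    refine ⟨fun i j hij => ?_, fun i => ?_⟩
    · induction i using Fin.cases with
      | zero =>
        induction j using Fin.cases with
        | zero => exact le_rfl
        | succ j => exact (h1 (Fin.zero_le j)).trans h0
      | succ i =>
        induction j using Fin.cases with
        | zero => exact absurd hij (by simp)
        | succ j => exact h1 (Fin.succ_le_succ_iff.1 hij)
    · induction i using Fin.cases with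
      | zero => exact (h2 0).trans h0
      | succ i => exact h2 i

/-- The largest variable is integrated first. Its incomplete gamma integral leaves an exponential
and powers `i` of the next variable, whose rate becomes `s + A (k + 1)` and whose exponent becomes
`β (k + 1) + i`. -/
lemma lintegral_ordDomain {A : ℕ → ℝ} (hA : ∀ j, 0 ≤ A j) (β : ℕ → ℕ) (d k : ℕ) {s : ℝ}
    (hs : 0 < s) (u : ℕ) :
    ∫⁻ x in ordDomain (d + 1), ENNReal.ofReal (Real.exp (-(s * x 0)) * x 0 ^ u *
        ∏ j : Fin d, (Real.exp (-(A (k + 1 + j) * x j.succ)) * x j.succ ^ β (k + 1 + j))) =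
      ENNReal.ofReal (coneVal A β d k s u) := by
  induction d generalizing k s u with
  | zero =>
    have h := lintegral_Ioi_exp_mul_pow hs le_rfl u
    have h0 : Real.exp (-(s * 0)) * incGamma s u 0 = u.factorial / s ^ (u + 1) := by
      rw [incGamma, Finset.sum_eq_single 0]
      · simp
      · intro i _ hi
        simp [hi]
      · simp
    rw [h0, setLIntegral_congr Ioi_ae_eq_Ici] at h
    rw [coneVal, ← h, ← lintegral_indicator isClosed_ordDomain.measurableSet,
      ← lintegral_indicator measurableSet_Ici,
      ← (volume_preserving_funUnique (Fin 1) ℝ).lintegral_comp_emb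
        (MeasurableEquiv.measurableEmbedding _)]
    refine lintegral_congr fun x => ?_
    have hx : x ∈ ordDomain (0 + 1) ↔ x 0 ∈ Set.Ici (0 : ℝ) := by
      refine ⟨fun h => h.2 0, fun h => ⟨?_, fun i => ?_⟩⟩
      · intro i j _
        rw [Subsingleton.elim (α := Fin 1) i j]
      · rw [Subsingleton.elim (α := Fin 1) i 0]
        exact h
    change (ordDomain (0 + 1)).indicator _ x = (Set.Ici (0 : ℝ)).indicator _ (x 0)
    by_cases h : x 0 ∈ Set.Ici (0 : ℝ)
    · rw [Set.indicator_of_mem h, Set.indicator_of_mem (hx.2 h)]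
      simp
    · rw [Set.indicator_of_notMem h, Set.indicator_of_notMem (fun h' => h (hx.1 h'))]
  | succ d ih =>
    set W : (Fin (d + 1) → ℝ) → ℝ := fun y =>
      ∏ j : Fin (d + 1), (Real.exp (-(A (k + 1 + j) * y j)) * y j ^ β (k + 1 + j)) with hW
    have hWm : Continuous W := by
      rw [hW]
      fun_prop
    have hF : Measurable fun x : Fin (d + 2) → ℝ =>
        ENNReal.ofReal (Real.exp (-(s * x 0)) * x 0 ^ u * W (fun j => x j.succ)) := by
      have : Continuous fun x : Fin (d + 2) → ℝ =>
          Real.exp (-(s * x 0)) * x 0 ^ u * W (fun j => x j.succ) := by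
        fun_prop
      exact this.measurable.ennreal_ofReal
    have hstep : ∀ y : Fin (d + 1) → ℝ,
        ∫⁻ x, (ordDomain (d + 2)).indicator (fun x : Fin (d + 2) → ℝ =>
          ENNReal.ofReal (Real.exp (-(s * x 0)) * x 0 ^ u * W (fun j => x j.succ)))
            ((0 : Fin (d + 2)).insertNth x y) =
        (ordDomain (d + 1)).indicator (fun y => ∑ i ∈ Finset.range (u + 1),
          ENNReal.ofReal ((u.factorial : ℝ) / i.factorial / s ^ (u - i + 1)) *
            ENNReal.ofReal (Real.exp (-((s + A (k + 1)) * y 0)) * y 0 ^ (β (k + 1) + i) *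
              ∏ j : Fin d, (Real.exp (-(A (k + 1 + 1 + j) * y j.succ)) *
                y j.succ ^ β (k + 1 + 1 + j)))) y := by
      intro y
      by_cases hy : y ∈ ordDomain (d + 1)
      · have h1 : ∀ x : ℝ, (ordDomain (d + 2)).indicator (fun x : Fin (d + 2) → ℝ =>
            ENNReal.ofReal (Real.exp (-(s * x 0)) * x 0 ^ u * W (fun j => x j.succ)))
              ((0 : Fin (d + 2)).insertNth x y) =
            (Set.Ici (y 0)).indicator
              (fun x => ENNReal.ofReal (Real.exp (-(s * x)) * x ^ u)) x * ENNReal.ofReal (W y) := by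
          intro x
          rw [Fin.insertNth_zero']
          by_cases hx : y 0 ≤ x
          · rw [Set.indicator_of_mem (cons_mem_ordDomain.2 ⟨hx, hy⟩),
              Set.indicator_of_mem (Set.mem_Ici.2 hx), ← ENNReal.ofReal_mul (mul_nonneg
                (Real.exp_pos _).le (pow_nonneg ((hy.2 0).trans hx) _))]
            rfl
          · rw [Set.indicator_of_notMem (fun h => hx (cons_mem_ordDomain.1 h).1),
              Set.indicator_of_notMem (fun h => hx (Set.mem_Ici.1 h)), zero_mul]
        rw [lintegral_congr h1, lintegral_mul_const' _ _ ENNReal.ofReal_ne_top,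
          lintegral_indicator measurableSet_Ici, ← setLIntegral_congr Ioi_ae_eq_Ici,
          lintegral_Ioi_exp_mul_pow hs (hy.2 0), Set.indicator_of_mem hy,
          ← ENNReal.ofReal_mul (mul_nonneg (Real.exp_pos _).le (incGamma_nonneg hs (hy.2 0) _))]
        have hyp : ∀ j : Fin d, 0 ≤ y j.succ := fun j => hy.2 _
        have hy0 := hy.2 0
        have hpos : ∀ i, 0 ≤ Real.exp (-((s + A (k + 1)) * y 0)) * y 0 ^ (β (k + 1) + i) *
              ∏ j : Fin d, (Real.exp (-(A (k + 1 + 1 + j) * y j.succ)) *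
                y j.succ ^ β (k + 1 + 1 + j)) := fun i =>
          mul_nonneg (by positivity) (Finset.prod_nonneg fun j _ =>
            mul_nonneg (Real.exp_pos _).le (pow_nonneg (hyp j) _))
        rw [Finset.sum_congr rfl fun i _ => (ENNReal.ofReal_mul (show (0 : ℝ) ≤
          (u.factorial : ℝ) / i.factorial / s ^ (u - i + 1) by positivity)).symm,
          ← ENNReal.ofReal_sum_of_nonneg fun i _ => mul_nonneg (by positivity) (hpos i)]
        congr 1
        simp only [hW, incGamma, Finset.mul_sum, Finset.sum_mul, Fin.prod_univ_succ]
        refine Finset.sum_congr rfl fun i _ => ?_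
        have h2 : Real.exp (-((s + A (k + 1)) * y 0)) =
            Real.exp (-(s * y 0)) * Real.exp (-(A (k + 1) * y 0)) := by
          rw [← Real.exp_add]
          ring_nf
        have h3 : ∀ j : Fin d, k + 1 + ((j.succ : Fin (d + 1)) : ℕ) = k + 1 + 1 + j := fun j => by
          rw [Fin.val_succ]
          ring
        simp only [h3, Fin.val_zero, add_zero]
        rw [h2, pow_add]
        ring
      · have h1 : ∀ x : ℝ, (0 : Fin (d + 2)).insertNth x y ∉ ordDomain (d + 2) := fun x h => by
          rw [Fin.insertNth_zero'] at h
          exact hy (cons_mem_ordDomain.1 h).2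
        simp only [Set.indicator_of_notMem (h1 _), lintegral_zero, Set.indicator_of_notMem hy]
    have hm : ∀ i, Measurable fun y : Fin (d + 1) → ℝ =>
        ENNReal.ofReal (Real.exp (-((s + A (k + 1)) * y 0)) * y 0 ^ (β (k + 1) + i) *
              ∏ j : Fin d, (Real.exp (-(A (k + 1 + 1 + j) * y j.succ)) *
                y j.succ ^ β (k + 1 + 1 + j))) := fun i => by
      have : Continuous fun y : Fin (d + 1) → ℝ =>
        Real.exp (-((s + A (k + 1)) * y 0)) * y 0 ^ (β (k + 1) + i) *
              ∏ j : Fin d, (Real.exp (-(A (k + 1 + 1 + j) * y j.succ)) *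
                y j.succ ^ β (k + 1 + 1 + j)) := by fun_prop
      exact this.measurable.ennreal_ofReal
    calc _ = ∫⁻ x in ordDomain (d + 2), ENNReal.ofReal (Real.exp (-(s * x 0)) * x 0 ^ u *
          W (fun j => x j.succ)) := rfl
      _ = _ := by
        rw [← lintegral_indicator isClosed_ordDomain.measurableSet,
          lintegral_volume_insertNth 0 (hF.indicator isClosed_ordDomain.measurableSet)]
        have hcoef : ∀ i, 0 ≤ (u.factorial : ℝ) / i.factorial / s ^ (u - i + 1) := fun i => by
          positivity
        rw [lintegral_lintegral_swap (f := fun (a : ℝ) (y : Fin (d + 1) → ℝ) =>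
            (ordDomain (d + 2)).indicator (fun x : Fin (d + 2) → ℝ =>
              ENNReal.ofReal (Real.exp (-(s * x 0)) * x 0 ^ u * W (fun j => x j.succ)))
              ((0 : Fin (d + 2)).insertNth a y))
          ((hF.indicator isClosed_ordDomain.measurableSet).comp
            (measurable_insertNth 0)).aemeasurable, lintegral_congr hstep,
          lintegral_indicator isClosed_ordDomain.measurableSet,
          lintegral_finsetSum _ fun i _ => (hm i).const_mul _, coneVal,
          ENNReal.ofReal_sum_of_nonneg fun i _ => mul_nonneg (hcoef i)
            (coneVal_nonneg hA _ _ _ (add_pos_of_pos_of_nonneg hs (hA _)) _)]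
        refine Finset.sum_congr rfl fun i _ => ?_
        rw [lintegral_const_mul _ (hm i), ih (k + 1) (add_pos_of_pos_of_nonneg hs (hA _)),
          ← ENNReal.ofReal_mul (hcoef i)]

end ConeIntegral

end SLMIMO
namespace SLMIMO

/-! ### Cone integrals as nested sums -/

section Nested

/-- The exponent `∑_{i = k+1}^{k+d} (β_i + 1)`. -/
def tailExp (β : ℕ → ℕ) (d k : ℕ) : ℕ := ∑ j ∈ Finset.range d, (β (k + 1 + j) + 1)

lemma tailExp_succ (β : ℕ → ℕ) (d k : ℕ) :
    tailExp β (d + 1) k = β (k + 1) + 1 + tailExp β d (k + 1) := by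
  rw [tailExp, Finset.sum_range_succ', tailExp, add_comm, add_zero]
  congr 1
  exact Finset.sum_congr rfl fun j _ => by rw [show k + 1 + (j + 1) = k + 1 + 1 + j by ring]

/-- The product `∏_{j = k+1}^{k+d} r_j ^ (∑_{i = j+1}^{k+d} (β_i + 1))`. -/
noncomputable def ratioProd (r : ℕ → ℝ) (β : ℕ → ℕ) (d k : ℕ) : ℝ :=
  ∏ j ∈ Finset.range d, r (k + 1 + j) ^ tailExp β (d - 1 - j) (k + 1 + j)

lemma ratioProd_succ (r : ℕ → ℝ) (β : ℕ → ℕ) (d k : ℕ) :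
    ratioProd r β (d + 1) k = r (k + 1) ^ tailExp β d (k + 1) * ratioProd r β d (k + 1) := by
  rw [ratioProd, Finset.prod_range_succ', ratioProd, mul_comm]
  congr 1
  refine Finset.prod_congr rfl fun j _ => ?_
  rw [show k + 1 + (j + 1) = k + 1 + 1 + j by ring, show d + 1 - 1 - (j + 1) = d - 1 - j by omega]

/-- After the substitution `S (k + 1) = S k * r (k + 1)` at each level, the powers of `S k` add up
to an exponent independent of the summation index, and `(β + i)! / i!` is the rising factorial `(i +
1)_β`. -/
lemma coneVal_eq {A : ℕ → ℝ} {S r : ℕ → ℝ} (hS : ∀ j, S (j + 1) = S j + A (j + 1))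
    (β : ℕ → ℕ) (d k u : ℕ) (hS0 : ∀ j, k ≤ j → j ≤ k + d → 0 < S j)
    (hr : ∀ j, k ≤ j → j < k + d → r (j + 1) = S (j + 1) / S j) :
    coneVal A β d k (S k) u =
      u.factorial / S k ^ (u + 1 + tailExp β d k) / ratioProd r β d k * nested r β d k u := by
  induction d generalizing k u with
  | zero => simp [coneVal, tailExp, ratioProd, nested]
  | succ d ih =>
    have hk := hS0 k le_rfl (by omega)
    have hk1 := hS0 (k + 1) (by omega) (by omega)
    have hrk : S (k + 1) = S k * r (k + 1) := by
      rw [hr k le_rfl (by omega), mul_div_cancel₀ _ hk.ne']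
    have hrpos : 0 < r (k + 1) := by
      rw [hr k le_rfl (by omega)]
      positivity
    rw [coneVal, nested, Finset.mul_sum, ← hS]
    refine Finset.sum_congr rfl fun i hi => ?_
    have hi' : i ≤ u := by
      have := Finset.mem_range.1 hi
      omega
    rw [ih (k + 1) _ (fun j h1 h2 => hS0 j (by omega) (by omega))
      (fun j h1 h2 => hr j (by omega) (by omega)), hrk, ratioProd_succ, tailExp_succ]
    have hf : ((β (k + 1) + i).factorial : ℝ) =
        i.factorial * ((i + 1).ascFactorial (β (k + 1)) : ℝ) := by
      rw [add_comm, ← Nat.factorial_mul_ascFactorial]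
      push_cast
      rfl
    have h1 : u + 1 + (β (k + 1) + 1 + tailExp β d (k + 1)) =
        (u - i + 1) + (β (k + 1) + i + 1 + tailExp β d (k + 1)) := by omega
    rw [hf, h1, pow_add (S k) (u - i + 1), mul_pow,
      pow_add (r (k + 1)) (β (k + 1) + i + 1) (tailExp β d (k + 1))]
    have hif : (i.factorial : ℝ) ≠ 0 := by positivity
    field_simp

lemma tendsto_nested {ι : Type*} {l : Filter ι} {r : ι → ℕ → ℝ} {ρ : ℕ → ℝ} (β : ℕ → ℕ)
    (d k u : ℕ) (hr : ∀ j, k < j → j ≤ k + d → Tendsto (fun t => r t j) l (nhds (ρ j)))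
    (hρ : ∀ j, k < j → j ≤ k + d → 0 < ρ j) :
    Tendsto (fun t => nested (r t) β d k u) l (nhds (nested ρ β d k u)) := by
  induction d generalizing k u with
  | zero => simp only [nested]; exact tendsto_const_nhds
  | succ d ih =>
    simp only [nested]
    refine tendsto_finsetSum _ fun i _ => Tendsto.mul (Tendsto.div tendsto_const_nhds
      ((hr (k + 1) (by omega) (by omega)).pow _)
      (pow_pos (hρ (k + 1) (by omega) (by omega)) _).ne') (ih (k + 1) _
        (fun j h1 h2 => hr j (by omega) (by omega)) fun j h1 h2 => hρ j (by omega) (by omega))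

/-- When one ratio tends to infinity, the nested sum splits. -/
lemma tendsto_nested_split {ι : Type*} {l : Filter ι} {r : ι → ℕ → ℝ} {ρ : ℕ → ℝ} (β : ℕ → ℕ)
    (d e k u K : ℕ) (hK : K = k + d + 1)
    (hr : ∀ j, k < j → j ≤ k + d + 1 + e → j ≠ K → Tendsto (fun t => r t j) l (nhds (ρ j)))
    (hρ : ∀ j, k < j → j ≤ k + d + 1 + e → j ≠ K → 0 < ρ j)
    (hR : Tendsto (fun t => r t K) l atTop) :
    Tendsto (fun t => r t K ^ (β K + 1) * nested (r t) β (d + 1 + e) k u) l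
      (nhds (nested ρ β d k u * ((β K).factorial * nested ρ β e K (β K)))) := by
  induction d generalizing k u with
  | zero =>
    have hK' : k + 1 = K := hK.symm
    -- Once the leading power of the divergent ratio is cancelled, term `i` carries `(r t K)⁻¹ ^ i`.
    -- Only `i = 0` survives, and the remaining sum restarts with upper limit `β K` whatever `u`
    -- was.
    have h1 : ∀ᶠ t in l, r t K ^ (β K + 1) * nested (r t) β (0 + 1 + e) k u =
        ∑ i ∈ Finset.range (u + 1), ((i + 1).ascFactorial (β K) : ℝ) * (r t K)⁻¹ ^ i *
          nested (r t) β e K (β K + i) := by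
      filter_upwards [hR.eventually_gt_atTop 0] with t ht
      rw [show 0 + 1 + e = e + 1 by ring, nested, hK', Finset.mul_sum]
      refine Finset.sum_congr rfl fun i _ => ?_
      rw [show β K + i + 1 = (β K + 1) + i by ring, pow_add, inv_pow]
      field_simp
      ring
    refine Tendsto.congr' (h1.mono fun _ h => h.symm) ?_
    have h2 : nested ρ β 0 k u * ((β K).factorial * nested ρ β e K (β K)) =
        ∑ i ∈ Finset.range (u + 1), ((i + 1).ascFactorial (β K) : ℝ) * 0 ^ i *
          nested ρ β e K (β K + i) := by
      rw [Finset.sum_eq_single 0]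
      · simp [nested, Nat.one_ascFactorial]
      · intro i _ hi
        simp [hi]
      · simp
    rw [h2]
    exact tendsto_finsetSum _ fun i _ => ((tendsto_const_nhds).mul
      ((tendsto_inv_atTop_zero.comp hR).pow i)).mul (tendsto_nested β e K _
        (fun j h1 h2 => hr j (by omega) (by omega) (by omega))
        fun j h1 h2 => hρ j (by omega) (by omega) (by omega))
  | succ d ih =>
    have h1 : ∀ t, r t K ^ (β K + 1) * nested (r t) β (d + 1 + 1 + e) k u =
        ∑ i ∈ Finset.range (u + 1), ((i + 1).ascFactorial (β (k + 1)) : ℝ) /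
          r t (k + 1) ^ (β (k + 1) + i + 1) *
            (r t K ^ (β K + 1) * nested (r t) β (d + 1 + e) (k + 1) (β (k + 1) + i)) := by
      intro t
      rw [show d + 1 + 1 + e = d + 1 + e + 1 by ring, nested, Finset.mul_sum]
      refine Finset.sum_congr rfl fun i _ => by ring
    simp only [h1]
    rw [nested, Finset.sum_mul]
    refine tendsto_finsetSum _ fun i _ => ?_
    rw [mul_assoc]
    refine Tendsto.mul (Tendsto.div tendsto_const_nhds
      ((hr (k + 1) (by omega) (by omega) (by omega)).pow _)
      (pow_pos (hρ (k + 1) (by omega) (by omega) (by omega)) _).ne') ?_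
    exact ih (k + 1) _ (by omega) (fun j h1 h2 => hr j (by omega) (by omega))
      fun j h1 h2 => hρ j (by omega) (by omega)

end Nested

end SLMIMO
namespace SLMIMO

/-! ### Asymptotics of the contribution of a monomial -/

section MonomialAsymptotics

lemma nested_congr {r r' : ℕ → ℝ} (β : ℕ → ℕ) (d k u : ℕ)
    (h : ∀ j, k < j → j ≤ k + d → r j = r' j) : nested r β d k u = nested r' β d k u := by
  induction d generalizing k u with
  | zero => rfl
  | succ d ih =>
    simp only [nested]
    refine Finset.sum_congr rfl fun i _ => ?_
    rw [h (k + 1) (by omega) (by omega), ih (k + 1) _ fun j h1 h2 => h j (by omega) (by omega)]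

lemma tailExp_eq (β : ℕ → ℕ) (d k : ℕ) :
    tailExp β d k = (∑ j ∈ Finset.Icc (k + 1) (k + d), β j) + d := by
  have h : Finset.Icc (k + 1) (k + d) = Finset.Ico (k + 1) (k + 1 + d) := by
    ext j
    simp only [Finset.mem_Icc, Finset.mem_Ico]
    omega
  rw [tailExp, Finset.sum_add_distrib, h, Finset.sum_Ico_eq_sum_range]
  simp

/-- The exponent `∑_{j > k} (β_j + 1)`. -/
def expAbove (n : ℕ) (β : ℕ → ℕ) (k : ℕ) : ℕ := (∑ j ∈ Finset.Icc (k + 1) n, β j) + (n - k)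

lemma ratioProd_eq (r : ℕ → ℝ) (β : ℕ → ℕ) {n : ℕ} (hn : 1 ≤ n) :
    ratioProd r β (n - 1) 1 = ∏ k ∈ Finset.Icc 2 n, r k ^ expAbove n β k := by
  have h : Finset.Icc 2 n = Finset.Ico 2 (n + 1) := by
    ext j
    simp only [Finset.mem_Icc, Finset.mem_Ico]
    omega
  rw [ratioProd, h, Finset.prod_Ico_eq_prod_range]
  refine Finset.prod_congr (by congr 1) fun j hj => ?_
  have hj' := Finset.mem_range.1 hj
  rw [tailExp_eq, expAbove, show 1 + 1 + j + (n - 1 - 1 - j) = n by omega,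
    show n - 1 - 1 - j = n - (2 + j) by omega]

lemma prod_expAbove_split (r : ℕ → ℝ) (β : ℕ → ℕ) {n N : ℕ} (hN0 : 1 ≤ N) (hN : N < n) :
    ∏ k ∈ Finset.Icc 2 n, r k ^ expAbove n β k =
      (∏ k ∈ Finset.Icc 2 N, r k ^ expAbove n β k) * r (N + 1) ^ expAbove n β (N + 1) *
        ∏ k ∈ Finset.Icc (N + 2) n, r k ^ expAbove n β k := by
  have h (a b : ℕ) : Finset.Icc (a + 1) b = Finset.Ioc a b := by
    ext j
    simp only [Finset.mem_Icc, Finset.mem_Ioc]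
    omega
  rw [h, h, h, ← Finset.prod_Ioc_consecutive _ hN0 hN.le,
    ← Finset.prod_Ioc_consecutive _ (Nat.le_succ N) hN, Nat.Ioc_succ_singleton,
    Finset.prod_singleton, mul_assoc]

/-- The exponent at `k = n` is zero, which is why the approximation stops its product at `n - 1`. -/
lemma prod_expAbove_top (r : ℕ → ℝ) (β : ℕ → ℕ) {n m : ℕ} :
    ∏ k ∈ Finset.Icc m n, r k ^ expAbove n β k =
      ∏ k ∈ Finset.Icc m (n - 1), r k ^ expAbove n β k := by
  symm
  refine Finset.prod_subset (Finset.Icc_subset_Icc_right (Nat.sub_le _ _)) fun k hk hk' => ?_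
  have : k = n := by
    simp only [Finset.mem_Icc, not_and, not_le] at hk hk'
    have := hk' hk.1
    omega
  rw [this, expAbove]
  simp

lemma tendsto_affine_div_affine (x y a : ℝ) {D : ℝ} (hD : D ≠ 0) :
    Tendsto (fun t : ℝ => (x + t * a) / (y + t * D)) atTop (nhds (a / D)) := by
  have h : Tendsto (fun t : ℝ => (x * t⁻¹ + a) / (y * t⁻¹ + D)) atTop
      (nhds ((x * 0 + a) / (y * 0 + D))) :=
    ((tendsto_inv_atTop_zero.const_mul x).add_const a).div
      ((tendsto_inv_atTop_zero.const_mul y).add_const D) (by simpa using hD)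
  simp only [mul_zero, zero_add] at h
  refine h.congr' ?_
  filter_upwards [eventually_gt_atTop 0] with t ht
  rw [← mul_div_mul_left (x * t⁻¹ + a) (y * t⁻¹ + D) ht.ne']
  congr 1 <;> field_simp

variable {n N : ℕ} {a : ℕ → ℝ}

/-- The partial sums of the coefficients from index `N + 1` on. -/
def psum (N : ℕ) (a : ℕ → ℝ) (k : ℕ) : ℝ := ∑ j ∈ Finset.Icc (N + 1) k, a j

lemma psum_eq_zero {k : ℕ} (hk : k ≤ N) : psum N a k = 0 := by
  rw [psum, Finset.Icc_eq_empty (by omega), Finset.sum_empty]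

lemma psum_succ (ha0 : ∀ j, 1 ≤ j → j ≤ N → a j = 0) (k : ℕ) :
    psum N a (k + 1) = psum N a k + a (k + 1) := by
  by_cases hk : N ≤ k
  · exact Finset.sum_Icc_succ_top (by omega) _
  · rw [psum_eq_zero (by omega), psum_eq_zero (by omega), ha0 _ (by omega) (by omega), add_zero]

lemma psum_nonneg (hann : ∀ j, 0 ≤ a j) (k : ℕ) : 0 ≤ psum N a k :=
  Finset.sum_nonneg fun j _ => hann j

lemma psum_pos (hann : ∀ j, 0 ≤ a j) (hpos : 0 < a (N + 1)) {k : ℕ} (hk : N + 1 ≤ k) :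
    0 < psum N a k :=
  hpos.trans_le (Finset.single_le_sum (fun j _ => hann j) (Finset.mem_Icc.2 ⟨le_rfl, hk⟩))

lemma ratio_scaled (t : ℝ) (k : ℕ) :
    ratio N (fun j => t * a j) (k + 1) = 1 + (1 + t * a (k + 1)) / (k + t * psum N a k) := by
  rw [ratio, psum, Finset.mul_sum]
  simp

lemma ratio_of_le (ha0 : ∀ j, 1 ≤ j → j ≤ N → a j = 0) (t : ℝ) {k : ℕ} (hk : 1 ≤ k)
    (hkN : k ≤ N) : ratio N (fun j => t * a j) k = constRatio k := by
  obtain ⟨k, rfl⟩ := Nat.exists_eq_add_of_le' hk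
  rw [ratio_scaled, ha0 _ hk hkN, psum_eq_zero (by omega), constRatio]
  simp

/-- The limits of the ratios. -/
noncomputable def ratioLim (N : ℕ) (a : ℕ → ℝ) (k : ℕ) : ℝ :=
  if k ≤ N then constRatio k else 1 + a k / psum N a (k - 1)

lemma ratioLim_pos (hann : ∀ j, 0 ≤ a j) {k : ℕ} (hk : 2 ≤ k) : 0 < ratioLim N a k := by
  rw [ratioLim]
  split_ifs
  · rw [constRatio]
    have : (2 : ℝ) ≤ k := by exact_mod_cast hk
    have : (0 : ℝ) < k - 1 := by linarith
    positivity
  · have := psum_nonneg (N := N) hann (k - 1)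
    have := hann k
    positivity

lemma tendsto_ratio (ha0 : ∀ j, 1 ≤ j → j ≤ N → a j = 0) (hann : ∀ j, 0 ≤ a j)
    (hpos : 0 < a (N + 1)) {k : ℕ} (hk : 2 ≤ k) (hkN : k ≠ N + 1) :
    Tendsto (fun t : ℝ => ratio N (fun j => t * a j) k) atTop (nhds (ratioLim N a k)) := by
  rw [ratioLim]
  split_ifs with h
  · simp only [ratio_of_le ha0 _ (by omega : 1 ≤ k) h]
    exact tendsto_const_nhds
  · obtain ⟨k, rfl⟩ := Nat.exists_eq_add_of_le' (by omega : 1 ≤ k)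
    simp only [ratio_scaled, Nat.add_sub_cancel]
    exact (tendsto_affine_div_affine _ _ _ (psum_pos hann hpos (by omega)).ne').const_add 1

lemma tendsto_ratio_atTop (hpos : 0 < a (N + 1)) (hN : 1 ≤ N) :
    Tendsto (fun t : ℝ => ratio N (fun j => t * a j) (N + 1)) atTop atTop := by
  have hN' : (0 : ℝ) < N := by exact_mod_cast hN
  simp only [ratio_scaled, psum_eq_zero le_rfl, mul_zero, add_zero]
  refine tendsto_atTop_add_const_left _ _ (Tendsto.atTop_div_const hN' ?_)
  exact tendsto_atTop_add_const_left _ _ (tendsto_id.atTop_mul_const hpos)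

/-- The rates `1 + t * a j` have partial sums `j + t * psum N a j`, because `a` vanishes up to `N`;
quotients of consecutive partial sums are the factors `ratio`. -/
lemma coneVal_scaled (ha0 : ∀ j, 1 ≤ j → j ≤ N → a j = 0) (hann : ∀ j, 0 ≤ a j) (hn : 1 ≤ n)
    (β : ℕ → ℕ) {t : ℝ} (ht : 0 ≤ t) :
    coneVal (fun j => 1 + t * a j) β (n - 1) 1 (1 + t * a 1) (β 1) =
      (β 1).factorial / (1 + t * psum N a 1) ^ expAbove n β 0 /
        (∏ k ∈ Finset.Icc 2 n, ratio N (fun j => t * a j) k ^ expAbove n β k) *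
          nested (ratio N fun j => t * a j) β (n - 1) 1 (β 1) := by
  have hS : ∀ j : ℕ, ((j + 1 : ℕ) : ℝ) + t * psum N a (j + 1) =
      ((j : ℕ) : ℝ) + t * psum N a j + (1 + t * a (j + 1)) := fun j => by
    rw [psum_succ ha0]
    push_cast
    ring
  have hS0 : ∀ j : ℕ, 1 ≤ j → 0 < (j : ℝ) + t * psum N a j := fun j hj =>
    add_pos_of_pos_of_nonneg (by exact_mod_cast hj) (mul_nonneg ht (psum_nonneg hann j))
  have h := coneVal_eq (A := fun j => 1 + t * a j) (S := fun j => (j : ℝ) + t * psum N a j)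
    (r := ratio N fun j => t * a j) hS β (n - 1) 1 (β 1) (fun j h1 _ => hS0 j h1)
    (fun j h1 _ => by
      have := hS0 j h1
      rw [hS, ratio_scaled, add_div _ (1 + t * a (j + 1)), div_self this.ne'])
  have h1 : 1 + t * a 1 = (1 : ℕ) + t * psum N a 1 := by
    rw [show psum N a 1 = a 1 by rw [psum_succ ha0 0, psum_eq_zero (Nat.zero_le _), zero_add]]
    simp
  have h2 : β 1 + 1 + tailExp β (n - 1) 1 = expAbove n β 0 := by
    have : Finset.Icc 1 n = insert 1 (Finset.Icc 2 n) := by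
      ext j
      simp only [Finset.mem_Icc, Finset.mem_insert]
      omega
    rw [tailExp_eq, expAbove, show 1 + (n - 1) = n by omega, zero_add, this,
      Finset.sum_insert (by simp)]
    norm_num
    omega
  rw [h1, h, h2, ratioProd_eq _ _ hn]
  simp

/-- After scaling, the exact and the approximate contribution of a monomial have the same limit. -/
lemma exists_tendsto_monomialTerm (ha0 : ∀ j, 1 ≤ j → j ≤ N → a j = 0) (hann : ∀ j, 0 ≤ a j)
    (hpos : 0 < a (N + 1)) (hN : N < n) (β : ℕ → ℕ) :
    ∃ c : ℝ, Tendsto (fun t : ℝ => t ^ expAbove n β N *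
        coneVal (fun j => 1 + t * a j) β (n - 1) 1 (1 + t * a 1) (β 1)) atTop (nhds c) ∧
      Tendsto (fun t : ℝ => t ^ expAbove n β N * monomialTerm n N (fun j => t * a j) β)
        atTop (nhds c) := by
  have htop : ∃ p, Tendsto (fun t : ℝ => 1 / ∏ k ∈ Finset.Icc (N + 2) (n - 1),
      ratio N (fun j => t * a j) k ^ expAbove n β k) atTop (nhds p) := by
    refine ⟨_, Tendsto.div tendsto_const_nhds (tendsto_finsetProd _ fun k hk =>
      (tendsto_ratio ha0 hann hpos (k := k) ?_ ?_).pow _) ?_⟩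
    · have := Finset.mem_Icc.1 hk
      omega
    · have := Finset.mem_Icc.1 hk
      omega
    · refine Finset.prod_ne_zero_iff.2 fun k hk => (pow_pos (ratioLim_pos hann ?_) _).ne'
      have := Finset.mem_Icc.1 hk
      omega
  have htail : Tendsto (fun t : ℝ => nested (ratio N fun j => t * a j) β (n - 1 - N) (N + 1)
      (β (N + 1))) atTop (nhds (nested (ratioLim N a) β (n - 1 - N) (N + 1) (β (N + 1)))) :=
    tendsto_nested β _ _ _ (fun j h1 _ => tendsto_ratio ha0 hann hpos (by omega) (by omega))
      fun j h1 _ => ratioLim_pos hann (by omega)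
  obtain ⟨p, hp⟩ := htop
  -- For `N = 0` already the first rate diverges and all ratios converge. For `N ≥ 1` the first `N`
  -- rates are fixed and the divergence sits in the ratio with index `N + 1`.
  rcases Nat.eq_zero_or_pos N with rfl | hN0
  · have hlead : Tendsto (fun t : ℝ => (t / (1 + t * a 1)) ^ expAbove n β 0) atTop
        (nhds ((1 / a 1) ^ expAbove n β 0)) := by
      refine Tendsto.pow ?_ _
      simpa using tendsto_affine_div_affine 0 1 1 hpos.ne'
    have hcommon := ((hlead.const_mul ((β 1).factorial : ℝ)).mul hp).mul htail
    refine ⟨_, hcommon.congr' ?_, hcommon.congr' ?_⟩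
    · filter_upwards [eventually_ge_atTop 0] with t ht
      rw [coneVal_scaled ha0 hann (by omega) β ht, prod_expAbove_top, psum]
      simp [div_pow]
      ring
    · refine Filter.Eventually.of_forall fun t => ?_
      have h0 : nested constRatio β (0 - 1) 1 (β 1) = 1 := rfl
      simp only [monomialTerm, h0, if_true, Nat.one_ascFactorial, div_pow]
      simp only [expAbove]
      simp
      ring
  · have hN' : (0 : ℝ) < N := by exact_mod_cast hN0
    have hR : ∀ t, ratio N (fun j => t * a j) (N + 1) = 1 + (1 + t * a (N + 1)) / N := fun t => by
      rw [ratio_scaled, psum_eq_zero le_rfl, mul_zero, add_zero]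
    have hlead : Tendsto (fun t : ℝ => (t / ratio N (fun j => t * a j) (N + 1)) ^ expAbove n β N)
        atTop (nhds ((1 / (a (N + 1) / N)) ^ expAbove n β N)) := by
      refine Tendsto.pow ?_ _
      have h := tendsto_affine_div_affine 0 (1 + 1 / N) 1 (div_pos hpos hN').ne'
      refine h.congr fun t => ?_
      rw [hR]
      congr 1
      · ring
      · ring
    have hmid : Tendsto (fun t : ℝ => ratio N (fun j => t * a j) (N + 1) ^ (β (N + 1) + 1) *
        nested (ratio N fun j => t * a j) β (n - 1) 1 (β 1)) atTop
          (nhds (nested (ratioLim N a) β (N - 1) 1 (β 1) * ((β (N + 1)).factorial *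
            nested (ratioLim N a) β (n - 1 - N) (N + 1) (β (N + 1))))) := by
      have h := tendsto_nested_split (l := atTop) (r := fun t : ℝ => ratio N fun j => t * a j)
        (ρ := ratioLim N a) β (N - 1) (n - 1 - N) 1 (β 1) (N + 1) (by omega)
        (fun j h1 _ h3 => tendsto_ratio ha0 hann hpos (by omega) h3)
        (fun j h1 _ h3 => ratioLim_pos hann (by omega)) (tendsto_ratio_atTop hpos hN0)
      rwa [show N - 1 + 1 + (n - 1 - N) = n - 1 by omega] at h
    have hconst : nested (ratioLim N a) β (N - 1) 1 (β 1) = nested constRatio β (N - 1) 1 (β 1) :=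
      nested_congr β _ _ _ fun j h1 h2 => by rw [ratioLim, if_pos (by omega)]
    rw [hconst] at hmid
    set P : ℝ := ∏ k ∈ Finset.Icc 2 N, constRatio k ^ expAbove n β k with hP
    have hPt : ∀ t : ℝ,
        ∏ k ∈ Finset.Icc 2 N, ratio N (fun j => t * a j) k ^ expAbove n β k = P := fun t =>
      Finset.prod_congr rfl fun k hk => by
        have := Finset.mem_Icc.1 hk
        rw [ratio_of_le ha0 t (by omega) this.2]
    have hcommon := (hlead.const_mul ((β 1).factorial / P)).mul hp
    -- The divergent ratio enters the nested sum with exponent `β (N + 1) + 1` and the product with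
    -- exponent `expAbove n β (N + 1)`.
    have hexp : expAbove n β N = (β (N + 1) + 1) + expAbove n β (N + 1) := by
      have : Finset.Icc (N + 1) n = insert (N + 1) (Finset.Icc (N + 1 + 1) n) := by
        ext j
        simp only [Finset.mem_Icc, Finset.mem_insert]
        omega
      rw [expAbove, expAbove, this, Finset.sum_insert (by simp)]
      omega
    refine ⟨_, (hcommon.mul hmid).congr' ?_, (hcommon.mul ((htail.const_mul
      ((β (N + 1)).factorial : ℝ)).const_mul _)).congr' ?_⟩
    · filter_upwards [eventually_ge_atTop 0] with t ht
      have hRpos : 0 < ratio N (fun j => t * a j) (N + 1) := by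
        rw [hR]
        have := hann (N + 1)
        positivity
      rw [coneVal_scaled ha0 hann (by omega) β ht, prod_expAbove_split _ _ hN0 hN,
        prod_expAbove_top, psum_eq_zero hN0,
        hPt t, div_pow, hexp, pow_add (ratio N (fun j => t * a j) (N + 1))]
      simp only [mul_zero, add_zero, one_pow, div_one]
      field_simp
    · refine Filter.Eventually.of_forall fun t => ?_
      simp only [monomialTerm, if_neg hN0.ne', Nat.one_ascFactorial, div_pow, hR]
      simp only [hP, expAbove]
      ring

end MonomialAsymptotics

end SLMIMO
namespace SLMIMO

/-! ### Asymptotics of the moment generating function -/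

section WeightedDegree

variable {σ : Type*} [Fintype σ]

/-- All monomials of `f` have weighted degree at least `d`. -/
def WeightGE (w : σ → ℕ) (d : ℕ) (f : MvPolynomial σ ℝ) : Prop :=
  ∀ p ∈ f.support, d ≤ ∑ m, w m * p m

lemma WeightGE.mul {w : σ → ℕ} {d e : ℕ} {f g : MvPolynomial σ ℝ} (hf : WeightGE w d f)
    (hg : WeightGE w e g) : WeightGE w (d + e) (f * g) := by
  classical
  intro p hp
  obtain ⟨p₁, h₁, p₂, h₂, rfl⟩ := Finset.mem_add.1 (MvPolynomial.support_mul f g hp)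
  simp only [Finsupp.add_apply, mul_add, Finset.sum_add_distrib]
  exact add_le_add (hf p₁ h₁) (hg p₂ h₂)

lemma WeightGE.prod {ι : Type*} {w : σ → ℕ} {s : Finset ι} {d : ι → ℕ}
    {f : ι → MvPolynomial σ ℝ} (h : ∀ i ∈ s, WeightGE w (d i) (f i)) :
    WeightGE w (∑ i ∈ s, d i) (∏ i ∈ s, f i) := by
  classical
  induction s using Finset.induction_on with
  | empty => intro p _; simp
  | insert i s hi ih =>
    rw [Finset.sum_insert hi, Finset.prod_insert hi]
    exact (h i (Finset.mem_insert_self _ _)).mul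
      (ih fun j hj => h j (Finset.mem_insert_of_mem hj))

lemma WeightGE.pow {w : σ → ℕ} {d : ℕ} {f : MvPolynomial σ ℝ} (hf : WeightGE w d f) (k : ℕ) :
    WeightGE w (k * d) (f ^ k) := by
  simpa using WeightGE.prod (s := Finset.range k) (f := fun _ => f) fun _ _ => hf

lemma WeightGE.mono {w : σ → ℕ} {d e : ℕ} {f : MvPolynomial σ ℝ} (hf : WeightGE w d f)
    (h : e ≤ d) : WeightGE w e f := fun p hp => h.trans (hf p hp)

lemma WeightGE.sub {w : σ → ℕ} {d : ℕ} {f g : MvPolynomial σ ℝ} (hf : WeightGE w d f)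
    (hg : WeightGE w d g) : WeightGE w d (f - g) := by
  classical
  intro p hp
  rcases Finset.mem_union.1 (MvPolynomial.support_sub σ f g hp) with h | h
  exacts [hf p h, hg p h]

lemma weightGE_X (w : σ → ℕ) (m : σ) : WeightGE w (w m) (MvPolynomial.X m) := by
  classical
  intro p hp
  rw [MvPolynomial.support_X, Finset.mem_singleton] at hp
  rw [hp]
  refine le_trans ?_ (Finset.single_le_sum (fun _ _ => Nat.zero_le _) (Finset.mem_univ m))
  simp

end WeightedDegree

/-! ### Trailing degrees and the exact Laplace transform. -/

section MgfAsymptotics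

variable {n : ℕ} {Nt Nr : ℕ}

/-- The indicator of the indices from `N` on, counted from zero. -/
def tailWeight (N : ℕ) (m : Fin n) : ℕ := if N ≤ m then 1 else 0

lemma tailWeight_antitone {N : ℕ} {i j : Fin n} (h : i ≤ j) : tailWeight N i ≤ tailWeight N j := by
  have : (i : ℕ) ≤ j := h
  unfold tailWeight
  split_ifs <;> omega

lemma tailDeg_eq (N : ℕ) (p : Fin n →₀ ℕ) : tailDeg N p = ∑ m, tailWeight N m * p m := by
  have h1 : ∑ m, tailWeight N m * p m = ∑ m ∈ Finset.univ.filter (fun m : Fin n => N ≤ m), p m := by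
    rw [Finset.sum_filter]
    refine Finset.sum_congr rfl fun m _ => ?_
    unfold tailWeight
    split_ifs <;> simp
  rw [h1, tailDeg]
  symm
  refine Finset.sum_bij (fun m _ => (m : ℕ) + 1) (fun m hm => ?_) (fun a _ b _ h => ?_)
    (fun j hj => ?_) fun m hm => ?_
  · have := (Finset.mem_filter.1 hm).2
    rw [Finset.mem_Icc]
    omega
  · exact Fin.ext (by simpa using h)
  · have := Finset.mem_Icc.1 hj
    exact ⟨⟨j - 1, by omega⟩, Finset.mem_filter.2 ⟨Finset.mem_univ _, by simp; omega⟩, by simp; omega⟩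
  · have : 1 ≤ (m : ℕ) + 1 ∧ (m : ℕ) + 1 ≤ n := by omega
    rw [at1, dif_pos this]
    rfl

/-- The minimal degree of the density polynomial in the variables from index `N` on. -/
def baseDeg (Nt Nr N : ℕ) : ℕ :=
  gap Nt Nr * ∑ m : Fin (min Nt Nr), tailWeight N m +
    2 * ∑ i : Fin (min Nt Nr), ∑ _j ∈ Finset.Ioi i, tailWeight N i

/-- The diversity order of a difference vector with `N` leading zeros. -/
def diversity (Nt Nr N : ℕ) : ℕ := baseDeg Nt Nr N + ∑ m : Fin (min Nt Nr), tailWeight N m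

lemma sum_tailWeight {N : ℕ} (hN : N ≤ n) : ∑ m : Fin n, tailWeight N m = n - N := by
  obtain ⟨k, rfl⟩ := Nat.exists_eq_add_of_le hN
  rw [Fin.sum_univ_add]
  simp [tailWeight]

lemma diversity_lt {N N' : ℕ} (h : N < N') (hN' : N' ≤ min Nt Nr) :
    diversity Nt Nr N' < diversity Nt Nr N := by
  have hw : ∀ m : Fin (min Nt Nr), tailWeight N' m ≤ tailWeight N m := fun m => by
    unfold tailWeight
    split_ifs <;> omega
  unfold diversity baseDeg
  refine add_lt_add_of_le_of_lt (add_le_add (Nat.mul_le_mul_left _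
    (Finset.sum_le_sum fun m _ => hw m)) (Nat.mul_le_mul_left _ (Finset.sum_le_sum fun m _ =>
      Finset.sum_le_sum fun _ _ => hw m))) ?_
  rw [sum_tailWeight hN', sum_tailWeight (h.le.trans hN')]
  omega

/-- Trailing variables have weight one, the others zero. A factor `λ_m` contributes its weight, and
a squared difference at least twice the smaller of its two weights, which belongs to the smaller
index. -/
lemma baseDeg_le_tailDeg (N : ℕ) {p : Fin (min Nt Nr) →₀ ℕ}
    (hp : p ∈ (eigPoly Nt Nr).support) : baseDeg Nt Nr N ≤ tailDeg N p := by
  have h : WeightGE (tailWeight N) (baseDeg Nt Nr N) (eigPoly Nt Nr) := by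
    have h1 := WeightGE.prod (s := Finset.univ) fun (m : Fin (min Nt Nr)) _ =>
      (weightGE_X (tailWeight N) m).pow (gap Nt Nr)
    have h2 := WeightGE.prod (s := Finset.univ) fun (m : Fin (min Nt Nr)) _ =>
      WeightGE.prod (s := Finset.univ.filter (fun m' => m' < m)) fun m' hm' =>
        (((weightGE_X (tailWeight N) m).mono (tailWeight_antitone
          (Finset.mem_filter.1 hm').2.le)).sub (weightGE_X (tailWeight N) m')).pow 2
    refine (h1.mul h2).mono (le_of_eq ?_)
    rw [baseDeg, Finset.mul_sum, Finset.mul_sum]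
    congr 1
    simp only [Finset.mul_sum]
    exact Finset.sum_comm' (by simp)
  rw [tailDeg_eq]
  exact h p hp

lemma lintegral_ordDomain_monomial (hn : 0 < n) {a : Fin n → ℝ} (ha : ∀ m, 0 ≤ a m)
    (p : Fin n → ℕ) :
    ∫⁻ x in ordDomain n, ENNReal.ofReal (∏ m, (Real.exp (-((1 + a m) * x m)) * x m ^ p m)) =
      ENNReal.ofReal (coneVal (fun j => 1 + at1 a j) (at1 p) (n - 1) 1 (1 + at1 a 1) (at1 p 1)) := by
  obtain ⟨d, rfl⟩ := Nat.exists_eq_add_of_le' hn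
  have hA : ∀ j, 0 ≤ at1 a j := fun j => by
    unfold at1
    split_ifs
    exacts [ha _, le_rfl]
  have h := lintegral_ordDomain (A := fun j => 1 + at1 a j) (fun j => by linarith [hA j])
    (at1 p) d 1 (s := 1 + at1 a 1) (by linarith [hA 1]) (at1 p 1)
  rw [Nat.add_sub_cancel, ← h]
  refine lintegral_congr fun x => ?_
  have e1 {R : Type} [Zero R] (f : Fin (d + 1) → R) : at1 f 1 = f 0 := by
    rw [at1, dif_pos ⟨le_rfl, by omega⟩]
    rfl
  have e2 {R : Type} [Zero R] (f : Fin (d + 1) → R) (j : Fin d) : at1 f (1 + 1 + j) = f j.succ := by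
    rw [at1, dif_pos ⟨by omega, by omega⟩]
    congr 1
    ext
    simp
    omega
  rw [Fin.prod_univ_succ]
  simp only [e1, e2]

lemma at1_nonneg {a : Fin n → ℝ} (ha : ∀ m, 0 ≤ a m) (j : ℕ) : 0 ≤ at1 a j := by
  unfold at1
  split_ifs
  exacts [ha _, le_rfl]

lemma integral_ordDomain_monomial (hn : 0 < n) {a : Fin n → ℝ} (ha : ∀ m, 0 ≤ a m)
    (p : Fin n → ℕ) :
    IntegrableOn (fun x => ∏ m, (Real.exp (-((1 + a m) * x m)) * x m ^ p m)) (ordDomain n) ∧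
    ∫ x in ordDomain n, ∏ m, (Real.exp (-((1 + a m) * x m)) * x m ^ p m) =
      coneVal (fun j => 1 + at1 a j) (at1 p) (n - 1) 1 (1 + at1 a 1) (at1 p 1) := by
  have h := lintegral_ordDomain_monomial hn ha p
  have hc : Continuous fun x : Fin n → ℝ => ∏ m, (Real.exp (-((1 + a m) * x m)) * x m ^ p m) := by
    fun_prop
  have h0 : 0 ≤ᵐ[volume.restrict (ordDomain n)] fun x : Fin n → ℝ =>
      ∏ m, (Real.exp (-((1 + a m) * x m)) * x m ^ p m) :=
    (ae_restrict_iff' isClosed_ordDomain.measurableSet).2 (Filter.Eventually.of_forall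
      fun x hx => Finset.prod_nonneg fun m _ =>
        mul_nonneg (Real.exp_pos _).le (pow_nonneg (hx.2 m) _))
  constructor
  · refine ⟨hc.aestronglyMeasurable, ?_⟩
    rw [hasFiniteIntegral_iff_ofReal h0, h]
    exact ENNReal.ofReal_lt_top
  · rw [integral_eq_lintegral_of_nonneg_ae h0 hc.aestronglyMeasurable, h, ENNReal.toReal_ofReal]
    exact coneVal_nonneg (fun j => by linarith [at1_nonneg ha j]) _ _ _
      (by linarith [at1_nonneg ha 1]) _

lemma mgfNeg_eq (hn : 0 < min Nt Nr) {a : Fin (min Nt Nr) → ℝ} (ha : ∀ m, 0 ≤ a m) :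
    mgfNeg Nt Nr a = 1 / normC Nt Nr * ∑ p ∈ (eigPoly Nt Nr).support,
      MvPolynomial.coeff p (eigPoly Nt Nr) * coneVal (fun j => 1 + at1 a j) (at1 p)
        (min Nt Nr - 1) 1 (1 + at1 a 1) (at1 p 1) := by
  have h1 : ∀ x : Fin (min Nt Nr) → ℝ,
      (∏ m, Real.exp (-(a m * x m))) * (1 / normC Nt Nr * unnormDensity Nt Nr x) =
      1 / normC Nt Nr * ∑ p ∈ (eigPoly Nt Nr).support, MvPolynomial.coeff p (eigPoly Nt Nr) *
        ∏ m, (Real.exp (-((1 + a m) * x m)) * x m ^ p m) := by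
    intro x
    rw [unnormDensity, MvPolynomial.eval_eq']
    rw [mul_left_comm, ← mul_assoc (∏ m, Real.exp (-(a m * x m))), Finset.mul_sum]
    congr 1
    refine Finset.sum_congr rfl fun p _ => ?_
    have h2 : ∏ m, (Real.exp (-((1 + a m) * x m)) * x m ^ p m) =
        (∏ m, Real.exp (-(a m * x m))) * (∏ m, Real.exp (-x m)) * ∏ m, x m ^ p m := by
      rw [← Finset.prod_mul_distrib, ← Finset.prod_mul_distrib]
      refine Finset.prod_congr rfl fun m _ => ?_
      rw [← Real.exp_add]
      ring_nf
    rw [h2]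
    ring
  have h2 : ∀ p ∈ (eigPoly Nt Nr).support, Integrable (fun x : Fin (min Nt Nr) → ℝ =>
      MvPolynomial.coeff p (eigPoly Nt Nr) * ∏ m, (Real.exp (-((1 + a m) * x m)) * x m ^ p m))
      (volume.restrict (ordDomain (min Nt Nr))) := fun p _ =>
    (integral_ordDomain_monomial hn ha p).1.const_mul _
  have h3 : ∀ p ∈ (eigPoly Nt Nr).support, ∫ x in ordDomain (min Nt Nr),
      MvPolynomial.coeff p (eigPoly Nt Nr) * ∏ m, (Real.exp (-((1 + a m) * x m)) * x m ^ p m) =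
      MvPolynomial.coeff p (eigPoly Nt Nr) * coneVal (fun j => 1 + at1 a j) (at1 p)
        (min Nt Nr - 1) 1 (1 + at1 a 1) (at1 p 1) := fun p _ =>
    (integral_const_mul _ _).trans (congrArg _ (integral_ordDomain_monomial hn ha p).2)
  rw [mgfNeg]
  simp only [h1]
  rw [integral_const_mul, integral_finsetSum _ h2, Finset.sum_congr rfl h3]

end MgfAsymptotics

end SLMIMO
namespace SLMIMO

/-! ### The Laplace transform along a ray. -/

section MgfLimit

variable {Nt Nr : ℕ}

/-- Lower bound for the moment generating function along a ray. -/
lemma exists_le_mgfNeg (i₀ : Fin (min Nt Nr)) {a : Fin (min Nt Nr) → ℝ} (ha : ∀ m, 0 ≤ a m)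
    (ha0 : ∀ m < i₀, a m = 0) :
    ∃ δ : ℝ, 0 < δ ∧ ∀ t : ℝ, 1 ≤ t →
      δ ≤ t ^ diversity Nt Nr i₀ * mgfNeg Nt Nr (fun m => t * a m) := by
  obtain ⟨ν, hν⟩ : ∃ ν : ℝ, ν = ((min Nt Nr : ℕ) : ℝ) := ⟨_, rfl⟩
  set M : ℝ := ∑ m, (1 + a m) * (2 * ν + 2) with hM
  refine ⟨(normC Nt Nr)⁻¹ * Real.exp (-M), mul_pos (inv_pos.2 normC_pos) (Real.exp_pos _),
    fun t ht => ?_⟩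
  have ht0 : 0 < t := by linarith
  -- The typical sizes of the eigenvalues under the exponential weight: one before `i₀`, `1 / t`
  -- from `i₀` on.
  set τ : Fin (min Nt Nr) → ℝ := fun m => (t ^ tailWeight (i₀ : ℕ) m)⁻¹ with hτ
  have hτ0 : ∀ m, 0 < τ m := fun m => inv_pos.2 (pow_pos ht0 _)
  have hτ1 : ∀ m, τ m ≤ 1 := fun m => inv_le_one_of_one_le₀ (one_le_pow₀ ht)
  have hτa : ∀ i j, i ≤ j → τ j ≤ τ i := fun i j h =>
    inv_anti₀ (pow_pos ht0 _) (pow_le_pow_right₀ ht (tailWeight_antitone h))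
  -- The factors `2 (ν - m) - 1` and `2 (ν - m)` separate the intervals: on the box `x m ≥ τ m`, and
  -- `x i - x j ≥ τ i` for `i < j`.
  set lo : Fin (min Nt Nr) → ℝ := fun m => (2 * (ν - m) - 1) * τ m with hlo
  set hi : Fin (min Nt Nr) → ℝ := fun m => (2 * (ν - m)) * τ m with hhi
  set box : Set (Fin (min Nt Nr) → ℝ) := Set.Icc lo hi with hbox
  have hmn : ∀ m : Fin (min Nt Nr), (m : ℝ) + 1 ≤ ν := fun m => by
    rw [hν]
    exact_mod_cast m.2
  have hge : ∀ x ∈ box, ∀ m, τ m ≤ x m := fun x hx m => by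
    refine le_trans ?_ (hx.1 m)
    have := hmn m
    have := hτ0 m
    simp only [hlo]
    nlinarith
  have hgap : ∀ x ∈ box, ∀ i j, i < j → τ i ≤ x i - x j := fun x hx i j hij => by
    have h1 := hx.1 i
    have h2 := hx.2 j
    have h3 := hτa i j hij.le
    have h4 := hmn j
    have h5 : (i : ℝ) + 1 ≤ j := by exact_mod_cast hij
    have h6 := hτ0 j
    have h7 := hτ0 i
    have h8 : 2 * (ν - j) * τ j ≤ 2 * (ν - j) * τ i :=
      mul_le_mul_of_nonneg_left h3 (by linarith)
    simp only [hlo, hhi] at h1 h2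
    nlinarith
  have hcone : box ⊆ strictCone (min Nt Nr) := fun x hx =>
    ⟨fun i j hij => by linarith [hgap x hx i j hij, hτ0 i], fun i => (hτ0 i).trans_le (hge x hx i)⟩
  have hexp : ∀ x ∈ box, (∑ m, x m) + ∑ m, t * a m * x m ≤ M := fun x hx => by
    rw [← Finset.sum_add_distrib, hM]
    refine Finset.sum_le_sum fun m _ => ?_
    have h1 : x m ≤ (2 * ν + 2) * τ m := by
      refine (hx.2 m).trans (mul_le_mul_of_nonneg_right ?_ (hτ0 m).le)
      have : (0 : ℝ) ≤ m := Nat.cast_nonneg _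
      linarith
    have hn0 : (0 : ℝ) ≤ ν := hν ▸ Nat.cast_nonneg _
    have h2 : x m ≤ 2 * ν + 2 := h1.trans (mul_le_of_le_one_right (by linarith) (hτ1 m))
    have h3 : t * a m * x m ≤ a m * (2 * ν + 2) := by
      by_cases hm : m < i₀
      · simp [ha0 m hm]
      · have hτm : τ m = t⁻¹ := by
          have : (i₀ : ℕ) ≤ m := not_lt.1 hm
          simp only [hτ, tailWeight, if_pos this, pow_one]
        rw [hτm] at h1
        have h4 : t * x m ≤ 2 * ν + 2 := by
          have := mul_le_mul_of_nonneg_left h1 ht0.le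
          rwa [mul_left_comm, mul_inv_cancel₀ ht0.ne', mul_one] at this
        nlinarith [ha m]
    nlinarith
  set κ : ℝ := (∏ i, ∏ _j ∈ Finset.Ioi i, τ i) ^ 2 * (∏ i, τ i) ^ gap Nt Nr * Real.exp (-M) with hκ
  have hdens : ∀ x ∈ box, κ ≤ svDensity (gap Nt Nr) x * Real.exp (-∑ m, t * a m * x m) := by
    intro x hx
    have h1 : ∏ i, ∏ _j ∈ Finset.Ioi i, τ i ≤ absVand x := by
      rw [absVand_eq]
      refine Finset.prod_le_prod (fun i _ => Finset.prod_nonneg fun j _ => (hτ0 i).le) fun i _ =>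
        Finset.prod_le_prod (fun j _ => (hτ0 i).le) fun j hj => ?_
      rw [abs_sub_comm]
      exact (hgap x hx i j (Finset.mem_Ioi.1 hj)).trans (le_abs_self _)
    have h2 : ∏ i, τ i ≤ ∏ i, x i :=
      Finset.prod_le_prod (fun i _ => (hτ0 i).le) fun i _ => hge x hx i
    have h0 : 0 ≤ ∏ i, ∏ _j ∈ Finset.Ioi i, τ i :=
      Finset.prod_nonneg fun i _ => Finset.prod_nonneg fun j _ => (hτ0 i).le
    have h0' : 0 ≤ ∏ i, τ i := Finset.prod_nonneg fun i _ => (hτ0 i).le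
    rw [svDensity, mul_assoc, ← Real.exp_add, hκ]
    have h3 : Real.exp (-M) ≤ Real.exp (-∑ i, x i + -∑ m, t * a m * x m) := by
      rw [Real.exp_le_exp]
      linarith [hexp x hx]
    have h4 := pow_le_pow_left₀ h0 h1 2
    have h5 := pow_le_pow_left₀ h0' h2 (gap Nt Nr)
    have h6 := mul_le_mul h4 h5 (pow_nonneg h0' _) (sq_nonneg _)
    exact mul_le_mul h6 h3 (Real.exp_pos _).le
      (mul_nonneg (sq_nonneg _) (pow_nonneg (h0'.trans h2) _))
  have hκ0 : 0 ≤ κ := mul_nonneg (mul_nonneg (sq_nonneg _)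
    (pow_nonneg (Finset.prod_nonneg fun i _ => (hτ0 i).le) _)) (Real.exp_pos _).le
  have hvol : volume box = ENNReal.ofReal (∏ i, τ i) := by
    rw [hbox, Real.volume_Icc_pi, ENNReal.ofReal_prod_of_nonneg fun i _ => (hτ0 i).le]
    refine Finset.prod_congr rfl fun i _ => ?_
    congr 1
    simp only [hlo, hhi]
    ring
  have hmeas : MeasurableSet box := measurableSet_Icc
  have hmgf : ENNReal.ofReal ((normC Nt Nr)⁻¹ * (κ * ∏ i, τ i)) ≤
      ENNReal.ofReal (mgfNeg Nt Nr fun m => t * a m) := by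
    rw [ofReal_mgfNeg _ fun m => mul_nonneg ht0.le (ha m), lintegral_lamLaw (by fun_prop),
      ENNReal.ofReal_mul (inv_nonneg.2 normC_pos.le)]
    refine mul_le_mul_right ?_ _
    rw [ENNReal.ofReal_mul hκ0, ← hvol, ← setLIntegral_const]
    refine (setLIntegral_mono' hmeas fun x hx => ?_).trans (lintegral_mono_set hcone)
    rw [← ENNReal.ofReal_mul (svDensity_nonneg fun i => ((hcone hx).2 i).le)]
    exact ENNReal.ofReal_le_ofReal (hdens x hx)
  -- The powers of `t` from the squared Vandermonde factor, from the product of the eigenvalues and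
  -- from the volume of the box add up to the diversity order.
  have hτprod : t ^ diversity Nt Nr i₀ * (κ * ∏ i, τ i) = Real.exp (-M) := by
    have h1 : ∏ i, τ i = (t ^ ∑ i : Fin (min Nt Nr), tailWeight (i₀ : ℕ) i)⁻¹ := by
      simp only [hτ]
      rw [Finset.prod_inv_distrib, Finset.prod_pow_eq_pow_sum]
    have h2 : ∏ i, ∏ _j ∈ Finset.Ioi i, τ i =
        (t ^ ∑ i : Fin (min Nt Nr), ∑ _j ∈ Finset.Ioi i, tailWeight (i₀ : ℕ) i)⁻¹ := by
      simp only [hτ, Finset.prod_inv_distrib, Finset.prod_pow_eq_pow_sum]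
    rw [hκ, h1, h2, diversity, baseDeg, pow_add, pow_add, pow_mul', pow_mul']
    field_simp
    rw [one_div, inv_pow, mul_inv_cancel₀ (by positivity)]
  have hfin : (normC Nt Nr)⁻¹ * (κ * ∏ i, τ i) ≤ mgfNeg Nt Nr fun m => t * a m := by
    by_contra hcon
    push Not at hcon
    have hpos : 0 < (normC Nt Nr)⁻¹ * (κ * ∏ i, τ i) := by
      refine mul_pos (inv_pos.2 normC_pos) ?_
      have : 0 < t ^ diversity Nt Nr i₀ * (κ * ∏ i, τ i) := hτprod ▸ Real.exp_pos _
      exact pos_of_mul_pos_right this (pow_pos ht0 _).le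
    exact absurd hmgf (not_le.2 ((ENNReal.ofReal_lt_ofReal_iff hpos).2 hcon))
  calc (normC Nt Nr)⁻¹ * Real.exp (-M)
      = t ^ diversity Nt Nr i₀ * ((normC Nt Nr)⁻¹ * (κ * ∏ i, τ i)) := by
        rw [← hτprod]; ring
    _ ≤ _ := mul_le_mul_of_nonneg_left hfin (pow_pos ht0 _).le

lemma eigPoly_ne_zero : eigPoly Nt Nr ≠ 0 := by
  refine mul_ne_zero (Finset.prod_ne_zero_iff.2 fun m _ => pow_ne_zero _ (MvPolynomial.X_ne_zero m))
    (Finset.prod_ne_zero_iff.2 fun m _ => Finset.prod_ne_zero_iff.2 fun m' hm' => pow_ne_zero _ ?_)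
  exact sub_ne_zero.2 fun h => (Finset.mem_filter.1 hm').2.ne' (MvPolynomial.X_injective h)

/-- The moment generating function and its approximation along a ray. -/
theorem exists_tendsto_mgfNeg (i₀ : Fin (min Nt Nr)) {a : Fin (min Nt Nr) → ℝ}
    (ha : ∀ m, 0 ≤ a m) (ha0 : ∀ m < i₀, a m = 0) (hpos : 0 < a i₀) :
    ∃ c : ℝ, 0 < c ∧
      Tendsto (fun t : ℝ => t ^ diversity Nt Nr i₀ * mgfNeg Nt Nr (fun m => t * a m))
        atTop (nhds c) ∧
      Tendsto (fun t : ℝ => t ^ diversity Nt Nr i₀ * asymSum Nt Nr i₀ (fun m => t * a m))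
        atTop (nhds c) := by
  have hn : 0 < min Nt Nr := i₀.pos
  have hat : ∀ t : ℝ, at1 (fun m => t * a m) = fun j => t * at1 a j := fun t => by
    funext j
    unfold at1
    split_ifs <;> simp
  have hmono : ∀ p : Fin (min Nt Nr) →₀ ℕ, ∃ c : ℝ,
      Tendsto (fun t : ℝ => t ^ expAbove (min Nt Nr) (at1 p) i₀ *
        coneVal (fun j => 1 + t * at1 a j) (at1 p) (min Nt Nr - 1) 1 (1 + t * at1 a 1) (at1 p 1))
        atTop (nhds c) ∧
      Tendsto (fun t : ℝ => t ^ expAbove (min Nt Nr) (at1 p) i₀ *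
        monomialTerm (min Nt Nr) i₀ (fun j => t * at1 a j) (at1 p)) atTop (nhds c) := fun p => by
    refine exists_tendsto_monomialTerm (fun j h1 h2 => ?_) (at1_nonneg ha) ?_ i₀.2 (at1 p)
    · rw [at1, dif_pos ⟨h1, by omega⟩]
      exact ha0 _ (by rw [Fin.lt_def]; simp; omega)
    · rw [at1, dif_pos ⟨by omega, i₀.2⟩]
      exact hpos
  choose c hc1 hc2 using hmono
  obtain ⟨p₀, hp₀⟩ : (minMonomials Nt Nr i₀).Nonempty := by
    obtain ⟨p, hp, hmin⟩ := Finset.exists_min_image (eigPoly Nt Nr).support (tailDeg i₀)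
      (MvPolynomial.support_nonempty.2 eigPoly_ne_zero)
    exact ⟨p, Finset.mem_filter.2 ⟨hp, hmin⟩⟩
  obtain ⟨hp₀s, hp₀min⟩ := Finset.mem_filter.1 hp₀
  set K : ℕ := expAbove (min Nt Nr) (at1 p₀) i₀ with hK
  have hKp : ∀ p : Fin (min Nt Nr) →₀ ℕ,
      expAbove (min Nt Nr) (at1 p) i₀ = tailDeg i₀ p + (min Nt Nr - i₀) := fun p => rfl
  set C : ℝ := 1 / normC Nt Nr * ∑ p ∈ minMonomials Nt Nr i₀,
    MvPolynomial.coeff p (eigPoly Nt Nr) * c p with hC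
  have hKmin : ∀ p ∈ minMonomials Nt Nr i₀, expAbove (min Nt Nr) (at1 p) i₀ = K := fun p hp => by
    obtain ⟨h1, h2⟩ := Finset.mem_filter.1 hp
    rw [hK, hKp, hKp, le_antisymm (h2 p₀ hp₀s) (hp₀min p h1)]
  have hasym : Tendsto (fun t : ℝ => t ^ K * asymSum Nt Nr i₀ (fun m => t * a m))
      atTop (nhds C) := by
    have h := (tendsto_finsetSum (minMonomials Nt Nr i₀) fun p _ =>
      (hc2 p).const_mul (MvPolynomial.coeff p (eigPoly Nt Nr))).const_mul (1 / normC Nt Nr)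
    refine h.congr fun t => ?_
    rw [asymSum, mul_left_comm, hat, Finset.mul_sum _ _ (t ^ K)]
    congr 1
    refine Finset.sum_congr rfl fun p hp => ?_
    rw [hKmin p hp]
    ring
  have hmgf : Tendsto (fun t : ℝ => t ^ K * mgfNeg Nt Nr (fun m => t * a m)) atTop (nhds C) := by
    -- Monomials of larger trailing degree carry additional powers of `1 / t` and vanish in the
    -- limit.
    have hterm : ∀ p ∈ (eigPoly Nt Nr).support, Tendsto (fun t : ℝ => t ^ K *
        coneVal (fun j => 1 + t * at1 a j) (at1 p) (min Nt Nr - 1) 1 (1 + t * at1 a 1) (at1 p 1))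
        atTop (nhds (if p ∈ minMonomials Nt Nr i₀ then c p else 0)) := by
      intro p hp
      split_ifs with h
      · rw [← hKmin p h]
        exact hc1 p
      · have hlt : tailDeg i₀ p₀ < tailDeg i₀ p := by
          by_contra hcon
          exact h (Finset.mem_filter.2 ⟨hp, fun q hq => (not_lt.1 hcon).trans (hp₀min q hq)⟩)
        obtain ⟨k, hk⟩ := Nat.exists_eq_add_of_lt hlt
        have h0 : Tendsto (fun t : ℝ => (t⁻¹) ^ (k + 1)) atTop (nhds 0) := by
          have := (tendsto_inv_atTop_zero (𝕜 := ℝ)).pow (k + 1)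
          rwa [zero_pow (Nat.succ_ne_zero k)] at this
        have h1 := h0.mul (hc1 p)
        rw [zero_mul] at h1
        refine h1.congr' ?_
        filter_upwards [eventually_gt_atTop 0] with t ht
        rw [show expAbove (min Nt Nr) (at1 p) i₀ = K + (k + 1) by
          rw [hK, hKp, hKp, hk]; ring, pow_add, inv_pow]
        field_simp
        ring
    have h := (tendsto_finsetSum (eigPoly Nt Nr).support fun p hp =>
      (hterm p hp).const_mul (MvPolynomial.coeff p (eigPoly Nt Nr))).const_mul (1 / normC Nt Nr)
    have hlim : 1 / normC Nt Nr * ∑ p ∈ (eigPoly Nt Nr).support,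
        MvPolynomial.coeff p (eigPoly Nt Nr) *
          (if p ∈ minMonomials Nt Nr i₀ then c p else 0) = C := by
      rw [hC]
      congr 1
      symm
      rw [minMonomials, Finset.sum_filter]
      refine Finset.sum_congr rfl fun p hp => ?_
      simp only [Finset.mem_filter, hp, true_and, mul_ite, mul_zero]
    rw [hlim] at h
    refine h.congr' ?_
    filter_upwards [eventually_ge_atTop 0] with t ht
    rw [mgfNeg_eq hn fun m => mul_nonneg ht (ha m), mul_left_comm, hat,
      Finset.mul_sum _ _ (t ^ K)]
    congr 1
    refine Finset.sum_congr rfl fun p _ => by ring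
  -- The coefficients have both signs, so positivity of `C` is not visible from the sum. Degrees
  -- give `diversity ≤ K`; strict inequality would make `t ^ K * mgfNeg` unbounded by the lower
  -- bound, and under equality this bound gives `C ≥ δ`.
  obtain ⟨δ, hδ, hlow⟩ := exists_le_mgfNeg i₀ ha ha0
  have hKK : K = diversity Nt Nr i₀ := by
    have hle : diversity Nt Nr i₀ ≤ K := by
      rw [hK, hKp, diversity, sum_tailWeight i₀.2.le]
      exact Nat.add_le_add_right (baseDeg_le_tailDeg _ hp₀s) _
    refine le_antisymm ?_ hle
    by_contra hcon
    obtain ⟨k, hk⟩ := Nat.exists_eq_add_of_lt (not_le.1 hcon)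
    have h1 : Tendsto (fun t : ℝ => t ^ (k + 1) * δ) atTop atTop :=
      (tendsto_pow_atTop (Nat.succ_ne_zero k)).atTop_mul_const hδ
    refine not_tendsto_nhds_of_tendsto_atTop (tendsto_atTop_mono' _ ?_ h1) C hmgf
    filter_upwards [eventually_ge_atTop 1] with t ht
    rw [hk, add_assoc, pow_add t (diversity Nt Nr i₀), mul_comm (t ^ diversity Nt Nr i₀), mul_assoc]
    exact mul_le_mul_of_nonneg_left (hlow t ht) (by positivity)
  rw [← hKK] at hlow ⊢
  refine ⟨C, hδ.trans_le (ge_of_tendsto hmgf ?_), hmgf, hasym⟩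
  filter_upwards [eventually_ge_atTop 1] with t ht using hlow t ht

end MgfLimit

end SLMIMO
namespace SLMIMO

/-! ### The Gaussian tail -/

section GaussianTail

/-- The mixing density of the Gaussian tail. -/
noncomputable def tailKernel (u : ℝ) : ℝ := 1 / (2 * Real.pi * (1 + u) * √u)

lemma tailKernel_nonneg {u : ℝ} (hu : 0 ≤ u) : 0 ≤ tailKernel u := by
  unfold tailKernel
  positivity

lemma measurable_tailKernel : Measurable tailKernel := by
  unfold tailKernel
  fun_prop

/-- `P(N(0,v) ≥ s)` as a function of `y = s² / (2 v)`. -/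
noncomputable def gaussTail (y : ℝ) : ℝ≥0∞ :=
  ∫⁻ u in Set.Ioi 0, ENNReal.ofReal (tailKernel u * Real.exp (-((1 + u) * y)))

lemma measurable_gaussTail : Measurable gaussTail := by
  have : Measurable fun p : ℝ × ℝ => ENNReal.ofReal (tailKernel p.2 * Real.exp (-((1 + p.2) * p.1))) := by
    have := measurable_tailKernel
    fun_prop
  exact this.lintegral_prod_right'

lemma lintegral_Ioi_rpow_mul_exp {a r : ℝ} (ha : 0 < a) (hr : 0 < r) :
    ∫⁻ u in Set.Ioi 0, ENNReal.ofReal (u ^ (a - 1) * Real.exp (-(r * u))) =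
      ENNReal.ofReal ((1 / r) ^ a * Real.Gamma a) := by
  have h := Real.integral_rpow_mul_exp_neg_mul_Ioi ha hr
  have hpos : 0 < (1 / r) ^ a * Real.Gamma a :=
    mul_pos (Real.rpow_pos_of_pos (by positivity) _) (Real.Gamma_pos_of_pos ha)
  have hint : Integrable (fun u : ℝ => u ^ (a - 1) * Real.exp (-(r * u)))
      (volume.restrict (Set.Ioi 0)) := by
    -- Without integrability the integral would be zero by convention, against its positive value.
    by_contra hcon
    rw [integral_undef hcon] at h
    exact hpos.ne h
  rw [← h, ofReal_integral_eq_lintegral_ofReal hint]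
  exact (ae_restrict_iff' measurableSet_Ioi).2 (Filter.Eventually.of_forall fun u hu =>
    mul_nonneg (Real.rpow_nonneg (le_of_lt hu) _) (Real.exp_pos _).le)

lemma lintegral_Ioi_exp_div_sqrt {r : ℝ} (hr : 0 < r) :
    ∫⁻ u in Set.Ioi 0, ENNReal.ofReal (Real.exp (-(r * u)) / √u) =
      ENNReal.ofReal (√Real.pi / √r) := by
  have h := lintegral_Ioi_rpow_mul_exp (a := 1 / 2) one_half_pos hr
  rw [Real.Gamma_one_half_eq, ← Real.sqrt_eq_rpow, Real.sqrt_div zero_le_one, Real.sqrt_one,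
    one_div_mul_eq_div] at h
  rw [← h]
  refine setLIntegral_congr_fun measurableSet_Ioi fun u hu => ?_
  have hu' : (0 : ℝ) < u := hu
  rw [show (1 / 2 - 1 : ℝ) = -(1 / 2) by norm_num, Real.rpow_neg hu'.le, ← Real.sqrt_eq_rpow]
  congr 1
  rw [div_eq_inv_mul]

lemma lintegral_Ioi_mul_exp_sq {s v b : ℝ} (hs : 0 < s) (hv : 0 < v) (hb : 0 < b) :
    ∫⁻ x in Set.Ioi s, ENNReal.ofReal (x / v * Real.exp (-(b * (x ^ 2 / (2 * v))))) =
      ENNReal.ofReal (Real.exp (-(b * (s ^ 2 / (2 * v)))) / b) := by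
  have hd : ∀ x ∈ Set.Ici s, HasDerivAt (fun x => -(Real.exp (-(b * (x ^ 2 / (2 * v)))) / b))
      (x / v * Real.exp (-(b * (x ^ 2 / (2 * v))))) x := fun x _ => by
    have h := ((((((hasDerivAt_id x).pow 2).div_const (2 * v)).const_mul b).neg).exp.div_const b).neg
    refine h.congr_deriv ?_
    simp
    field_simp
  have hnn : ∀ x ∈ Set.Ioi s, 0 ≤ x / v * Real.exp (-(b * (x ^ 2 / (2 * v)))) := fun x hx => by
    have : 0 < x := hs.trans hx
    positivity
  have hlim : Tendsto (fun x : ℝ => -(Real.exp (-(b * (x ^ 2 / (2 * v)))) / b)) atTop (nhds 0) := by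
    have h1 : Tendsto (fun x : ℝ => b * (x ^ 2 / (2 * v))) atTop atTop :=
      Tendsto.const_mul_atTop hb ((tendsto_pow_atTop two_ne_zero).atTop_div_const (by positivity))
    have h2 := ((Real.tendsto_exp_neg_atTop_nhds_zero.comp h1).div_const b).neg
    simpa using h2
  have hint := integrableOn_Ioi_deriv_of_nonneg' hd hnn hlim
  rw [← ofReal_integral_eq_lintegral_ofReal hint
    ((ae_restrict_iff' measurableSet_Ioi).2 (Filter.Eventually.of_forall hnn)),
    integral_Ioi_of_hasDerivAt_of_nonneg' hd hnn hlim, zero_sub, neg_neg]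

/-- The factor `exp (-(1 + u) y) / (1 + u)` is the integral of `(x / v) exp (-(1 + u) x² / (2 v))`
over `x > s`. After exchanging the integrals, the integral of `exp (-u x² / (2 v)) / √u` in `u` is
proportional to `1 / x`, which cancels the factor `x` and leaves the Gaussian density. -/
lemma gaussianReal_Ioi {s : ℝ} (hs : 0 < s) {v : ℝ≥0} (hv : 0 < v) :
    gaussianReal 0 v (Set.Ioi s) = gaussTail (s ^ 2 / (2 * v)) := by
  have hv' : (0 : ℝ) < v := hv
  have h1 : gaussTail (s ^ 2 / (2 * v)) = ∫⁻ u in Set.Ioi 0, ∫⁻ x in Set.Ioi s,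
      ENNReal.ofReal (1 / (2 * Real.pi * √u) *
        (x / v * Real.exp (-((1 + u) * (x ^ 2 / (2 * v)))))) := by
    refine setLIntegral_congr_fun measurableSet_Ioi fun u hu => ?_
    have hu' : (0 : ℝ) < u := hu
    have h0 : 0 ≤ 1 / (2 * Real.pi * √u) := by positivity
    simp only [ENNReal.ofReal_mul h0]
    rw [lintegral_const_mul' _ _ ENNReal.ofReal_ne_top,
      lintegral_Ioi_mul_exp_sq hs hv' (by positivity : (0 : ℝ) < 1 + u), ← ENNReal.ofReal_mul h0,
      tailKernel]
    congr 1
    field_simp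
  rw [gaussianReal_apply _ hv.ne', h1, lintegral_lintegral_swap (by fun_prop)]
  refine setLIntegral_congr_fun measurableSet_Ioi fun x hx => ?_
  have hx' : 0 < x := hs.trans hx
  have h2 : ∀ u : ℝ, ENNReal.ofReal (1 / (2 * Real.pi * √u) *
        (x / v * Real.exp (-((1 + u) * (x ^ 2 / (2 * v)))))) =
      ENNReal.ofReal (1 / (2 * Real.pi) * (x / v * Real.exp (-(x ^ 2 / (2 * v))))) *
        ENNReal.ofReal (Real.exp (-(x ^ 2 / (2 * v) * u)) / √u) := fun u => by
    rw [← ENNReal.ofReal_mul (by positivity)]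
    congr 1
    rw [show -((1 + u) * (x ^ 2 / (2 * (v : ℝ)))) =
      -(x ^ 2 / (2 * v)) + -(x ^ 2 / (2 * v) * u) by ring, Real.exp_add]
    field_simp
  simp only [h2]
  rw [lintegral_const_mul' _ _ ENNReal.ofReal_ne_top,
    lintegral_Ioi_exp_div_sqrt (by positivity), ← ENNReal.ofReal_mul (by positivity), gaussianPDF,
    gaussianPDFReal]
  congr 1
  rw [Real.sqrt_div (sq_nonneg x), Real.sqrt_sq hx'.le, sub_zero, neg_div,
    show 2 * Real.pi * (v : ℝ) = Real.pi * (2 * v) by ring, Real.sqrt_mul Real.pi_pos.le]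
  have hp := Real.mul_self_sqrt Real.pi_pos.le
  have hv2 := Real.mul_self_sqrt (by positivity : (0 : ℝ) ≤ 2 * v)
  have hp0 : 0 < √Real.pi := Real.sqrt_pos.2 Real.pi_pos
  have hv0 : 0 < √(2 * (v : ℝ)) := Real.sqrt_pos.2 (by positivity)
  field_simp
  nlinarith

lemma gaussianReal_Ici {s : ℝ} (hs : 0 < s) {v : ℝ≥0} (hv : 0 < v) :
    gaussianReal 0 v (Set.Ici s) = gaussTail (s ^ 2 / (2 * v)) := by
  have := nullSingletonClass_gaussianReal (μ := 0) hv.ne'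
  rw [← gaussianReal_Ioi hs hv]
  exact measure_congr Ioi_ae_eq_Ici.symm

/-- `(2π)⁻¹ ∫ (1 + u)^{-K-1} u^{-1/2} du`. -/
noncomputable def tailMoment (K : ℕ) : ℝ :=
  Real.Gamma (K + 1 / 2) / (2 * √Real.pi * K.factorial)

/-- The power `(1 + u) ^ (-(K + 1))` is written as a gamma integral in `y`. After the exchange the
`u`-integral gives `√(π / y)`, and the rest is `Γ (K + 1 / 2)`. -/
lemma lintegral_tailKernel (K : ℕ) :
    ∫⁻ u in Set.Ioi 0, ENNReal.ofReal (tailKernel u * ((1 + u) ^ K)⁻¹) =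
      ENNReal.ofReal (tailMoment K) := by
  have h1 : ∫⁻ u in Set.Ioi 0, ENNReal.ofReal (tailKernel u * ((1 + u) ^ K)⁻¹) =
      ∫⁻ u in Set.Ioi (0 : ℝ), ∫⁻ y in Set.Ioi (0 : ℝ),
        ENNReal.ofReal (1 / (2 * Real.pi * √u * K.factorial) *
          (y ^ (((K : ℝ) + 1) - 1) * Real.exp (-((1 + u) * y)))) := by
    refine setLIntegral_congr_fun measurableSet_Ioi fun u hu => ?_
    have hu' : (0 : ℝ) < u := hu
    have h0 : 0 ≤ 1 / (2 * Real.pi * √u * K.factorial) := by positivity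
    simp only [ENNReal.ofReal_mul h0]
    rw [lintegral_const_mul' _ _ ENNReal.ofReal_ne_top,
      lintegral_Ioi_rpow_mul_exp (by positivity) (by positivity), ← ENNReal.ofReal_mul h0,
      Real.Gamma_nat_eq_factorial, tailKernel]
    congr 1
    rw [show ((K : ℝ) + 1) = ((K + 1 : ℕ) : ℝ) by push_cast; ring, Real.rpow_natCast,
      one_div_pow]
    field_simp
    rw [pow_succ']
  rw [h1, lintegral_lintegral_swap (by fun_prop)]
  have h2 : ∀ y ∈ Set.Ioi (0 : ℝ), ∫⁻ u in Set.Ioi (0 : ℝ),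
        ENNReal.ofReal (1 / (2 * Real.pi * √u * K.factorial) *
          (y ^ (((K : ℝ) + 1) - 1) * Real.exp (-((1 + u) * y)))) =
      ENNReal.ofReal (1 / (2 * √Real.pi * K.factorial)) *
        ENNReal.ofReal (y ^ (((K : ℝ) + 1 / 2) - 1) * Real.exp (-(1 * y))) := by
    intro y hy
    have hy' : (0 : ℝ) < y := hy
    have h3 : ∀ u : ℝ, ENNReal.ofReal (1 / (2 * Real.pi * √u * K.factorial) *
          (y ^ (((K : ℝ) + 1) - 1) * Real.exp (-((1 + u) * y)))) =
        ENNReal.ofReal (1 / (2 * Real.pi * K.factorial) *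
          (y ^ (((K : ℝ) + 1) - 1) * Real.exp (-y))) *
          ENNReal.ofReal (Real.exp (-(y * u)) / √u) := fun u => by
      rw [← ENNReal.ofReal_mul (by positivity)]
      congr 1
      rw [show -((1 + u) * y) = -y + -(y * u) by ring, Real.exp_add]
      field_simp
    simp only [h3]
    rw [lintegral_const_mul' _ _ ENNReal.ofReal_ne_top, lintegral_Ioi_exp_div_sqrt hy',
      ← ENNReal.ofReal_mul (by positivity), ← ENNReal.ofReal_mul (by positivity)]
    congr 1
    rw [show ((K : ℝ) + 1) - 1 = (K + 1 / 2 - 1) + 1 / 2 by ring, Real.rpow_add hy',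
      ← Real.sqrt_eq_rpow, one_mul]
    have hp := Real.mul_self_sqrt Real.pi_pos.le
    have hp0 : 0 < √Real.pi := Real.sqrt_pos.2 Real.pi_pos
    have hy0 : 0 < √y := Real.sqrt_pos.2 hy'
    field_simp
    nlinarith
  rw [setLIntegral_congr_fun measurableSet_Ioi h2, lintegral_const_mul' _ _ ENNReal.ofReal_ne_top,
    lintegral_Ioi_rpow_mul_exp (by positivity) one_pos, ← ENNReal.ofReal_mul (by positivity),
    tailMoment]
  congr 1
  simp
  ring

lemma tailMoment_pos (K : ℕ) : 0 < tailMoment K := by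
  have : 0 < Real.Gamma ((K : ℝ) + 1 / 2) := Real.Gamma_pos_of_pos (by positivity)
  unfold tailMoment
  have := Real.pi_pos
  positivity

lemma tailMoment_succ (K : ℕ) : tailMoment (K + 1) = tailMoment K * ((2 * K + 1) / (2 * K + 2)) := by
  have hp0 : 0 < √Real.pi := Real.sqrt_pos.2 Real.pi_pos
  rw [tailMoment, tailMoment, show ((K + 1 : ℕ) : ℝ) + 1 / 2 = (K + 1 / 2) + 1 by push_cast; ring,
    Real.Gamma_add_one (by positivity), Nat.factorial_succ]
  push_cast
  field_simp

lemma tailMoment_zero : tailMoment 0 = 1 / 2 := by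
  have hp0 : 0 < √Real.pi := Real.sqrt_pos.2 Real.pi_pos
  rw [tailMoment]
  simp only [Nat.cast_zero, zero_add, Real.Gamma_one_half_eq, Nat.factorial_zero, Nat.cast_one]
  field_simp

/-- `tailMoment` is decreasing and is below `1 / 12` from index twelve on, so only finitely many
cases remain to be computed. At `K = 0` the inequality fails: `1 / 2` against `1 / 3`. -/
lemma tailMoment_lt {K : ℕ} (hK : 1 ≤ K) : tailMoment K < 1 / 12 + 1 / 4 * (3 / 4) ^ K := by
  have h12 : tailMoment 12 < 1 / 12 := by
    norm_num [tailMoment_succ, tailMoment_zero]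
  rcases le_total 12 K with h | h
  · have h1 : tailMoment K ≤ tailMoment 12 := by
      induction K, h using Nat.le_induction with
      | base => exact le_rfl
      | succ K hK ih =>
        rw [tailMoment_succ]
        refine (mul_le_of_le_one_right (tailMoment_pos K).le ?_).trans (ih (by omega))
        rw [div_le_one (by positivity)]
        linarith
    have : (0 : ℝ) < 1 / 4 * (3 / 4) ^ K := by positivity
    linarith
  · interval_cases K <;> norm_num [tailMoment_succ, tailMoment_zero]

end GaussianTail

end SLMIMO
namespace SLMIMO

/-! ### Pairwise error averaged over the channel. -/

section PairError

variable {Nt Nr : ℕ}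

/-- Since `(1 + u) t ≥ t`, the bounds `(c ± ε) / s ^ K` for `φ s` hold at `s = (1 + u) t` for all `u
> 0` at once as soon as `t ≥ t₀`. Integrating them against the kernel produces `tailMoment K`. -/
lemma tendsto_lintegral_tailKernel {φ : ℝ → ℝ} {K : ℕ} {c : ℝ} (hc : 0 < c)
    (h : Tendsto (fun s => s ^ K * φ s) atTop (nhds c)) :
    Tendsto (fun t => t ^ K *
      (∫⁻ u in Set.Ioi 0, ENNReal.ofReal (tailKernel u * φ ((1 + u) * t))).toReal) atTop
        (nhds (c * tailMoment K)) := by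
  have hw := tailMoment_pos K
  have key : ∀ ε, 0 < ε → ε < c → ∀ᶠ t in atTop,
      (c - ε) * tailMoment K ≤ t ^ K *
        (∫⁻ u in Set.Ioi 0, ENNReal.ofReal (tailKernel u * φ ((1 + u) * t))).toReal ∧
      t ^ K * (∫⁻ u in Set.Ioi 0, ENNReal.ofReal (tailKernel u * φ ((1 + u) * t))).toReal ≤
        (c + ε) * tailMoment K := by
    intro ε hε hεc
    obtain ⟨t₀, ht₀⟩ := eventually_atTop.1 (Metric.tendsto_nhds.1 h ε hε)
    filter_upwards [eventually_ge_atTop t₀, eventually_gt_atTop 0] with t ht ht0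
    set I := ∫⁻ u in Set.Ioi 0, ENNReal.ofReal (tailKernel u * φ ((1 + u) * t)) with hI
    have hconst : ∀ b : ℝ, 0 ≤ b → ∫⁻ u in Set.Ioi 0, ENNReal.ofReal
        (b / t ^ K * (tailKernel u * ((1 + u) ^ K)⁻¹)) = ENNReal.ofReal (b / t ^ K * tailMoment K) := by
      intro b hb
      have h0 : 0 ≤ b / t ^ K := by positivity
      simp only [ENNReal.ofReal_mul h0]
      rw [lintegral_const_mul' _ _ ENNReal.ofReal_ne_top, lintegral_tailKernel]
    have hφ : ∀ u : ℝ, 0 < u → (c - ε) / t ^ K * ((1 + u) ^ K)⁻¹ ≤ φ ((1 + u) * t) ∧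
        φ ((1 + u) * t) ≤ (c + ε) / t ^ K * ((1 + u) ^ K)⁻¹ := by
      intro u hu
      have hs : t₀ ≤ (1 + u) * t := by nlinarith
      have h1 := ht₀ _ hs
      rw [Real.dist_eq, abs_lt] at h1
      have hpos : 0 < ((1 + u) * t) ^ K := by positivity
      have h2 : ∀ b : ℝ, b / t ^ K * ((1 + u) ^ K)⁻¹ = b / ((1 + u) * t) ^ K := fun b => by
        rw [mul_pow]
        field_simp
      rw [h2, h2, div_le_iff₀ hpos, le_div_iff₀ hpos]
      constructor <;> linarith
    have hup : I ≤ ENNReal.ofReal ((c + ε) / t ^ K * tailMoment K) := by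
      rw [← hconst _ (by linarith)]
      refine setLIntegral_mono' measurableSet_Ioi fun u hu => ENNReal.ofReal_le_ofReal ?_
      rw [mul_left_comm]
      exact mul_le_mul_of_nonneg_left (hφ u hu).2 (tailKernel_nonneg (le_of_lt hu))
    have hlo : ENNReal.ofReal ((c - ε) / t ^ K * tailMoment K) ≤ I := by
      rw [← hconst _ (by linarith)]
      refine setLIntegral_mono' measurableSet_Ioi fun u hu => ENNReal.ofReal_le_ofReal ?_
      rw [mul_left_comm]
      exact mul_le_mul_of_nonneg_left (hφ u hu).1 (tailKernel_nonneg (le_of_lt hu))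
    have hfin : I ≠ ∞ := (hup.trans_lt ENNReal.ofReal_lt_top).ne
    have hb1 : 0 ≤ (c + ε) / t ^ K * tailMoment K :=
      mul_nonneg (div_nonneg (by linarith) (pow_pos ht0 _).le) hw.le
    have h1 := ENNReal.toReal_le_of_le_ofReal hb1 hup
    have h2 := (ENNReal.ofReal_le_iff_le_toReal hfin).1 hlo
    have hpos : 0 < t ^ K := pow_pos ht0 _
    constructor
    · have := mul_le_mul_of_nonneg_left h2 hpos.le
      refine le_trans (le_of_eq ?_) this
      field_simp
    · have := mul_le_mul_of_nonneg_left h1 hpos.le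
      refine this.trans (le_of_eq ?_)
      field_simp
  rw [Metric.tendsto_nhds]
  intro ε hε
  have hmin : 0 < min (c / 2) (ε / (2 * tailMoment K)) := lt_min (by positivity) (by positivity)
  filter_upwards [key _ hmin (by linarith [min_le_left (c / 2) (ε / (2 * tailMoment K))])]
    with t ht
  have h3 : min (c / 2) (ε / (2 * tailMoment K)) * tailMoment K < ε := by
    have h4 := mul_le_mul_of_nonneg_right (min_le_right (c / 2) (ε / (2 * tailMoment K))) hw.le
    have h5 : ε / (2 * tailMoment K) * tailMoment K = ε / 2 := by field_simp
    linarith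
  rw [Real.dist_eq, abs_lt]
  constructor
  · linarith [ht.1]
  · linarith [ht.2]

/-- The error probability between two messages, averaged over the channel. -/
noncomputable def pairError (Nt Nr : ℕ) (a : Fin (min Nt Nr) → ℝ) : ℝ≥0∞ :=
  ∫⁻ x, gaussTail (∑ m, a m * x m) ∂lamLaw Nt Nr

lemma pairError_eq {a : Fin (min Nt Nr) → ℝ} (ha : ∀ m, 0 ≤ a m) :
    pairError Nt Nr a = ∫⁻ u in Set.Ioi 0,
      ENNReal.ofReal (tailKernel u * mgfNeg Nt Nr (fun m => (1 + u) * a m)) := by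
  have hm : Measurable fun p : (Fin (min Nt Nr) → ℝ) × ℝ =>
      ENNReal.ofReal (tailKernel p.2 * Real.exp (-((1 + p.2) * ∑ m, a m * p.1 m))) := by
    have := measurable_tailKernel
    fun_prop
  unfold pairError gaussTail
  rw [lintegral_lintegral_swap hm.aemeasurable]
  refine setLIntegral_congr_fun measurableSet_Ioi fun u hu => ?_
  have hu' : (0 : ℝ) < u := hu
  simp only [ENNReal.ofReal_mul (tailKernel_nonneg hu'.le)]
  rw [lintegral_const_mul' _ _ ENNReal.ofReal_ne_top,
    ofReal_mgfNeg _ fun m => mul_nonneg (by positivity) (ha m)]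
  simp only [Finset.mul_sum, mul_assoc]

lemma tendsto_pairError (i₀ : Fin (min Nt Nr)) {a : Fin (min Nt Nr) → ℝ} (ha : ∀ m, 0 ≤ a m)
    {c : ℝ} (hc : 0 < c)
    (h : Tendsto (fun t : ℝ => t ^ diversity Nt Nr i₀ * mgfNeg Nt Nr (fun m => t * a m))
      atTop (nhds c)) :
    Tendsto (fun t : ℝ => t ^ diversity Nt Nr i₀ * (pairError Nt Nr (fun m => t * a m)).toReal)
      atTop (nhds (c * tailMoment (diversity Nt Nr i₀))) := by
  refine (tendsto_lintegral_tailKernel hc h).congr' ?_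
  filter_upwards [eventually_ge_atTop 0] with t ht
  rw [pairError_eq fun m => mul_nonneg ht (ha m)]
  simp only [mul_assoc]

lemma pairError_ne_top (a : Fin (min Nt Nr) → ℝ) (ha : ∀ m, 0 ≤ a m) : pairError Nt Nr a ≠ ∞ := by
  have h1 : ∀ y : ℝ, 0 ≤ y → gaussTail y ≤ ENNReal.ofReal (tailMoment 0) := fun y hy => by
    rw [← lintegral_tailKernel]
    refine setLIntegral_mono' measurableSet_Ioi fun u hu => ENNReal.ofReal_le_ofReal ?_
    have hu' : (0 : ℝ) < u := hu
    refine mul_le_mul_of_nonneg_left ?_ (tailKernel_nonneg hu'.le)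
    rw [pow_zero, inv_one, Real.exp_le_one_iff, neg_nonpos]
    positivity
  refine ne_top_of_le_ne_top (ENNReal.ofReal_ne_top (r := tailMoment 0))
    ((lintegral_mono_ae (g := fun _ => ENNReal.ofReal (tailMoment 0)) ?_).trans (by simp))
  filter_upwards [ae_lamLaw_mem] with x hx
  exact h1 _ (Finset.sum_nonneg fun m _ => mul_nonneg (ha m) (hx.2 m))

end PairError

end SLMIMO
namespace SLMIMO

/-! ### Error events of the maximum likelihood detector -/

section ErrorEvents

variable {n L M Nt Nr : ℕ}

lemma SVD.conjTranspose_Ubar_mul {H : Matrix (Fin Nr) (Fin Nt) ℂ} (D : SVD H) :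
    D.Ubarᴴ * D.Ubar = 1 := by
  have h : D.Uᴴ * D.U = 1 := Matrix.mem_unitaryGroup_iff'.1 D.U_mem
  ext i j
  have := congrFun (congrFun h (Fin.castLE (min_le_right Nt Nr) i))
    (Fin.castLE (min_le_right Nt Nr) j)
  simp only [Matrix.mul_apply, Matrix.conjTranspose_apply] at this
  simp only [SVD.Ubar, Matrix.mul_apply, Matrix.conjTranspose_apply, Matrix.submatrix_apply, id,
    this, Matrix.one_apply, Fin.castLE_inj]

lemma SVD.conjTranspose_Ubar_mul_mul_Vbar {H : Matrix (Fin Nr) (Fin Nt) ℂ} (D : SVD H) :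
    D.Ubarᴴ * H * D.Vbar = Matrix.diagonal fun m => ((√(D.lam m) : ℝ) : ℂ) := by
  have hU : D.Uᴴ * D.U = 1 := Matrix.mem_unitaryGroup_iff'.1 D.U_mem
  have hV : D.Vᴴ * D.V = 1 := Matrix.mem_unitaryGroup_iff'.1 D.V_mem
  have h : D.Uᴴ * H * D.V = sigmaMat D.lam := by
    calc D.Uᴴ * H * D.V = D.Uᴴ * (D.U * sigmaMat D.lam * D.Vᴴ) * D.V :=
          congrArg (fun A => D.Uᴴ * A * D.V) D.eq
      _ = (D.Uᴴ * D.U) * sigmaMat D.lam * (D.Vᴴ * D.V) := by simp only [Matrix.mul_assoc]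
      _ = _ := by rw [hU, hV, Matrix.one_mul, Matrix.mul_one]
  ext i j
  have := congrFun (congrFun h (Fin.castLE (min_le_right Nt Nr) i))
    (Fin.castLE (min_le_left Nt Nr) j)
  simp only [Matrix.mul_apply, Matrix.conjTranspose_apply] at this
  simp only [SVD.Ubar, SVD.Vbar, Matrix.mul_apply, Matrix.conjTranspose_apply,
    Matrix.submatrix_apply, id, this, sigmaMat, Matrix.of_apply, Matrix.diagonal_apply]
  by_cases hij : i = j
  · subst hij
    simp
  · have : (i : ℕ) ≠ j := fun h => hij (Fin.ext h)
    simp [hij, this]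

lemma SVD.received_eq {H : Matrix (Fin Nr) (Fin Nt) ℂ} (D : SVD H)
    (s : Fin (min Nt Nr) → ℂ) (ν : Fin Nr → ℂ) :
    D.received s ν = (fun m => ((√(D.lam m) : ℝ) : ℂ) * s m) + D.Ubarᴴ *ᵥ ν := by
  rw [SVD.received, Matrix.mulVec_add, Matrix.mulVec_mulVec, Matrix.mulVec_mulVec,
    D.conjTranspose_Ubar_mul_mul_Vbar]
  congr 1
  funext m
  rw [Matrix.mulVec_diagonal]

lemma sqNorm_nonneg (v : Fin n → ℂ) : 0 ≤ sqNorm v := Finset.sum_nonneg fun _ _ => sq_nonneg _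

lemma sqNorm_add (d w : Fin n → ℂ) :
    sqNorm (d + w) = sqNorm d + sqNorm w + 2 * (star d ⬝ᵥ w).re := by
  simp only [sqNorm, dotProduct, Complex.re_sum, Finset.mul_sum, ← Finset.sum_add_distrib]
  refine Finset.sum_congr rfl fun m _ => ?_
  rw [← Complex.normSq_eq_norm_sq, ← Complex.normSq_eq_norm_sq, ← Complex.normSq_eq_norm_sq,
    Pi.add_apply, Complex.normSq_add]
  simp

/-- The scaled difference vector `Λ^{1/2} ψ`. -/
noncomputable def scaled (lam : Fin n → ℝ) (ψ : Fin n → ℂ) : Fin n → ℂ :=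
  fun m => ((√(lam m) : ℝ) : ℂ) * ψ m

lemma sqNorm_scaled {lam : Fin n → ℝ} (h : ∀ m, 0 ≤ lam m) (ψ : Fin n → ℂ) :
    sqNorm (scaled lam ψ) = ∑ m, ‖ψ m‖ ^ 2 * lam m := by
  refine Finset.sum_congr rfl fun m _ => ?_
  rw [scaled, norm_mul, mul_pow, Complex.norm_real, Real.norm_eq_abs, sq_abs, Real.sq_sqrt (h m),
    mul_comm]

/-- The direction in which the noise has to move for a pairwise error. -/
noncomputable def SVD.errDir {H : Matrix (Fin Nr) (Fin Nt) ℂ} (D : SVD H)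
    (ψ : Fin (min Nt Nr) → ℂ) : Fin Nr → ℂ := -star (D.Ubar *ᵥ scaled D.lam ψ)

lemma SVD.sqNorm_errDir {H : Matrix (Fin Nr) (Fin Nt) ℂ} (D : SVD H)
    (ψ : Fin (min Nt Nr) → ℂ) : sqNorm (D.errDir ψ) = sqNorm (scaled D.lam ψ) := by
  rw [← sqNorm_mulVec D.conjTranspose_Ubar_mul, ← sqNorm_star, SVD.errDir]
  simp [sqNorm]

/-- The quadratic noise term is common to both metrics, so their difference is affine in the noise
and a pairwise comparison is a half-space. -/
lemma SVD.metric_received {H : Matrix (Fin Nr) (Fin Nt) ℂ} (D : SVD H)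
    (s s' : Fin (min Nt Nr) → ℂ) (ν : Fin Nr → ℂ) :
    metric D.lam (D.received s ν) s' = metric D.lam (D.received s ν) s +
      (sqNorm (scaled D.lam (s - s')) - 2 * (D.errDir (s - s') ⬝ᵥ ν).re) := by
  have h1 : ∀ s', metric D.lam (D.received s ν) s' =
      sqNorm (scaled D.lam (s - s') + D.Ubarᴴ *ᵥ ν) := fun s' => by
    rw [metric, D.received_eq]
    congr 1
    funext m
    simp only [Pi.add_apply, scaled, Pi.sub_apply]
    ring
  have h2 : (D.errDir (s - s') ⬝ᵥ ν).re = -(star (scaled D.lam (s - s')) ⬝ᵥ (D.Ubarᴴ *ᵥ ν)).re := by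
    rw [SVD.errDir, Matrix.star_mulVec, Matrix.dotProduct_mulVec, neg_dotProduct, Complex.neg_re]
  have h3 : scaled D.lam (s - s) = 0 := by
    funext m
    simp [scaled]
  rw [h1, h1 s, h3, zero_add, h2, sqNorm_add]
  ring

variable {N₀ : ℝ}

/-- With `Q` the squared distance, the projected noise is real Gaussian of variance `N₀ Q / 2`, and
`(Q / 2)² / (N₀ Q) = Q / (4 N₀) = ∑ a_m λ_m`. The closed half-space serves the upper bound, where
ties may be decided wrongly, the open one the lower bound. -/
lemma SVD.noiseLaw_halfspace {H : Matrix (Fin Nr) (Fin Nt) ℂ} (D : SVD H) (hN : 0 < N₀)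
    {ψ : Fin (min Nt Nr) → ℂ} (hψ : ψ ≠ 0) (hpos : ∀ m, 0 < D.lam m) :
    noiseLaw Nr N₀ {ν | sqNorm (scaled D.lam ψ) / 2 ≤ (D.errDir ψ ⬝ᵥ ν).re} =
        gaussTail (∑ m, coefA ψ N₀ m * D.lam m) ∧
      noiseLaw Nr N₀ {ν | sqNorm (scaled D.lam ψ) / 2 < (D.errDir ψ ⬝ᵥ ν).re} =
        gaussTail (∑ m, coefA ψ N₀ m * D.lam m) := by
  have hq := sqNorm_scaled (fun m => (hpos m).le) ψ
  set Q := sqNorm (scaled D.lam ψ) with hQ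
  have hQ0 : 0 < Q := by
    obtain ⟨m, hm⟩ := Function.ne_iff.1 hψ
    rw [hq]
    refine Finset.sum_pos' (fun i _ => mul_nonneg (sq_nonneg _) (hpos i).le)
      ⟨m, Finset.mem_univ _, mul_pos (pow_pos (norm_pos_iff.2 hm) 2) (hpos m)⟩
  have hmap := pi_cgauss_map_re_dotProduct N₀.toNNReal (D.errDir ψ)
  rw [D.sqNorm_errDir, ← hQ] at hmap
  have hv : (0 : ℝ≥0) < N₀.toNNReal / 2 * Q.toNNReal := by
    have := Real.toNNReal_pos.2 hN
    have := Real.toNNReal_pos.2 hQ0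
    positivity
  have hy : (Q / 2) ^ 2 / (2 * ((N₀.toNNReal / 2 * Q.toNNReal : ℝ≥0) : ℝ)) =
      ∑ m, coefA ψ N₀ m * D.lam m := by
    have h1 : ∑ m, coefA ψ N₀ m * D.lam m = Q / (4 * N₀) := by
      rw [hq, Finset.sum_div]
      exact Finset.sum_congr rfl fun m _ => by rw [coefA]; ring
    rw [h1]
    push_cast
    rw [Real.coe_toNNReal _ hN.le, Real.coe_toNNReal _ hQ0.le]
    field_simp
    ring
  have hmeas : Measurable fun ν : Fin Nr → ℂ => (D.errDir ψ ⬝ᵥ ν).re := by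
    unfold dotProduct
    fun_prop
  constructor
  · rw [← hy, ← gaussianReal_Ici (half_pos hQ0) hv, ← hmap, Measure.map_apply hmeas measurableSet_Ici]
    rfl
  · rw [← hy, ← gaussianReal_Ioi (half_pos hQ0) hv, ← hmap, Measure.map_apply hmeas measurableSet_Ioi]
    rfl

lemma Code.diff_ne_zero (S : Code n L M) {q : (Fin L → Fin M) × (Fin L → Fin M)}
    (hq : q.1 ≠ q.2) : S.diff q ≠ 0 := fun h => hq (S.injective (sub_eq_zero.1 h))

variable {S : Code (min Nt Nr) L M}
  {dec : (Fin (min Nt Nr) → ℝ) → (Fin (min Nt Nr) → ℂ) → (Fin L → Fin M)}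

lemma SVD.noiseLaw_error_le {H : Matrix (Fin Nr) (Fin Nt) ℂ} (D : SVD H) (hN : 0 < N₀)
    (hdec : S.IsML dec) (hpos : ∀ m, 0 < D.lam m) (u : Fin L → Fin M) :
    noiseLaw Nr N₀ {ν | dec D.lam (D.received (S.symbol u) ν) ≠ u} ≤
      ∑ u' ∈ Finset.univ.erase u, gaussTail (∑ m, coefA (S.diff (u, u')) N₀ m * D.lam m) := by
  have hsub : {ν | dec D.lam (D.received (S.symbol u) ν) ≠ u} ⊆
      ⋃ u' ∈ Finset.univ.erase u, {ν | sqNorm (scaled D.lam (S.diff (u, u'))) / 2 ≤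
        (D.errDir (S.diff (u, u')) ⬝ᵥ ν).re} := by
    intro ν hν
    refine Set.mem_iUnion₂.2 ⟨_, Finset.mem_erase.2 ⟨hν, Finset.mem_univ _⟩, ?_⟩
    have h := hdec D.lam (D.received (S.symbol u) ν) u
    rw [D.metric_received] at h
    suffices h' : sqNorm (scaled D.lam (S.symbol u - S.symbol
        (dec D.lam (D.received (S.symbol u) ν)))) / 2 ≤ (D.errDir (S.symbol u - S.symbol
          (dec D.lam (D.received (S.symbol u) ν))) ⬝ᵥ ν).re from h'
    linarith
  refine (measure_mono hsub).trans ((measure_biUnion_finset_le _ _).trans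
    (Finset.sum_le_sum fun u' hu' => le_of_eq ?_))
  exact (D.noiseLaw_halfspace hN (S.diff_ne_zero (Finset.ne_of_mem_erase hu').symm) hpos).1

/-- A strictly better competitor excludes a correct decision, however ties are broken. -/
lemma SVD.le_noiseLaw_error {H : Matrix (Fin Nr) (Fin Nt) ℂ} (D : SVD H) (hN : 0 < N₀)
    (hdec : S.IsML dec) (hpos : ∀ m, 0 < D.lam m) {u u' : Fin L → Fin M} (hu : u ≠ u') :
    gaussTail (∑ m, coefA (S.diff (u, u')) N₀ m * D.lam m) ≤
      noiseLaw Nr N₀ {ν | dec D.lam (D.received (S.symbol u) ν) ≠ u} := by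
  rw [← (D.noiseLaw_halfspace hN (S.diff_ne_zero (q := (u, u')) hu) hpos).2]
  refine measure_mono fun ν hν hcon => ?_
  have h := hdec D.lam (D.received (S.symbol u) ν) u'
  rw [hcon, D.metric_received (S.symbol u) (S.symbol u')] at h
  have hν' : sqNorm (scaled D.lam (S.symbol u - S.symbol u')) / 2 <
      (D.errDir (S.symbol u - S.symbol u') ⬝ᵥ ν).re := hν
  linarith

lemma ae_lamLaw_pos : ∀ᵐ x ∂lamLaw Nt Nr, ∀ m, 0 < x m := by
  refine (withDensity_absolutelyContinuous _ _).ae_le ?_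
  rw [← Measure.restrict_congr_set strictCone_ae_eq_ordDomain]
  filter_upwards [ae_restrict_mem isOpen_strictCone.measurableSet] with x hx using hx.2

/-- The probability of a wrong decision for one message. -/
noncomputable def msgError (S : Code (min Nt Nr) L M)
    (svd : ∀ H : Matrix (Fin Nr) (Fin Nt) ℂ, SVD H)
    (dec : (Fin (min Nt Nr) → ℝ) → (Fin (min Nt Nr) → ℂ) → (Fin L → Fin M)) (N₀ : ℝ)
    (u : Fin L → Fin M) : ℝ≥0∞ :=
  ∫⁻ H, noiseLaw Nr N₀ {ν | dec (svd (Matrix.of H)).lam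
    ((svd (Matrix.of H)).received (S.symbol u) ν) ≠ u} ∂channelLaw Nt Nr

variable (svd : ∀ H : Matrix (Fin Nr) (Fin Nt) ℂ, SVD H)

lemma measurable_gaussTail_sum (a : Fin n → ℝ) :
    Measurable fun x : Fin n → ℝ => gaussTail (∑ m, a m * x m) :=
  measurable_gaussTail.comp (by fun_prop)

instance isProbabilityMeasure_noiseLaw : IsProbabilityMeasure (noiseLaw Nr N₀) := by
  unfold noiseLaw
  infer_instance

lemma msgError_le (hN : 0 < N₀) (hdec : S.IsML dec) (u : Fin L → Fin M) :
    msgError S svd dec N₀ u ≤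
      ∑ u' ∈ Finset.univ.erase u, pairError Nt Nr (coefA (S.diff (u, u')) N₀) := by
  have hms : MeasurableSet {x : Fin (min Nt Nr) → ℝ | ∀ m, 0 < x m} := measurableSet_pos _
  have hm : Measurable fun x : Fin (min Nt Nr) → ℝ =>
      ∑ u' ∈ Finset.univ.erase u, gaussTail (∑ m, coefA (S.diff (u, u')) N₀ m * x m) :=
    Finset.measurable_sum _ fun u' _ => measurable_gaussTail_sum _
  have hm2 : Measurable ({x : Fin (min Nt Nr) → ℝ | ∀ m, 0 < x m}ᶜ.indicator
      (1 : (Fin (min Nt Nr) → ℝ) → ℝ≥0∞)) :=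
    measurable_one.indicator hms.compl
  -- The error probability need not be measurable in `H`. It is dominated by a measurable function
  -- of the eigenvalues; the indicator covers the channels with a vanishing eigenvalue, where the
  -- pairwise formula is not available.
  have h1 : msgError S svd dec N₀ u ≤ ∫⁻ H, ((fun x : Fin (min Nt Nr) → ℝ =>
      (∑ u' ∈ Finset.univ.erase u, gaussTail (∑ m, coefA (S.diff (u, u')) N₀ m * x m)) +
        {x : Fin (min Nt Nr) → ℝ | ∀ m, 0 < x m}ᶜ.indicator 1 x) (svd (Matrix.of H)).lam)
          ∂channelLaw Nt Nr := by
    refine lintegral_mono fun H => ?_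
    by_cases hpos : ∀ m, 0 < (svd (Matrix.of H)).lam m
    · exact ((svd (Matrix.of H)).noiseLaw_error_le hN hdec hpos u).trans le_self_add
    · refine le_trans prob_le_one (le_trans (le_of_eq ?_) le_add_self)
      rw [Set.indicator_of_mem]
      · rfl
      · exact hpos
  refine h1.trans (le_of_eq ?_)
  refine (lintegral_svd_lam svd (hm.add hm2)).trans ((lintegral_add_left hm _).trans ?_)
  rw [lintegral_finsetSum _ fun u' _ => measurable_gaussTail_sum _]
  have h2 : ∫⁻ x, {x : Fin (min Nt Nr) → ℝ | ∀ m, 0 < x m}ᶜ.indicator (1 : (Fin (min Nt Nr) → ℝ) → ℝ≥0∞) x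
      ∂lamLaw Nt Nr = 0 := by
    rw [lintegral_indicator_one hms.compl]
    exact ae_lamLaw_pos
  rw [h2, add_zero]
  rfl

lemma le_msgError (hN : 0 < N₀) (hdec : S.IsML dec) {u u' : Fin L → Fin M} (hu : u ≠ u') :
    pairError Nt Nr (coefA (S.diff (u, u')) N₀) ≤ msgError S svd dec N₀ u := by
  have hms : MeasurableSet {x : Fin (min Nt Nr) → ℝ | ∀ m, 0 < x m} := measurableSet_pos _
  have hm := (measurable_gaussTail_sum (coefA (S.diff (u, u')) N₀)).indicator hms
  have h1 : pairError Nt Nr (coefA (S.diff (u, u')) N₀) =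
      ∫⁻ x, {x : Fin (min Nt Nr) → ℝ | ∀ m, 0 < x m}.indicator
        (fun x => gaussTail (∑ m, coefA (S.diff (u, u')) N₀ m * x m)) x ∂lamLaw Nt Nr := by
    refine lintegral_congr_ae ?_
    filter_upwards [ae_lamLaw_pos] with x hx
    rw [Set.indicator_of_mem]
    exact hx
  rw [h1, ← lintegral_svd_lam svd hm]
  refine lintegral_mono fun H => ?_
  by_cases hpos : ∀ m, 0 < (svd (Matrix.of H)).lam m
  · dsimp only
    rw [Set.indicator_of_mem (by exact hpos)]
    exact (svd (Matrix.of H)).le_noiseLaw_error hN hdec hpos hu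
  · dsimp only
    rw [Set.indicator_of_notMem (by exact hpos)]
    exact zero_le

lemma msgError_ne_top (u : Fin L → Fin M) : msgError S svd dec N₀ u ≠ ∞ := by
  have hP : channelLaw Nt Nr Set.univ = 1 := by
    rw [channelLaw]
    exact measure_univ
  refine ne_top_of_le_ne_top ENNReal.one_ne_top
    ((lintegral_mono (g := fun _ => 1) fun H => prob_le_one).trans ?_)
  rw [lintegral_const, hP, mul_one]

end ErrorEvents

end SLMIMO
namespace SLMIMO

/-! ### High signal-to-noise ratio -/

section HighSNR

variable {n L M Nt Nr : ℕ}

/-- A nonzero vector has a first nonzero entry, whose index is the number of leading zeros. -/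
lemma exists_leadingZeros {ψ : Fin n → ℂ} (hψ : ψ ≠ 0) :
    ∃ i₀ : Fin n, (i₀ : ℕ) = leadingZeros ψ ∧ ψ i₀ ≠ 0 ∧ ∀ m < i₀, ψ m = 0 := by
  classical
  obtain ⟨i, hi⟩ := Function.ne_iff.1 hψ
  obtain ⟨i₀, h₀, hmin⟩ := (Finset.univ.filter fun i => ψ i ≠ 0).exists_min_image id
    ⟨i, Finset.mem_filter.2 ⟨Finset.mem_univ _, hi⟩⟩
  have h₀' : ψ i₀ ≠ 0 := (Finset.mem_filter.1 h₀).2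
  have hlt : ∀ m < i₀, ψ m = 0 := fun m hm => by
    by_contra hcon
    exact absurd (hmin m (Finset.mem_filter.2 ⟨Finset.mem_univ _, hcon⟩)) (not_le.2 hm)
  refine ⟨i₀, ?_, h₀', hlt⟩
  have hset : {m : Fin n | ∀ k, k ≤ m → ψ k = 0} = (Finset.Iio i₀ : Set (Fin n)) := by
    ext m
    rw [Finset.coe_Iio, Set.mem_Iio]
    constructor
    · intro h
      by_contra hcon
      exact h₀' (h i₀ (not_lt.1 hcon))
    · intro h k hk
      exact hlt k (hk.trans_lt h)
  rw [leadingZeros, hset, Set.ncard_coe_finset, Fin.card_Iio]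

lemma two_rpow_eta (hM : 2 ≤ M) : (2 : ℝ) ^ eta L M = (M : ℝ) ^ L := by
  have hM0 : (0 : ℝ) < M := by
    have : 0 < M := by omega
    exact_mod_cast this
  rw [eta, mul_comm, Real.rpow_mul two_pos.le, Real.rpow_logb two_pos (by norm_num) hM0,
    Real.rpow_natCast]

lemma exists_ne_messages (hL : 0 < L) (hM : 2 ≤ M) : ∃ u u' : Fin L → Fin M, u ≠ u' :=
  ⟨fun _ => ⟨0, by omega⟩, fun _ => ⟨1, by omega⟩, fun h => by
    simpa using congrArg Fin.val (congrFun h ⟨0, hL⟩)⟩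

lemma Code.power_pos (S : Code n L M) (hL : 0 < L) (hM : 2 ≤ M) : 0 < S.power := by
  obtain ⟨u, u', hu⟩ := exists_ne_messages hL hM
  have hM0 : (0 : ℝ) < M := by
    have : 0 < M := by omega
    exact_mod_cast this
  refine mul_pos (by positivity) ?_
  by_contra hcon
  have h0 : ∑ u, sqNorm (S.symbol u) = 0 :=
    le_antisymm (not_lt.1 hcon) (Finset.sum_nonneg fun _ _ => sqNorm_nonneg _)
  have h1 := (Finset.sum_eq_zero_iff_of_nonneg fun _ _ => sqNorm_nonneg _).1 h0
  have h2 : ∀ u, S.symbol u = 0 := fun u => funext fun m => by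
    have := (Finset.sum_eq_zero_iff_of_nonneg fun _ _ => sq_nonneg _).1
      (h1 u (Finset.mem_univ _)) m (Finset.mem_univ _)
    simpa using this
  exact hu (S.injective ((h2 u).trans (h2 u').symm))

/-- The coefficient of a pair of messages at unit signal-to-noise ratio. -/
noncomputable def Code.coef (S : Code n L M) (q : (Fin L → Fin M) × (Fin L → Fin M)) : Fin n → ℝ :=
  coefA (S.diff q) S.power

lemma Code.coefA_noiseVar (S : Code n L M) (q : (Fin L → Fin M) × (Fin L → Fin M)) (γ : ℝ) :
    coefA (S.diff q) (S.noiseVar γ) = fun m => γ * S.coef q m := by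
  funext m
  rw [Code.coef, coefA, coefA, Code.noiseVar]
  rw [mul_div_assoc', div_div_eq_mul_div]
  ring

lemma Code.coefB_noiseVar (S : Code n L M) (q : (Fin L → Fin M) × (Fin L → Fin M)) (γ : ℝ) :
    coefB (S.diff q) (S.noiseVar γ) = fun m => (4 / 3 * γ) * S.coef q m := by
  funext m
  rw [Code.coef, coefB, coefA, Code.noiseVar]
  rw [mul_div_assoc', div_div_eq_mul_div]
  ring

/-- The diversity order of a pair of messages. -/
noncomputable def Code.pairDiversity (S : Code (min Nt Nr) L M)
    (q : (Fin L → Fin M) × (Fin L → Fin M)) : ℕ := diversity Nt Nr (leadingZeros (S.diff q))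

/-- The weight of the union bound at diversity order `K`. -/
noncomputable def boundWeight (K : ℕ) : ℝ := 1 / 12 + 1 / 4 * (3 / 4) ^ K

lemma boundWeight_pos (K : ℕ) : 0 < boundWeight K := by
  unfold boundWeight
  positivity

variable (S : Code (min Nt Nr) L M)

/-- As `b_m = 4 / 3 * a_m`, the second term is the same function at `4 / 3 * γ`, which costs the
factor `(3 / 4) ^ K`. -/
lemma tendsto_scaled {K : ℕ} {f : ℝ → ℝ} {c : ℝ}
    (h : Tendsto (fun t : ℝ => t ^ K * f t) atTop (nhds c)) :
    Tendsto (fun γ : ℝ => γ ^ K * (1 / 12 * f γ + 1 / 4 * f (4 / 3 * γ))) atTop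
      (nhds (c * boundWeight K)) := by
  have h1 := h.comp (tendsto_id.const_mul_atTop (by norm_num : (0 : ℝ) < 4 / 3))
  have h2 := (h.const_mul (1 / 12)).add (h1.const_mul (1 / 4 * (3 / 4) ^ K))
  have h3 : 1 / 12 * c + 1 / 4 * (3 / 4) ^ K * c = c * boundWeight K := by
    rw [boundWeight]
    ring
  rw [h3] at h2
  refine h2.congr fun γ => ?_
  simp only [Function.comp_apply, id, mul_pow]
  have : (3 / 4 : ℝ) ^ K * (4 / 3) ^ K = 1 := by
    rw [← mul_pow]
    norm_num
  linear_combination (1 / 4 * γ ^ K * f (4 / 3 * γ)) * this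

/-- The asymptotics of all the quantities attached to a pair of messages. -/
lemma exists_pair_asymptotics (hL : 0 < L) (hM : 2 ≤ M)
    {q : (Fin L → Fin M) × (Fin L → Fin M)} (hq : q.1 ≠ q.2) :
    ∃ c : ℝ, 0 < c ∧ 1 ≤ S.pairDiversity q ∧
      Tendsto (fun γ : ℝ => γ ^ S.pairDiversity q * (I1 Nt Nr (S.diff q) (S.noiseVar γ) +
        I2 Nt Nr (S.diff q) (S.noiseVar γ))) atTop (nhds (c * boundWeight (S.pairDiversity q))) ∧
      Tendsto (fun γ : ℝ => γ ^ S.pairDiversity q *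
        (I1tilde Nt Nr (leadingZeros (S.diff q)) (S.diff q) (S.noiseVar γ) +
          I2tilde Nt Nr (leadingZeros (S.diff q)) (S.diff q) (S.noiseVar γ))) atTop
        (nhds (c * boundWeight (S.pairDiversity q))) ∧
      Tendsto (fun γ : ℝ => γ ^ S.pairDiversity q *
        (pairError Nt Nr (coefA (S.diff q) (S.noiseVar γ))).toReal) atTop
        (nhds (c * tailMoment (S.pairDiversity q))) := by
  obtain ⟨i₀, hi₀, hne, hz⟩ := exists_leadingZeros (S.diff_ne_zero hq)
  have hP := S.power_pos hL hM
  have ha : ∀ m, 0 ≤ S.coef q m := fun m => by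
    unfold Code.coef coefA
    positivity
  have ha0 : ∀ m < i₀, S.coef q m = 0 := fun m hm => by
    simp [Code.coef, coefA, hz m hm]
  have hpos : 0 < S.coef q i₀ := by
    have := norm_pos_iff.2 hne
    unfold Code.coef coefA
    positivity
  obtain ⟨c, hc, h1, h2⟩ := exists_tendsto_mgfNeg i₀ ha ha0 hpos
  have h3 := tendsto_pairError i₀ ha hc h1
  rw [hi₀] at h1 h2 h3
  refine ⟨c, hc, ?_, ?_, ?_, ?_⟩
  -- The first nonzero entry itself contributes one; `tailMoment_lt` needs this.
  · rw [Code.pairDiversity, diversity, sum_tailWeight (hi₀ ▸ i₀.2.le)]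
    have := i₀.2
    omega
  · refine (tendsto_scaled h1).congr fun γ => ?_
    rw [I1, I2, S.coefA_noiseVar, S.coefB_noiseVar, Code.pairDiversity]
  · refine (tendsto_scaled h2).congr fun γ => ?_
    rw [I1tilde, I2tilde, S.coefA_noiseVar, S.coefB_noiseVar, Code.pairDiversity]
  · refine h3.congr fun γ => ?_
    rw [S.coefA_noiseVar, Code.pairDiversity]

lemma isEquivalent_of_tendsto_scaled {f g : ℝ → ℝ} {K : ℕ} {c : ℝ} (hc : 0 < c)
    (hf : Tendsto (fun t => t ^ K * f t) atTop (nhds c))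
    (hg : Tendsto (fun t => t ^ K * g t) atTop (nhds c)) : f ~[atTop] g := by
  refine (isEquivalent_iff_tendsto_one ?_).2 ?_
  · filter_upwards [hg.eventually (lt_mem_nhds hc)] with t ht h0
    simp [h0] at ht
  · have h := hf.div hg hc.ne'
    rw [div_self hc.ne'] at h
    refine h.congr' ?_
    filter_upwards [eventually_gt_atTop 0] with t ht
    exact mul_div_mul_left _ _ (pow_pos ht K).ne'

lemma isBigO_of_scaled {f g : ℝ → ℝ} {K : ℕ} {c δ : ℝ} (hδ : 0 < δ)
    (hf : Tendsto (fun t => t ^ K * f t) atTop (nhds c))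
    (hg : ∀ᶠ t in atTop, δ ≤ t ^ K * g t) : f =O[atTop] g := by
  refine IsBigO.of_bound ((|c| + 1) / δ) ?_
  have hf' := hf.abs.eventually (gt_mem_nhds (lt_add_one |c|))
  filter_upwards [hf', hg, eventually_gt_atTop 0] with t h1 h2 ht
  have hpos : 0 < t ^ K := pow_pos ht K
  rw [abs_mul, abs_of_pos hpos] at h1
  rw [Real.norm_eq_abs, Real.norm_eq_abs]
  have h3 : δ ≤ t ^ K * |g t| := h2.trans (mul_le_mul_of_nonneg_left (le_abs_self _) hpos.le)
  rw [div_mul_eq_mul_div, le_div_iff₀ hδ]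
  have h4 : t ^ K * (|f t| * δ) ≤ t ^ K * ((|c| + 1) * |g t|) := by
    calc t ^ K * (|f t| * δ) = (t ^ K * |f t|) * δ := by ring
      _ ≤ (|c| + 1) * (t ^ K * |g t|) := mul_le_mul h1.le h3 hδ.le (by positivity)
      _ = _ := by ring
  exact le_of_mul_le_mul_left h4 hpos

lemma Code.leadingZeros_le_maxZeros {q : (Fin L → Fin M) × (Fin L → Fin M)} (hq : q.1 ≠ q.2) :
    leadingZeros (S.diff q) ≤ S.maxZeros :=
  Finset.le_sup (f := fun q => leadingZeros (S.diff q))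
    (Finset.mem_offDiag.2 ⟨Finset.mem_univ _, Finset.mem_univ _, hq⟩)

lemma Code.maxPairs_nonempty (hL : 0 < L) (hM : 2 ≤ M) : S.maxPairs.Nonempty := by
  obtain ⟨u, u', hu⟩ := exists_ne_messages hL hM
  have hne : (Finset.univ : Finset (Fin L → Fin M)).offDiag.Nonempty :=
    ⟨(u, u'), Finset.mem_offDiag.2 ⟨Finset.mem_univ _, Finset.mem_univ _, hu⟩⟩
  obtain ⟨q, hq, h⟩ := Finset.exists_mem_eq_sup _ hne fun q => leadingZeros (S.diff q)
  exact ⟨q, Finset.mem_filter.2 ⟨hq, h.symm⟩⟩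

lemma Code.maxPairs_ne {q : (Fin L → Fin M) × (Fin L → Fin M)} (hq : q ∈ S.maxPairs) :
    q.1 ≠ q.2 := (Finset.mem_offDiag.1 (Finset.mem_filter.1 hq).1).2.2

lemma Code.leadingZeros_of_mem_maxPairs {q : (Fin L → Fin M) × (Fin L → Fin M)}
    (hq : q ∈ S.maxPairs) : leadingZeros (S.diff q) = S.maxZeros := (Finset.mem_filter.1 hq).2

/-- The union bound and its approximation have the same limit after scaling. -/
lemma exists_tendsto_unionBound (hL : 0 < L) (hM : 2 ≤ M) :
    ∃ c : ℝ, 0 < c ∧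
      Tendsto (fun γ : ℝ => γ ^ diversity Nt Nr S.maxZeros * unionBound S (S.noiseVar γ)) atTop
        (nhds c) ∧
      Tendsto (fun γ : ℝ => γ ^ diversity Nt Nr S.maxZeros * asymAwep S (S.noiseVar γ)) atTop
        (nhds c) := by
  have hpair := fun q : {q : (Fin L → Fin M) × (Fin L → Fin M) // q.1 ≠ q.2} =>
    exists_pair_asymptotics S hL hM q.2
  choose c hc _ hI hIt _ using hpair
  set K := diversity Nt Nr S.maxZeros with hK
  have hM0 : (0 : ℝ) < (M : ℝ) ^ L := by
    have : 0 < M := by omega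
    positivity
  set C : ℝ := 1 / (2 : ℝ) ^ eta L M * ∑ q ∈ S.maxPairs.attach,
    c ⟨q, S.maxPairs_ne q.2⟩ * boundWeight K with hC
  have hKq : ∀ q ∈ S.maxPairs, S.pairDiversity q = K := fun q hq => by
    rw [Code.pairDiversity, S.leadingZeros_of_mem_maxPairs hq]
  refine ⟨C, ?_, ?_, ?_⟩
  · refine mul_pos (by rw [two_rpow_eta hM]; positivity) (Finset.sum_pos (fun q _ =>
      mul_pos (hc _) (boundWeight_pos K)) ?_)
    obtain ⟨q, hq⟩ := S.maxPairs_nonempty hL hM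
    exact ⟨⟨q, hq⟩, Finset.mem_attach _ _⟩
  -- Fewer leading zeros mean a strictly larger diversity order, hence a negligible contribution.
  · have hrest : ∀ q ∈ (Finset.univ : Finset (Fin L → Fin M)).offDiag \ S.maxPairs,
        Tendsto (fun γ : ℝ => γ ^ K * (I1 Nt Nr (S.diff q) (S.noiseVar γ) +
          I2 Nt Nr (S.diff q) (S.noiseVar γ))) atTop (nhds 0) := by
      intro q hq
      obtain ⟨hq1, hq2⟩ := Finset.mem_sdiff.1 hq
      have hne := (Finset.mem_offDiag.1 hq1).2.2
      have hlt : leadingZeros (S.diff q) < S.maxZeros :=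
        lt_of_le_of_ne (S.leadingZeros_le_maxZeros hne)
          fun h => hq2 (Finset.mem_filter.2 ⟨hq1, h⟩)
      have hmax : S.maxZeros ≤ min Nt Nr := by
        obtain ⟨q', hq'⟩ := S.maxPairs_nonempty hL hM
        obtain ⟨i, hi, -⟩ := exists_leadingZeros (S.diff_ne_zero (S.maxPairs_ne hq'))
        rw [← S.leadingZeros_of_mem_maxPairs hq', ← hi]
        exact i.2.le
      obtain ⟨k, hk⟩ := Nat.exists_eq_add_of_lt (diversity_lt (Nt := Nt) (Nr := Nr) hlt hmax)
      have h0 : Tendsto (fun t : ℝ => (t⁻¹) ^ (k + 1)) atTop (nhds 0) := by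
        have := (tendsto_inv_atTop_zero (𝕜 := ℝ)).pow (k + 1)
        rwa [zero_pow (Nat.succ_ne_zero k)] at this
      have h1 := h0.mul (hI ⟨q, hne⟩)
      rw [zero_mul] at h1
      refine h1.congr' ?_
      filter_upwards [eventually_gt_atTop 0] with t ht
      rw [Code.pairDiversity, hk, ← hK, add_assoc, pow_add, inv_pow]
      field_simp
      ring
    have h := ((tendsto_finsetSum _ hrest).add (tendsto_finsetSum S.maxPairs.attach fun q _ =>
      hI ⟨q, S.maxPairs_ne q.2⟩)).const_mul (1 / (2 : ℝ) ^ eta L M)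
    simp only [hKq _ (Subtype.prop _), Finset.sum_const_zero, zero_add] at h
    refine h.congr fun γ => ?_
    rw [unionBound, mul_left_comm, Finset.mul_sum _ _ (γ ^ K)]
    congr 1
    rw [← Finset.sum_sdiff (Finset.filter_subset (fun q => leadingZeros (S.diff q) = S.maxZeros)
      (Finset.univ : Finset (Fin L → Fin M)).offDiag)]
    congr 1
    exact Finset.sum_attach S.maxPairs fun q => γ ^ K * (I1 Nt Nr (S.diff q) (S.noiseVar γ) +
      I2 Nt Nr (S.diff q) (S.noiseVar γ))
  · have h := (tendsto_finsetSum S.maxPairs.attach fun q _ =>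
      hIt ⟨q, S.maxPairs_ne q.2⟩).const_mul (1 / (2 : ℝ) ^ eta L M)
    simp only [hKq _ (Subtype.prop _), S.leadingZeros_of_mem_maxPairs (Subtype.prop _)] at h
    refine h.congr fun γ => ?_
    rw [asymAwep, mul_left_comm, Finset.mul_sum _ _ (γ ^ K)]
    congr 1
    exact Finset.sum_attach S.maxPairs fun q => γ ^ K *
      (I1tilde Nt Nr S.maxZeros (S.diff q) (S.noiseVar γ) +
        I2tilde Nt Nr S.maxZeros (S.diff q) (S.noiseVar γ))

variable (svd : ∀ H : Matrix (Fin Nr) (Fin Nt) ℂ, SVD H)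
  {dec : (Fin (min Nt Nr) → ℝ) → (Fin (min Nt Nr) → ℂ) → (Fin L → Fin M)}

lemma awep_eq (N₀ : ℝ) :
    awep S svd dec N₀ = 1 / (M : ℝ) ^ L * ∑ u, (msgError S svd dec N₀ u).toReal := rfl

/-- The expression `1 / 12 * exp (-y) + 1 / 4 * exp (-(4 / 3 * y))` does not dominate the Gaussian
tail at `y = 0`, so the comparison cannot be pointwise in the channel. After averaging, both sides
decay with the same order and the same `c`, and for each of the finitely many pairs `tailMoment_lt`
decides at large SNR. -/
lemma eventually_awep_le (hL : 0 < L) (hM : 2 ≤ M) (hdec : S.IsML dec) :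
    ∀ᶠ γ : ℝ in atTop, awep S svd dec (S.noiseVar γ) ≤ unionBound S (S.noiseVar γ) := by
  have hpair : ∀ q ∈ (Finset.univ : Finset (Fin L → Fin M)).offDiag, ∀ᶠ γ : ℝ in atTop,
      (pairError Nt Nr (coefA (S.diff q) (S.noiseVar γ))).toReal ≤
        I1 Nt Nr (S.diff q) (S.noiseVar γ) + I2 Nt Nr (S.diff q) (S.noiseVar γ) := by
    intro q hq
    obtain ⟨c, hc, hK, h1, -, h2⟩ := exists_pair_asymptotics S hL hM (Finset.mem_offDiag.1 hq).2.2
    have hlt : c * tailMoment (S.pairDiversity q) < c * boundWeight (S.pairDiversity q) :=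
      mul_lt_mul_of_pos_left (tailMoment_lt hK) hc
    filter_upwards [h2.eventually_lt h1 hlt, eventually_gt_atTop 0] with γ hγ hγ0
    exact (lt_of_mul_lt_mul_left hγ (pow_pos hγ0 _).le).le
  have hP := S.power_pos hL hM
  filter_upwards [(Finset.eventually_all _).2 hpair, eventually_gt_atTop 0] with γ hγ hγ0
  have hN : 0 < S.noiseVar γ := div_pos hP hγ0
  rw [awep_eq, unionBound, two_rpow_eta hM]
  refine mul_le_mul_of_nonneg_left ?_ (by positivity)
  have h1 : ∀ u, (msgError S svd dec (S.noiseVar γ) u).toReal ≤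
      ∑ u' ∈ Finset.univ.erase u,
        (I1 Nt Nr (S.diff (u, u')) (S.noiseVar γ) + I2 Nt Nr (S.diff (u, u')) (S.noiseVar γ)) := by
    intro u
    have hfin : ∀ u' ∈ Finset.univ.erase u,
        pairError Nt Nr (coefA (S.diff (u, u')) (S.noiseVar γ)) ≠ ∞ := fun u' _ =>
      pairError_ne_top _ fun m => by
        unfold coefA
        positivity
    refine (ENNReal.toReal_mono (ENNReal.sum_ne_top.2 hfin) (msgError_le svd hN hdec u)).trans ?_
    rw [ENNReal.toReal_sum hfin]
    exact Finset.sum_le_sum fun u' hu' => hγ (u, u') (Finset.mem_offDiag.2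
      ⟨Finset.mem_univ _, Finset.mem_univ _, (Finset.ne_of_mem_erase hu').symm⟩)
  refine (Finset.sum_le_sum fun u _ => h1 u).trans (le_of_eq ?_)
  rw [Finset.sum_sigma']
  refine Finset.sum_bij' (fun x _ => (x.1, x.2)) (fun q _ => ⟨q.1, q.2⟩) ?_ ?_ ?_ ?_ ?_
  · intro x hx
    simpa [eq_comm] using hx
  · intro q hq
    simpa [eq_comm] using hq
  all_goals intros; rfl

/-- One pair with the maximal number of leading zeros already has the full order, and its pairwise
error bounds the error of its first message from below. -/
lemma exists_le_awep (hL : 0 < L) (hM : 2 ≤ M) (hdec : S.IsML dec) :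
    ∃ δ : ℝ, 0 < δ ∧ ∀ᶠ γ : ℝ in atTop,
      δ ≤ γ ^ diversity Nt Nr S.maxZeros * awep S svd dec (S.noiseVar γ) := by
  obtain ⟨q, hq⟩ := S.maxPairs_nonempty hL hM
  obtain ⟨c, hc, -, -, -, h⟩ := exists_pair_asymptotics S hL hM (S.maxPairs_ne hq)
  rw [Code.pairDiversity, S.leadingZeros_of_mem_maxPairs hq] at h
  set K := diversity Nt Nr S.maxZeros with hK
  have hM0 : (0 : ℝ) < (M : ℝ) ^ L := by
    have : 0 < M := by omega
    positivity
  have hlim : 0 < c * tailMoment K := mul_pos hc (tailMoment_pos K)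
  refine ⟨1 / (M : ℝ) ^ L * (c * tailMoment K / 2), by positivity, ?_⟩
  have hP := S.power_pos hL hM
  filter_upwards [h.eventually (lt_mem_nhds (half_lt_self hlim)), eventually_gt_atTop 0]
    with γ hγ hγ0
  have hN : 0 < S.noiseVar γ := div_pos hP hγ0
  rw [awep_eq, mul_left_comm]
  refine mul_le_mul_of_nonneg_left (hγ.le.trans (mul_le_mul_of_nonneg_left ?_
    (pow_pos hγ0 _).le)) (by positivity)
  refine (ENNReal.toReal_mono (msgError_ne_top svd q.1)
    (le_msgError svd hN hdec (S.maxPairs_ne hq))).trans ?_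
  exact Finset.single_le_sum (f := fun u => (msgError S svd dec (S.noiseVar γ) u).toReal)
    (fun _ _ => ENNReal.toReal_nonneg) (Finset.mem_univ q.1)

end HighSNR

end SLMIMO

theorem theorem1 (Nt Nr L M : ℕ) (hL : 0 < L) (hM : 2 ≤ M)
    (S : SLMIMO.Code (min Nt Nr) L M)
    (svd : ∀ H : Matrix (Fin Nr) (Fin Nt) ℂ, SLMIMO.SVD H)
    (dec : (Fin (min Nt Nr) → ℝ) → (Fin (min Nt Nr) → ℂ) → (Fin L → Fin M))
    (hdec : S.IsML dec) :
    ((fun γ : ℝ => SLMIMO.unionBound S (S.noiseVar γ)) ~[atTop]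
        fun γ : ℝ => SLMIMO.asymAwep S (S.noiseVar γ)) ∧
      (∀ᶠ γ : ℝ in atTop,
        SLMIMO.awep S svd dec (S.noiseVar γ) ≤ SLMIMO.unionBound S (S.noiseVar γ)) ∧
      ((fun γ : ℝ => SLMIMO.awep S svd dec (S.noiseVar γ)) =Θ[atTop]
        fun γ : ℝ => SLMIMO.asymAwep S (S.noiseVar γ)) := by
  obtain ⟨c, hc, h1, h2⟩ := SLMIMO.exists_tendsto_unionBound S hL hM
  obtain ⟨δ, hδ, hlow⟩ := SLMIMO.exists_le_awep S svd hL hM hdec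
  have hle := SLMIMO.eventually_awep_le S svd hL hM hdec
  have hequiv := SLMIMO.isEquivalent_of_tendsto_scaled hc h1 h2
  -- The upper half of `Θ` passes through the union bound and its equivalent; the lower half
  -- compares the scaled quantities.
  refine ⟨hequiv, hle, IsBigO.trans (IsBigO.of_bound 1 ?_) hequiv.isBigO,
    SLMIMO.isBigO_of_scaled hδ h2 hlow⟩
  filter_upwards [hle, hlow, eventually_gt_atTop 0] with γ h hl hγ
  have h0 : 0 ≤ SLMIMO.awep S svd dec (S.noiseVar γ) :=
    (pos_of_mul_pos_right (hδ.trans_le hl) (pow_pos hγ _).le).le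
  rw [one_mul, Real.norm_of_nonneg h0]
  exact h.trans (le_abs_self _)
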